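/- **Setting.** Let $J=(J_x)_{x\in\mathbb Z^2}$ be non-negative reals with $J_x=J_{-x}$, with $J_x=0$ whenever $|x|>R$ for some $R>0$ ($|x|$ is the Euclidean norm), and with $J_x>0$ whenever $|x|=1$. Let $\beta\ge 0$ and let $q\ge 1$ be real. The bonds are the unordered pairs $e=\{x,y\}$ of distinct sites of $\mathbb Z^2$ with $J_e:=J_{y-x}>0$; let $\mathcal E$ be the set of bonds, $\Omega=\{0,1\}^{\mathcal E}$ with the product $\sigma$-algebra $\mathcal F$, and $p_e=1-e^{-2\beta J_e}$. The open clusters of $\omega\in\Omega$ are the connected components of the graph on $\mathbb Z^2$ with edges $\{e:\omega(e)=1\}$; $A\leftrightarrow B$ is the event that some site of $A$ and some site of $B$ lie in the same open cluster. For finite $\Lambda\subset\mathbb Z^2$ let $\mathcal E^\Lambda$ be the set of bonds with both endpoints in $\Lambda$, let $\mathcal T_\Lambda$ be the $\sigma$-algebra generated by the $\omega(e)$ with $e\in\mathcal E\setminus\mathcal E^\Lambda$, and let $\mathfrak N_\Lambda(\omega)$ be the number of open clusters of $\omega$ that intersect $\Lambda$. For $\eta\in\Omega$ let $\mathbb P_\Lambda^\eta$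 be the probability measure on $\Omega$ supported on the finitely many $\omega$ that agree with $\eta$ on $\mathcal E\setminus\mathcal E^\Lambda$, with $$\mathbb P^\eta_\Lambda(\omega)=\frac1{Z^\eta_\Lambda}\,q^{\mathfrak N_\Lambda(\omega)}\prod_{e\in\mathcal E^\Lambda}p_e^{\omega(e)}(1-p_e)^{1-\omega(e)}$$ for those $\omega$, where $Z^\eta_\Lambda$ is the normalizing constant. Write $\mathbb P^{\mathrm w}_\Lambda$ for $\eta\equiv1$. An infinite-volume random cluster measure for $(J,\beta,q)$ is a probability measure $\mathbb P$ on $(\Omega,\mathcal F)$ such that, for all $A\in\mathcal F$ and all finite $\Lambda\subset\mathbb Z^2$, $\mathbb P(A\mid\mathcal T_\Lambda)(\eta)=\mathbb P^\eta_\Lambda(A)$ for $\mathbb P$-a.e. $\eta$. **Proposition A.1.** Suppose that there is a unique infinite-volume random cluster measure $\mathbb P$ for $(J,\beta,q)$, and that for some $c_1>0$ $$\mathbb P(0\leftrightarrow x)\le e^{-c_1|x|}\qquad\text{for all }x\in\mathbb Z^2.$$ Then there are constants $\nu_0,\nu_1>0$ such that, with $\Lambda_N=\{-N,\dots,N\}^2$,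 $$\mathbb P^{\mathrm w}_{\Lambda_N}\bigl(0\leftrightarrow\mathbb Z^2\setminus\Lambda_N\bigr)\le\nu_0e^{-\nu_1N}\qquad\text{for every integer }N\ge0.$$ -/

import Mathlib

open MeasureTheory ProbabilityTheory

/-- The Euclidean norm of a point of `ℤ^d`. -/
noncomputable def latticeNorm {d : ℕ} (x : Fin d → ℤ) : ℝ :=
  Real.sqrt (∑ i, (x i : ℝ) ^ 2)

/-- The box `{-N, …, N}^d`. -/
noncomputable def latticeBox (d N : ℕ) : Finset (Fin d → ℤ) :=
  Fintype.piFinset fun _ => Finset.Icc (-(N : ℤ)) (N : ℤ)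

/-- Finite-range coupling constants on `ℤ^d`: non-negative, symmetric, vanishing beyond some
range, and positive on nearest neighbours. -/
structure FiniteRangeCoupling (d : ℕ) where
  J : (Fin d → ℤ) → ℝ
  nonneg : ∀ x, 0 ≤ J x
  symm : ∀ x, J (-x) = J x
  finite_range : ∃ R : ℝ, 0 < R ∧ ∀ x, R < latticeNorm x → J x = 0
  nearest_pos : ∀ x, latticeNorm x = 1 → 0 < J x

namespace FiniteRangeCoupling

variable {d : ℕ} (C : FiniteRangeCoupling d)

theorem J_sub_comm (x y : Fin d → ℤ) : C.J (y - x) = C.J (x - y) := by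
  rw [← C.symm (x - y), neg_sub]

/-- The graph on `ℤ^d` whose edges are the bonds: the unordered pairs of (distinct) sites
with `J (y - x) > 0`. -/
def bondGraph : SimpleGraph (Fin d → ℤ) where
  Adj x y := x ≠ y ∧ 0 < C.J (y - x)
  symm := ⟨fun x y h => ⟨h.1.symm, by rw [← C.J_sub_comm]; exact h.2⟩⟩
  loopless := ⟨fun _ h => h.1 rfl⟩

/-- The set of bonds, as a type. -/
abbrev Bond : Type := C.bondGraph.edgeSet

/-- Bond configurations (`true` is open, `false` is closed), with the product σ-algebra. -/
abbrev Config : Type := C.Bond → Bool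

/-- The coupling `J_e = J (y - x)` of the bond `e = {x, y}`. -/
def bondJ (e : C.Bond) : ℝ :=
  Sym2.lift ⟨fun x y => C.J (y - x), C.J_sub_comm⟩ e.1

/-- The probability parameter `p_e = 1 - exp (-2 β J_e)`. -/
noncomputable def bondProb (β : ℝ) (e : C.Bond) : ℝ :=
  1 - Real.exp (-2 * β * C.bondJ e)

open Classical in
/-- The bonds with both endpoints in `Λ`. -/
noncomputable def bondsIn (Λ : Finset (Fin d → ℤ)) : Finset C.Bond :=
  Λ.sym2.subtype (fun e => e ∈ C.bondGraph.edgeSet)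

/-- The graph of open bonds of a configuration; its connected components are the
open clusters. -/
def openGraph (ω : C.Config) : SimpleGraph (Fin d → ℤ) where
  Adj x y := ∃ h : s(x, y) ∈ C.bondGraph.edgeSet, ω ⟨s(x, y), h⟩ = true
  symm := ⟨fun x y h => by rwa [Sym2.eq_swap]⟩
  loopless := ⟨fun _ h => C.bondGraph.loopless.irrefl _ h.1⟩

/-- The event `A ↔ B`: some site of `A` lies in the same open cluster as some site of `B`. -/
def connects (A B : Set (Fin d → ℤ)) : Set C.Config :=
  {ω | ∃ x ∈ A, ∃ y ∈ B, (C.openGraph ω).Reachable x y}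

/-- The number of open clusters of `ω` that intersect `Λ`. -/
noncomputable def numClusters (Λ : Finset (Fin d → ℤ)) (ω : C.Config) : ℕ :=
  ((C.openGraph ω).connectedComponentMk '' (Λ : Set (Fin d → ℤ))).ncard

/-- The random cluster weight
`∏ p_e^{ω(e)} (1 - p_e)^{1 - ω(e)} q^{(number of clusters meeting Λ)}`,
the product being over the bonds `e` inside `Λ`. -/
noncomputable def weight (β q : ℝ) (Λ : Finset (Fin d → ℤ)) (ω : C.Config) : ℝ :=
  (∏ e ∈ C.bondsIn Λ, if ω e = true then C.bondProb β e else 1 - C.bondProb β e) *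
    q ^ C.numClusters Λ ω

open Classical in
/-- The configuration that equals `ζ` on the bonds inside `Λ` and `η` on all other bonds.
For fixed `η`, these are exactly the configurations that agree with `η` off the bonds
inside `Λ`, each obtained from exactly one `ζ`. -/
noncomputable def glue (Λ : Finset (Fin d → ℤ)) (η : C.Config)
    (ζ : C.bondsIn Λ → Bool) : C.Config :=
  fun e => if h : e ∈ C.bondsIn Λ then ζ ⟨e, h⟩ else η e

open Classical in
/-- The partition function in `Λ` with boundary condition `η`. -/
noncomputable def partitionFunction (β q : ℝ) (Λ : Finset (Fin d → ℤ)) (η : C.Config) : ℝ :=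
  ∑ ζ : C.bondsIn Λ → Bool, C.weight β q Λ (C.glue Λ η ζ)

open Classical in
/-- The finite-volume random cluster measure in `Λ` with boundary condition `η`: it gives mass
`weight ω / Z` to each `ω` that agrees with `η` off the bonds inside `Λ`, and no mass to
other configurations. -/
noncomputable def finiteVolume (β q : ℝ) (Λ : Finset (Fin d → ℤ)) (η : C.Config) :
    Measure C.Config :=
  ∑ ζ : C.bondsIn Λ → Bool,
    ENNReal.ofReal ((C.partitionFunction β q Λ η)⁻¹ * C.weight β q Λ (C.glue Λ η ζ)) •
      Measure.dirac (C.glue Λ η ζ)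

/-- The wired finite-volume measure: all bonds not inside `Λ` are open. -/
noncomputable def wired (β q : ℝ) (Λ : Finset (Fin d → ℤ)) : Measure C.Config :=
  C.finiteVolume β q Λ (fun _ => true)

/-- The σ-algebra generated by the states of the bonds that are not inside `Λ`. -/
abbrev outside (Λ : Finset (Fin d → ℤ)) : MeasurableSpace C.Config :=
  ⨆ e : {e : C.Bond // e ∉ C.bondsIn Λ},
    MeasurableSpace.comap (fun ω : C.Config => ω e.1) inferInstance

/-- Infinite-volume random cluster measures: the probability measures that satisfy the
DLR equations. -/
structure IsRandomCluster (β q : ℝ) (P : Measure C.Config) : Prop where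
  isProbabilityMeasure : IsProbabilityMeasure P
  dlr : ∀ (A : Set C.Config), MeasurableSet A → ∀ Λ : Finset (Fin d → ℤ),
    P⟦A | C.outside Λ⟧ =ᵐ[P] fun η => (C.finiteVolume β q Λ η).real A

end FiniteRangeCoupling

/-! The wired measure dominates `P` on increasing events, so decay under `P` gives no direct bound.
Two steps bridge the gap.

Soft step (`tendsto_arm`): the wired probability `arm L` that the centre of a box of radius `L`
reaches the complement of the box tends to 0. For β > 0, a limit point of the wired measures is
translation invariant and tolerates local changes, so it has at most one infinite cluster by a
Burton–Keane argument (`ae_uniqueInfinite`). Opening all far-away bonds can then no longer merge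
clusters that meet a fixed finite set, and this continuity in the boundary condition gives the limit
point the DLR equations. Hence it is `P`, under which long connections from the origin are unlikely.
The case β = 0 is trivial.

Quantitative step (`arm_le`, `exists_arm_le_exp`): in a wired box of radius `N`, take a layer as
thick as the range `r` at depth about `L`, and count its sites connected to the complement of the
box. If there are many, there are many arms of length `L` in disjoint boxes; these are dominated by
independent events of probability `arm L`, and once `arm L` is small this beats the entropy
(`prob_many_hits_le`). If there are few, closing every bond at these sites costs little and
separates the origin from the boundary, while the origin stays connected to a site at distance
nearly `N`. A connection that avoids the wired boundary is no more likely than under `P`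
(`prob_wired_truncated_le`), so the assumed decay applies (`prob_arm_few_hits_le`). A planar layer
has only order `N` sites, so all entropy and closing costs can be kept below a fraction of `c₁ N`.

The tools throughout are Holley's inequality (`expect_mono_boundary`), consistency of the
finite-volume measures (`expect_expect`) and single-bond finite energy (`prob_update_le`). -/

namespace SimpleGraph

/-! ### Paths leaving a vertex set. -/

variable {V : Type*}

/-- The subgraph of `G` whose edges have both endpoints in `S`. -/
def within (G : SimpleGraph V) (S : Set V) : SimpleGraph V where
  Adj x y := G.Adj x y ∧ x ∈ S ∧ y ∈ S
  symm := ⟨fun _ _ h => ⟨h.1.symm, h.2.2, h.2.1⟩⟩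
  loopless := ⟨fun _ h => G.loopless.irrefl _ h.1⟩

theorem within_le (G : SimpleGraph V) (S : Set V) : G.within S ≤ G := fun _ _ h => h.1

/-- The first step of a walk out of `S`. Keeping the initial segment inside `S` shows later which
bonds an exit event depends on. -/
theorem Reachable.exists_exit {G : SimpleGraph V} {S : Set V} {x y : V} (h : G.Reachable x y)
    (hx : x ∈ S) (hy : y ∉ S) :
    ∃ u v, (G.within S).Reachable x u ∧ u ∈ S ∧ v ∉ S ∧ G.Adj u v := by
  obtain ⟨p⟩ := h
  induction p with
  | nil => exact absurd hx hy
  | @cons a b c hab p ih =>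
    by_cases hb : b ∈ S
    · obtain ⟨u, v, h1, h2⟩ := ih hb hy
      exact ⟨u, v, Reachable.trans (Adj.reachable ⟨hab, hx, hb⟩) h1, h2⟩
    · exact ⟨a, b, Reachable.refl _, hx, hb, hab⟩

theorem Reachable.mem_of_closed {G : SimpleGraph V} {S : Set V} {x y : V} (h : G.Reachable x y)
    (hx : x ∈ S) (hS : ∀ u v, u ∈ S → G.Adj u v → v ∈ S) : y ∈ S := by
  by_contra hy
  obtain ⟨u, v, -, hu, hv, huv⟩ := h.exists_exit hx hy
  exact hv (hS u v hu huv)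

end SimpleGraph

/-! ### Cluster counts, the lattice condition, boundary monotonicity and consistency. -/

namespace FiniteRangeCoupling

section

open Classical

variable {d : ℕ} (C : FiniteRangeCoupling d)

theorem mem_bondsIn {Λ : Finset (Fin d → ℤ)} {x y : Fin d → ℤ} (h : s(x, y) ∈ C.bondGraph.edgeSet) :
    (⟨s(x, y), h⟩ : C.Bond) ∈ C.bondsIn Λ ↔ x ∈ Λ ∧ y ∈ Λ := by
  simp [bondsIn]

theorem bondsIn_mono {Λ Δ : Finset (Fin d → ℤ)} (h : Λ ⊆ Δ) : C.bondsIn Λ ⊆ C.bondsIn Δ := by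
  rintro ⟨e, he⟩
  induction e using Sym2.ind with
  | _ x y => rw [mem_bondsIn, mem_bondsIn]; exact fun hh => ⟨h hh.1, h hh.2⟩

theorem openGraph_mono {ω ω' : C.Config} (h : ω ≤ ω') : C.openGraph ω ≤ C.openGraph ω' := by
  rintro x y ⟨hxy, ho⟩
  exact ⟨hxy, Bool.le_iff_imp.1 (h ⟨s(x, y), hxy⟩) ho⟩

theorem connects_mono {A B : Set (Fin d → ℤ)} {ω ω' : C.Config} (h : ω ≤ ω')
    (hω : ω ∈ C.connects A B) : ω' ∈ C.connects A B := by
  obtain ⟨x, hx, y, hy, hr⟩ := hω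
  exact ⟨x, hx, y, hy, hr.mono (C.openGraph_mono h)⟩

theorem bondJ_pos (e : C.Bond) : 0 < C.bondJ e := by
  obtain ⟨e, he⟩ := e
  induction e using Sym2.ind with
  | _ x y => exact he.2

theorem bondProb_nonneg {β : ℝ} (hβ : 0 ≤ β) (e : C.Bond) : 0 ≤ C.bondProb β e := by
  have := C.bondJ_pos e
  rw [bondProb, sub_nonneg, Real.exp_le_one_iff]
  nlinarith [mul_nonneg hβ this.le]

theorem bondProb_pos {β : ℝ} (hβ : 0 < β) (e : C.Bond) : 0 < C.bondProb β e := by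
  have := C.bondJ_pos e
  rw [bondProb, sub_pos, Real.exp_lt_one_iff]
  nlinarith [mul_pos hβ this]

theorem one_sub_bondProb_pos (β : ℝ) (e : C.Bond) : 0 < 1 - C.bondProb β e := by
  simp [bondProb, Real.exp_pos]

/-- The open cluster of a site. -/
def cluster (ω : C.Config) (x : Fin d → ℤ) : Set (Fin d → ℤ) := {y | (C.openGraph ω).Reachable x y}

theorem mem_cluster {ω : C.Config} {x y : Fin d → ℤ} :
    y ∈ C.cluster ω x ↔ (C.openGraph ω).Reachable x y := Iff.rfl

theorem cluster_eq_iff {ω : C.Config} {x y : Fin d → ℤ} :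
    C.cluster ω x = C.cluster ω y ↔ (C.openGraph ω).Reachable x y := by
  constructor
  · intro h
    have : y ∈ C.cluster ω y := SimpleGraph.Reachable.refl _
    rwa [← h] at this
  · intro h
    ext z
    exact ⟨fun hz => h.symm.trans hz, fun hz => h.trans hz⟩

theorem numClusters_eq (Λ : Finset (Fin d → ℤ)) (ω : C.Config) :
    C.numClusters Λ ω = (C.cluster ω '' (Λ : Set (Fin d → ℤ))).ncard := by
  have hsupp : C.cluster ω = fun x => ((C.openGraph ω).connectedComponentMk x).supp := by
    funext x
    ext y
    simp only [mem_cluster, SimpleGraph.ConnectedComponent.mem_supp_iff,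
      SimpleGraph.ConnectedComponent.eq]
    exact ⟨fun h => h.symm, fun h => h.symm⟩
  rw [hsupp, numClusters, ← Set.image_image SimpleGraph.ConnectedComponent.supp,
    Set.ncard_image_of_injective _ SimpleGraph.ConnectedComponent.supp_injective]

/-- Clusters meeting `Λ` correspond to classes of sites of `Λ`, so the boundary condition enters the
weight only through the connections it creates between those sites. -/
theorem numClusters_congr {Λ : Finset (Fin d → ℤ)} {ω ω' : C.Config}
    (h : ∀ x ∈ Λ, ∀ y ∈ Λ, (C.openGraph ω).Reachable x y ↔ (C.openGraph ω').Reachable x y) :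
    C.numClusters Λ ω = C.numClusters Λ ω' := by
  rw [numClusters, numClusters]
  -- The map passes through a representative in `Λ`; the `else` value is never reached, since every
  -- class in the image has one.
  refine Set.ncard_congr
    (fun c _ => if hc : ∃ x ∈ Λ, (C.openGraph ω).connectedComponentMk x = c then
      (C.openGraph ω').connectedComponentMk hc.choose
      else (C.openGraph ω').connectedComponentMk 0) ?_ ?_ ?_
  · rintro _ ⟨x, hx, rfl⟩
    have hc : ∃ y ∈ Λ, (C.openGraph ω).connectedComponentMk y =
      (C.openGraph ω).connectedComponentMk x := ⟨x, hx, rfl⟩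
    rw [dif_pos hc]
    exact ⟨_, hc.choose_spec.1, rfl⟩
  · rintro _ _ ⟨x, hx, rfl⟩ ⟨y, hy, rfl⟩ hxy
    have hc : ∃ z ∈ Λ, (C.openGraph ω).connectedComponentMk z =
      (C.openGraph ω).connectedComponentMk x := ⟨x, hx, rfl⟩
    have hc' : ∃ z ∈ Λ, (C.openGraph ω).connectedComponentMk z =
      (C.openGraph ω).connectedComponentMk y := ⟨y, hy, rfl⟩
    simp only [dif_pos hc, dif_pos hc'] at hxy
    rw [← hc.choose_spec.2, ← hc'.choose_spec.2]
    rw [SimpleGraph.ConnectedComponent.eq] at hxy ⊢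
    exact (h _ hc.choose_spec.1 _ hc'.choose_spec.1).2 hxy
  · rintro _ ⟨x, hx, rfl⟩
    have hc : ∃ z ∈ Λ, (C.openGraph ω).connectedComponentMk z =
      (C.openGraph ω).connectedComponentMk x := ⟨x, hx, rfl⟩
    refine ⟨_, ⟨x, hx, rfl⟩, ?_⟩
    rw [dif_pos hc, SimpleGraph.ConnectedComponent.eq]
    exact (h _ hc.choose_spec.1 _ hx).1 (SimpleGraph.ConnectedComponent.eq.1 hc.choose_spec.2)

theorem numClusters_le (Λ : Finset (Fin d → ℤ)) (ω : C.Config) : C.numClusters Λ ω ≤ Λ.card := by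
  rw [numClusters]
  exact (Set.ncard_image_le Λ.finite_toSet).trans (by simp)

/-- Functions on the lattice that are constant on the open clusters. -/
def clusterFunctions (ω : C.Config) : Submodule ℝ ((Fin d → ℤ) → ℝ) where
  carrier := {f | ∀ x y, (C.openGraph ω).Adj x y → f x = f y}
  add_mem' := fun hf hg x y h => by simp [hf x y h, hg x y h]
  zero_mem' := fun _ _ _ => rfl
  smul_mem' := fun c f hf x y h => by simp [hf x y h]

theorem clusterFunctions_reachable {ω : C.Config} {f : (Fin d → ℤ) → ℝ}
    (hf : f ∈ C.clusterFunctions ω) {x y : Fin d → ℤ} (h : (C.openGraph ω).Reachable x y) :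
    f x = f y :=
  h.mem_of_closed (S := {z | f x = f z}) rfl fun u v hu huv => hu.trans (hf u v huv)

/-- Restrictions to `Λ` of functions that are constant on the open clusters. -/
def clusterFunctionsOn (Λ : Finset (Fin d → ℤ)) (ω : C.Config) : Submodule ℝ (Λ → ℝ) :=
  (C.clusterFunctions ω).map (LinearMap.funLeft ℝ ℝ (Subtype.val : Λ → (Fin d → ℤ)))

/-- A function constant on clusters is a free choice of one value per cluster meeting `Λ`. Counting
clusters becomes linear algebra, and the dimension formula replaces a bond-by-bond induction. -/
theorem finrank_clusterFunctionsOn (Λ : Finset (Fin d → ℤ)) (ω : C.Config) :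
    Module.finrank ℝ (C.clusterFunctionsOn Λ ω) = C.numClusters Λ ω := by
  set T : Set (C.openGraph ω).ConnectedComponent :=
    (C.openGraph ω).connectedComponentMk '' (Λ : Set (Fin d → ℤ)) with hT
  have hTfin : T.Finite := Λ.finite_toSet.image _
  have : Fintype T := hTfin.fintype
  let g : Λ → T := fun x => ⟨(C.openGraph ω).connectedComponentMk x, x, x.2, rfl⟩
  have hg : Function.Surjective g := by
    rintro ⟨_, x, hx, rfl⟩
    exact ⟨⟨x, hx⟩, rfl⟩
  have hrange : C.clusterFunctionsOn Λ ω = LinearMap.range (LinearMap.funLeft ℝ ℝ g) := by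
    ext f
    constructor
    · rintro ⟨F, hF, rfl⟩
      refine ⟨fun c => F c.2.choose, ?_⟩
      ext x
      have hx := (g x).2
      exact C.clusterFunctions_reachable hF
        (SimpleGraph.ConnectedComponent.eq.1 hx.choose_spec.2)
    · rintro ⟨F, rfl⟩
      refine ⟨fun x => if h : (C.openGraph ω).connectedComponentMk x ∈ T then F ⟨_, h⟩ else 0,
        ?_, ?_⟩
      · intro x y hxy
        have : (C.openGraph ω).connectedComponentMk x = (C.openGraph ω).connectedComponentMk y :=
          SimpleGraph.ConnectedComponent.eq.2 hxy.reachable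
        simp only [this]
      · ext x
        have hx : (C.openGraph ω).connectedComponentMk (x : Fin d → ℤ) ∈ T := ⟨x, x.2, rfl⟩
        simp [LinearMap.funLeft, hx, g]
  rw [hrange, LinearMap.finrank_range_of_inj (LinearMap.funLeft_injective_of_surjective ℝ ℝ g hg),
    Module.finrank_fintype_fun_eq_card, numClusters, ← hT, ← Nat.card_coe_set_eq,
    Nat.card_eq_fintype_card]

/-- The sum of the two function spaces lies in the space of `ω ⊓ ω'`, and their intersection lies in
that of `ω ⊔ ω'`; the dimension formula concludes. In the second inclusion the two extensions off
`Λ` may differ. The extension for `ω'` serves for both, because off `Λ` every bond open in `ω` is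
open in `ω'`. -/
theorem numClusters_supermodular {Λ : Finset (Fin d → ℤ)} {ω ω' : C.Config}
    (h : ∀ e, e ∉ C.bondsIn Λ → ω e ≤ ω' e) :
    C.numClusters Λ ω + C.numClusters Λ ω' ≤
      C.numClusters Λ (ω ⊓ ω') + C.numClusters Λ (ω ⊔ ω') := by
  simp only [← finrank_clusterFunctionsOn]
  rw [← Submodule.finrank_sup_add_finrank_inf_eq]
  gcongr
  · refine Submodule.finrank_mono (sup_le ?_ ?_) <;>
    · refine Submodule.map_mono fun f hf x y hxy => hf x y ?_
      first
      | exact C.openGraph_mono inf_le_left hxy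
      | exact C.openGraph_mono inf_le_right hxy
  · refine Submodule.finrank_mono ?_
    rintro f ⟨⟨F, hF, rfl⟩, ⟨F', hF', hFF⟩⟩
    refine ⟨F', ?_, hFF⟩
    rintro x y ⟨hxy, ho⟩
    by_cases hω' : ω' ⟨s(x, y), hxy⟩ = true
    · exact hF' x y ⟨hxy, hω'⟩
    · have hω : ω ⟨s(x, y), hxy⟩ = true := by simpa [hω'] using ho
      by_cases he : (⟨s(x, y), hxy⟩ : C.Bond) ∈ C.bondsIn Λ
      · obtain ⟨hx, hy⟩ := (C.mem_bondsIn hxy).1 he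
        have h1 := congrFun hFF ⟨x, hx⟩
        have h2 := congrFun hFF ⟨y, hy⟩
        simp only [LinearMap.funLeft_apply] at h1 h2
        rw [h1, h2]
        exact hF x y ⟨hxy, hω⟩
      · exact absurd (Bool.le_iff_imp.1 (h _ he) hω) hω'

theorem weight_nonneg {β q : ℝ} (hβ : 0 ≤ β) (hq : 1 ≤ q) (Λ : Finset (Fin d → ℤ)) (ω : C.Config) :
    0 ≤ C.weight β q Λ ω := by
  refine mul_nonneg (Finset.prod_nonneg fun e _ => ?_) (by positivity)
  split_ifs
  · exact C.bondProb_nonneg hβ e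
  · exact (C.one_sub_bondProb_pos β e).le

/-- The bond factors on both sides are equal, so only the powers of `q` matter, and `1 ≤ q` turns
supermodularity of the cluster count into the FKG lattice condition. Ordered boundary conditions are
allowed to differ, as Holley's inequality requires. -/
theorem weight_lattice {β q : ℝ} (hβ : 0 ≤ β) (hq : 1 ≤ q) {Λ : Finset (Fin d → ℤ)}
    {ω ω' : C.Config} (h : ∀ e, e ∉ C.bondsIn Λ → ω e ≤ ω' e) :
    C.weight β q Λ ω * C.weight β q Λ ω' ≤
      C.weight β q Λ (ω ⊓ ω') * C.weight β q Λ (ω ⊔ ω') := by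
  simp only [weight]
  rw [mul_mul_mul_comm, mul_mul_mul_comm
      (∏ e ∈ C.bondsIn Λ, if (ω ⊓ ω') e = true then C.bondProb β e else 1 - C.bondProb β e),
    ← Finset.prod_mul_distrib, ← Finset.prod_mul_distrib, ← pow_add, ← pow_add]
  have hprod : ∀ e : C.Bond, ((if ω e = true then C.bondProb β e else 1 - C.bondProb β e) *
      if ω' e = true then C.bondProb β e else 1 - C.bondProb β e) =
      ((if (ω ⊓ ω') e = true then C.bondProb β e else 1 - C.bondProb β e) *
      if (ω ⊔ ω') e = true then C.bondProb β e else 1 - C.bondProb β e) := by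
    intro e
    cases h1 : ω e <;> cases h2 : ω' e <;> simp [h1, h2, mul_comm]
  rw [Finset.prod_congr rfl fun e _ => hprod e]
  refine mul_le_mul_of_nonneg_left (pow_le_pow_right₀ hq (C.numClusters_supermodular h)) ?_
  refine Finset.prod_nonneg fun e _ => mul_nonneg ?_ ?_ <;>
  · split_ifs
    · exact C.bondProb_nonneg hβ e
    · exact (C.one_sub_bondProb_pos β e).le

theorem glue_of_mem {Λ : Finset (Fin d → ℤ)} {η : C.Config} {ζ : C.bondsIn Λ → Bool} {e : C.Bond}
    (h : e ∈ C.bondsIn Λ) : C.glue Λ η ζ e = ζ ⟨e, h⟩ := dif_pos h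

theorem glue_of_notMem {Λ : Finset (Fin d → ℤ)} {η : C.Config} {ζ : C.bondsIn Λ → Bool}
    {e : C.Bond} (h : e ∉ C.bondsIn Λ) : C.glue Λ η ζ e = η e := dif_neg h

theorem glue_congr {Λ : Finset (Fin d → ℤ)} {η η' : C.Config}
    (h : ∀ e, e ∉ C.bondsIn Λ → η e = η' e) (ζ : C.bondsIn Λ → Bool) :
    C.glue Λ η ζ = C.glue Λ η' ζ := by
  funext e
  by_cases he : e ∈ C.bondsIn Λ
  · rw [glue_of_mem C he, glue_of_mem C he]
  · rw [glue_of_notMem C he, glue_of_notMem C he, h e he]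

theorem glue_glue {Λ Δ : Finset (Fin d → ℤ)} (h : Λ ⊆ Δ) (η : C.Config) (ζ : C.bondsIn Δ → Bool)
    (ξ : C.bondsIn Λ → Bool) :
    C.glue Λ (C.glue Δ η ζ) ξ =
      C.glue Δ η (fun e => if he : e.1 ∈ C.bondsIn Λ then ξ ⟨e, he⟩ else ζ e) := by
  funext e
  by_cases he : e ∈ C.bondsIn Λ
  · rw [glue_of_mem C he, glue_of_mem C (C.bondsIn_mono h he), dif_pos he]
  · rw [glue_of_notMem C he]
    by_cases he' : e ∈ C.bondsIn Δ
    · rw [glue_of_mem C he', glue_of_mem C he', dif_neg he]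
    · rw [glue_of_notMem C he', glue_of_notMem C he']

theorem partitionFunction_pos {β q : ℝ} (hβ : 0 ≤ β) (hq : 1 ≤ q) (Λ : Finset (Fin d → ℤ))
    (η : C.Config) : 0 < C.partitionFunction β q Λ η := by
  refine Finset.sum_pos' (fun _ _ => C.weight_nonneg hβ hq Λ _)
    ⟨fun _ => false, Finset.mem_univ _, ?_⟩
  refine mul_pos (Finset.prod_pos fun e he => ?_) (by positivity)
  rw [glue_of_mem C he]
  simpa using C.one_sub_bondProb_pos β e

theorem partitionFunction_congr (β q : ℝ) {Λ : Finset (Fin d → ℤ)} {η η' : C.Config}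
    (h : ∀ e, e ∉ C.bondsIn Λ → η e = η' e) :
    C.partitionFunction β q Λ η = C.partitionFunction β q Λ η' := by
  rw [partitionFunction, partitionFunction]
  simp only [C.glue_congr h]

/-- The expectation of `f` under the finite-volume random cluster measure. -/
noncomputable def expect (β q : ℝ) (Λ : Finset (Fin d → ℤ)) (η : C.Config) (f : C.Config → ℝ) : ℝ :=
  (∑ ζ : C.bondsIn Λ → Bool, C.weight β q Λ (C.glue Λ η ζ) * f (C.glue Λ η ζ)) /
    C.partitionFunction β q Λ η

theorem expect_congr (β q : ℝ) {Λ : Finset (Fin d → ℤ)} {η η' : C.Config}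
    (h : ∀ e, e ∉ C.bondsIn Λ → η e = η' e) (f : C.Config → ℝ) :
    C.expect β q Λ η f = C.expect β q Λ η' f := by
  rw [expect, expect, C.partitionFunction_congr β q h]
  simp only [C.glue_congr h]

theorem expect_sum (β q : ℝ) (Λ : Finset (Fin d → ℤ)) (η : C.Config) {ι : Type*} (s : Finset ι)
    (f : ι → C.Config → ℝ) :
    C.expect β q Λ η (fun ω => ∑ i ∈ s, f i ω) = ∑ i ∈ s, C.expect β q Λ η (f i) := by
  simp only [expect, Finset.mul_sum, ← Finset.sum_div]
  rw [Finset.sum_comm]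

theorem expect_const_mul (β q : ℝ) (Λ : Finset (Fin d → ℤ)) (η : C.Config) (c : ℝ)
    (f : C.Config → ℝ) :
    C.expect β q Λ η (fun ω => c * f ω) = c * C.expect β q Λ η f := by
  simp only [expect, mul_div_assoc', Finset.mul_sum]
  congr 1
  exact Finset.sum_congr rfl fun _ _ => by ring

theorem expect_pull_out (β q : ℝ) {Λ : Finset (Fin d → ℤ)} (η : C.Config) {g : C.Config → ℝ}
    (hg : ∀ ω ω', (∀ e, e ∉ C.bondsIn Λ → ω e = ω' e) → g ω = g ω') (f : C.Config → ℝ) :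
    C.expect β q Λ η (fun ω => g ω * f ω) = g η * C.expect β q Λ η f := by
  rw [← expect_const_mul, expect, expect]
  congr 1
  refine Finset.sum_congr rfl fun ζ _ => ?_
  rw [hg (C.glue Λ η ζ) η fun e he => C.glue_of_notMem he]

theorem expect_mono {β q : ℝ} (hβ : 0 ≤ β) (hq : 1 ≤ q) (Λ : Finset (Fin d → ℤ)) (η : C.Config)
    {f g : C.Config → ℝ} (h : ∀ ω, (∀ e, e ∉ C.bondsIn Λ → ω e = η e) → f ω ≤ g ω) :
    C.expect β q Λ η f ≤ C.expect β q Λ η g := by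
  rw [expect, expect]
  have := C.partitionFunction_pos hβ hq Λ η
  gcongr with ζ
  · exact C.weight_nonneg hβ hq Λ _
  · exact h _ fun e he => C.glue_of_notMem he

theorem expect_one {β q : ℝ} (hβ : 0 ≤ β) (hq : 1 ≤ q) (Λ : Finset (Fin d → ℤ)) (η : C.Config) :
    C.expect β q Λ η (fun _ => 1) = 1 := by
  simp only [expect, mul_one]
  exact div_self (C.partitionFunction_pos hβ hq Λ η).ne'

theorem expect_const {β q : ℝ} (hβ : 0 ≤ β) (hq : 1 ≤ q) (Λ : Finset (Fin d → ℤ)) (η : C.Config)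
    (c : ℝ) : C.expect β q Λ η (fun _ => c) = c := by
  have := C.expect_const_mul β q Λ η c (fun _ => 1)
  rwa [C.expect_one hβ hq, mul_one] at this

theorem expect_nonneg {β q : ℝ} (hβ : 0 ≤ β) (hq : 1 ≤ q) (Λ : Finset (Fin d → ℤ)) (η : C.Config)
    {f : C.Config → ℝ} (h : ∀ ω, 0 ≤ f ω) : 0 ≤ C.expect β q Λ η f := by
  have := C.expect_mono hβ hq Λ η (f := fun _ => 0) (g := f) fun ω _ => h ω
  rwa [C.expect_const hβ hq] at this

/-- Holley's inequality on the finite cube of inner bonds. It needs one common test function, so `f`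
is first evaluated with the larger boundary condition, which only increases it. -/
theorem expect_mono_boundary {β q : ℝ} (hβ : 0 ≤ β) (hq : 1 ≤ q) (Λ : Finset (Fin d → ℤ))
    {η η' : C.Config} (h : η ≤ η') {f : C.Config → ℝ} (hf : Monotone f) (hf0 : ∀ ω, 0 ≤ f ω) :
    C.expect β q Λ η f ≤ C.expect β q Λ η' f := by
  have hZ := C.partitionFunction_pos hβ hq Λ η
  have hZ' := C.partitionFunction_pos hβ hq Λ η'
  have hglue : ∀ a b : C.bondsIn Λ → Bool, C.glue Λ η (a ⊓ b) = C.glue Λ η a ⊓ C.glue Λ η' b := by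
    intro a b
    funext e
    by_cases he : e ∈ C.bondsIn Λ
    · simp [glue_of_mem C he]
    · simp [glue_of_notMem C he, h e]
  have hglue' : ∀ a b : C.bondsIn Λ → Bool,
      C.glue Λ η' (a ⊔ b) = C.glue Λ η a ⊔ C.glue Λ η' b := by
    intro a b
    funext e
    by_cases he : e ∈ C.bondsIn Λ
    · simp [glue_of_mem C he]
    · simp [glue_of_notMem C he, h e]
  have hle : ∀ a, C.glue Λ η a ≤ C.glue Λ η' a := by
    intro a e
    by_cases he : e ∈ C.bondsIn Λ
    · simp [glue_of_mem C he]
    · simp [glue_of_notMem C he, h e]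
  have key := holley (α := C.bondsIn Λ → Bool) (β := ℝ)
    (μ := fun a => f (C.glue Λ η' a))
    (f := fun a => C.weight β q Λ (C.glue Λ η a) / C.partitionFunction β q Λ η)
    (g := fun a => C.weight β q Λ (C.glue Λ η' a) / C.partitionFunction β q Λ η')
    (fun a => hf0 _)
    (fun a => div_nonneg (C.weight_nonneg hβ hq Λ _) hZ.le)
    (fun a => div_nonneg (C.weight_nonneg hβ hq Λ _) hZ'.le)
    (fun a b hab => hf fun e => by
      by_cases he : e ∈ C.bondsIn Λ
      · simpa [glue_of_mem C he] using hab ⟨e, he⟩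
      · simp [glue_of_notMem C he])
    (by
      rw [← Finset.sum_div, ← Finset.sum_div]
      exact (div_self hZ.ne').trans (div_self hZ'.ne').symm)
    (fun a b => by
      rw [div_mul_div_comm, div_mul_div_comm]
      refine div_le_div_of_nonneg_right ?_ (mul_pos hZ hZ').le
      rw [hglue, hglue']
      refine C.weight_lattice hβ hq fun e he => ?_
      rw [glue_of_notMem C he, glue_of_notMem C he]
      exact h e)
  calc C.expect β q Λ η f
      ≤ ∑ a : C.bondsIn Λ → Bool, f (C.glue Λ η' a) *
        (C.weight β q Λ (C.glue Λ η a) / C.partitionFunction β q Λ η) := by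
        rw [expect, Finset.sum_div]
        refine Finset.sum_le_sum fun a _ => ?_
        rw [mul_comm, mul_div_assoc]
        exact mul_le_mul_of_nonneg_right (hf (hle a))
          (div_nonneg (C.weight_nonneg hβ hq Λ _) hZ.le)
    _ ≤ _ := key
    _ = C.expect β q Λ η' f := by
        rw [expect, Finset.sum_div]
        exact Finset.sum_congr rfl fun a _ => by ring

theorem cluster_subset_of_agree {Λ : Finset (Fin d → ℤ)} {ω ω' : C.Config} {x : Fin d → ℤ}
    (h : ∀ e, e ∉ C.bondsIn Λ → ω e = ω' e) (hx : ∀ y ∈ Λ, y ∉ C.cluster ω x) :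
    C.cluster ω' x ⊆ C.cluster ω x := by
  intro y hy
  refine hy.mem_of_closed (S := C.cluster ω x) (SimpleGraph.Reachable.refl _) ?_
  rintro u v hu ⟨huv, ho⟩
  have he : (⟨s(u, v), huv⟩ : C.Bond) ∉ C.bondsIn Λ := fun hh =>
    hx u ((C.mem_bondsIn huv).1 hh).1 hu
  rw [← h _ he] at ho
  exact SimpleGraph.Reachable.trans hu (SimpleGraph.Adj.reachable ⟨huv, ho⟩)

/-- A cluster that misses `Λ` neither uses nor touches a bond inside `Λ`, so changing those bonds
does not affect it. -/
theorem cluster_eq_of_agree {Λ : Finset (Fin d → ℤ)} {ω ω' : C.Config} {x : Fin d → ℤ}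
    (h : ∀ e, e ∉ C.bondsIn Λ → ω e = ω' e) (hx : ∀ y ∈ Λ, y ∉ C.cluster ω x) :
    C.cluster ω' x = C.cluster ω x := by
  have h1 := C.cluster_subset_of_agree h hx
  exact h1.antisymm
    (C.cluster_subset_of_agree (fun e he => (h e he).symm) fun y hy hy' => hx y hy (h1 hy'))

/-- Clusters that meet `Δ` but miss `Λ` are the same for both configurations, so the excess of the
`Δ`-count over the `Λ`-count depends only on the bonds off `Λ`. -/
theorem numClusters_exchange {Λ Δ : Finset (Fin d → ℤ)} (hΛ : Λ ⊆ Δ) {ω ω' : C.Config}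
    (h : ∀ e, e ∉ C.bondsIn Λ → ω e = ω' e) :
    C.numClusters Δ ω + C.numClusters Λ ω' = C.numClusters Δ ω' + C.numClusters Λ ω := by
  have hsub : ∀ ω : C.Config, C.cluster ω '' (Λ : Set (Fin d → ℤ)) ⊆ C.cluster ω '' Δ :=
    fun ω => Set.image_mono hΛ
  have hsplit : ∀ ω : C.Config, C.numClusters Δ ω =
      (C.cluster ω '' (Δ : Set (Fin d → ℤ)) \ C.cluster ω '' Λ).ncard + C.numClusters Λ ω := by
    intro ω
    rw [numClusters_eq, numClusters_eq,
      Set.ncard_sdiff_add_ncard_of_subset (hsub ω) (Δ.finite_toSet.image _)]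
  have hle : ∀ ω ω' : C.Config, (∀ e, e ∉ C.bondsIn Λ → ω e = ω' e) →
      C.cluster ω '' (Δ : Set (Fin d → ℤ)) \ C.cluster ω '' Λ ⊆
        C.cluster ω' '' (Δ : Set (Fin d → ℤ)) \ C.cluster ω' '' Λ := by
    rintro ω ω' h _ ⟨⟨x, hx, rfl⟩, hx'⟩
    have hxΛ : ∀ y ∈ Λ, y ∉ C.cluster ω x := fun y hy hy' =>
      hx' ⟨y, hy, C.cluster_eq_iff.2 hy'.symm⟩
    have heq := C.cluster_eq_of_agree h hxΛ
    refine ⟨⟨x, hx, heq⟩, ?_⟩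
    rintro ⟨y, hy, hyx⟩
    rw [← heq, cluster_eq_iff] at hyx
    exact hxΛ y hy (heq ▸ hyx.symm)
  rw [hsplit ω, hsplit ω', (hle ω ω' h).antisymm (hle ω' ω fun e he => (h e he).symm)]
  ring

theorem weight_exchange (β q : ℝ) {Λ Δ : Finset (Fin d → ℤ)} (hΛ : Λ ⊆ Δ) {ω ω' : C.Config}
    (h : ∀ e, e ∉ C.bondsIn Λ → ω e = ω' e) :
    C.weight β q Δ ω * C.weight β q Λ ω' = C.weight β q Δ ω' * C.weight β q Λ ω := by
  simp only [weight]
  rw [← Finset.prod_sdiff (C.bondsIn_mono hΛ),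
    ← Finset.prod_sdiff (s₁ := C.bondsIn Λ) (s₂ := C.bondsIn Δ) (C.bondsIn_mono hΛ)]
  have h1 : (∏ e ∈ C.bondsIn Δ \ C.bondsIn Λ,
      if ω e = true then C.bondProb β e else 1 - C.bondProb β e) =
      ∏ e ∈ C.bondsIn Δ \ C.bondsIn Λ,
      if ω' e = true then C.bondProb β e else 1 - C.bondProb β e :=
    Finset.prod_congr rfl fun e he => by rw [h e (Finset.mem_sdiff.1 he).2]
  have h2 : q ^ C.numClusters Δ ω * q ^ C.numClusters Λ ω' =
      q ^ C.numClusters Δ ω' * q ^ C.numClusters Λ ω := by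
    rw [← pow_add, ← pow_add, C.numClusters_exchange hΛ h]
  rw [h1]
  linear_combination (∏ e ∈ C.bondsIn Δ \ C.bondsIn Λ,
      if ω' e = true then C.bondProb β e else 1 - C.bondProb β e) *
    (∏ e ∈ C.bondsIn Λ, if ω e = true then C.bondProb β e else 1 - C.bondProb β e) *
    (∏ e ∈ C.bondsIn Λ, if ω' e = true then C.bondProb β e else 1 - C.bondProb β e) * h2

/-- Resampling inside `Λ` preserves the measure in `Δ`: the exchange identity for weights is
detailed balance. -/
theorem expect_expect {β q : ℝ} (hβ : 0 ≤ β) (hq : 1 ≤ q) {Λ Δ : Finset (Fin d → ℤ)} (h : Λ ⊆ Δ)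
    (η : C.Config) (f : C.Config → ℝ) :
    C.expect β q Δ η (fun ω => C.expect β q Λ ω f) = C.expect β q Δ η f := by
  set ω : (C.bondsIn Δ → Bool) → C.Config := fun ζ => C.glue Δ η ζ with hω
  set m : (C.bondsIn Δ → Bool) → (C.bondsIn Λ → Bool) → (C.bondsIn Δ → Bool) :=
    fun ζ ξ e => if he : e.1 ∈ C.bondsIn Λ then ξ ⟨e, he⟩ else ζ e with hm
  have hgl : ∀ ζ ξ, C.glue Λ (ω ζ) ξ = ω (m ζ ξ) := fun ζ ξ => C.glue_glue h η ζ ξ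
  have hagree : ∀ ζ ξ, ∀ e, e ∉ C.bondsIn Λ → ω ζ e = ω (m ζ ξ) e := fun ζ ξ e he => by
    rw [← hgl, glue_of_notMem C he]
  -- Swap the part of `ζ` inside `Λ` with the fresh sample `ξ`. Reindexing the double sum by this
  -- involution moves the weights from the new configuration to the old one.
  set Φ : (C.bondsIn Δ → Bool) × (C.bondsIn Λ → Bool) →
      (C.bondsIn Δ → Bool) × (C.bondsIn Λ → Bool) :=
    fun p => (m p.1 p.2, fun e => p.1 ⟨e, C.bondsIn_mono h e.2⟩) with hΦ
  have hinv : Function.Involutive Φ := by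
    rintro ⟨ζ, ξ⟩
    simp only [hΦ, hm]
    refine Prod.ext ?_ ?_
    · funext e
      by_cases he : e.1 ∈ C.bondsIn Λ <;> simp [he]
    · funext e
      simp
  rw [expect, expect]
  congr 1
  have hZ := fun ζ => (C.partitionFunction_pos hβ hq Λ (ω ζ)).ne'
  calc ∑ ζ, C.weight β q Δ (ω ζ) * C.expect β q Λ (ω ζ) f
      = ∑ p : (C.bondsIn Δ → Bool) × (C.bondsIn Λ → Bool),
        C.weight β q Δ (ω p.1) * C.weight β q Λ (ω (m p.1 p.2)) * f (ω (m p.1 p.2)) /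
          C.partitionFunction β q Λ (ω p.1) := by
        rw [Fintype.sum_prod_type]
        refine Finset.sum_congr rfl fun ζ _ => ?_
        rw [expect, mul_div_assoc', Finset.mul_sum, Finset.sum_div]
        simp only [hgl, mul_assoc]
    _ = ∑ p : (C.bondsIn Δ → Bool) × (C.bondsIn Λ → Bool),
        C.weight β q Δ (ω p.1) * f (ω p.1) * C.weight β q Λ (ω (m p.1 p.2)) /
          C.partitionFunction β q Λ (ω p.1) := by
        refine Fintype.sum_equiv hinv.toPerm _ _ fun p => ?_
        have h1 : (Φ p).1 = m p.1 p.2 := rfl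
        have h2 : m (Φ p).1 (Φ p).2 = p.1 := congrArg Prod.fst (hinv p)
        simp only [Function.Involutive.coe_toPerm]
        rw [h2, h1, ← C.partitionFunction_congr β q (hagree p.1 p.2)]
        congr 1
        linear_combination f (ω (m p.1 p.2)) * C.weight_exchange β q h (hagree p.1 p.2)
    _ = ∑ ζ, C.weight β q Δ (ω ζ) * f (ω ζ) := by
        rw [Fintype.sum_prod_type]
        refine Finset.sum_congr rfl fun ζ _ => ?_
        dsimp only
        rw [← Finset.sum_div, ← Finset.mul_sum]
        simp only [← hgl]
        exact mul_div_cancel_right₀ _ (hZ ζ)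

end

end FiniteRangeCoupling

/-! ### Boxes and the finite range. -/

namespace FiniteRangeCoupling

section

open Classical

variable {d : ℕ} (C : FiniteRangeCoupling d)

theorem abs_apply_le_latticeNorm (x : Fin d → ℤ) (i : Fin d) : |(x i : ℝ)| ≤ latticeNorm x := by
  rw [latticeNorm, ← Real.sqrt_sq_eq_abs]
  exact Real.sqrt_le_sqrt
    (Finset.single_le_sum (f := fun i => (x i : ℝ) ^ 2) (fun i _ => sq_nonneg _) (Finset.mem_univ i))

/-- The bonds join sites whose coordinates differ by at most `r`. -/
def HasRange (r : ℕ) : Prop := ∀ x y, C.bondGraph.Adj x y → ∀ i, |y i - x i| ≤ r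

theorem exists_hasRange : ∃ r : ℕ, 0 < r ∧ C.HasRange r := by
  obtain ⟨R, hR, h⟩ := C.finite_range
  refine ⟨⌈R⌉₊, Nat.ceil_pos.2 hR, fun x y hxy i => ?_⟩
  have h1 : latticeNorm (y - x) ≤ R := by
    by_contra hlt
    exact hxy.2.ne' (h _ (not_le.1 hlt))
  have h2 := (abs_apply_le_latticeNorm (y - x) i).trans (h1.trans (Nat.le_ceil R))
  simp only [Pi.sub_apply] at h2
  exact_mod_cast h2

theorem mem_latticeBox {N : ℕ} {x : Fin d → ℤ} : x ∈ latticeBox d N ↔ ∀ i, |x i| ≤ N := by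
  simp [latticeBox, Fintype.mem_piFinset, abs_le]

theorem latticeBox_mono {M N : ℕ} (h : M ≤ N) : latticeBox d M ⊆ latticeBox d N := fun x hx =>
  mem_latticeBox.2 fun i => (mem_latticeBox.1 hx i).trans (by exact_mod_cast h)

theorem exists_bondJ_le : ∃ K : ℝ, 0 ≤ K ∧ ∀ e : C.Bond, C.bondJ e ≤ K := by
  obtain ⟨r, -, hr⟩ := C.exists_hasRange
  refine ⟨∑ x ∈ latticeBox d r, C.J x, Finset.sum_nonneg fun x _ => C.nonneg x, ?_⟩
  rintro ⟨e, he⟩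
  induction e using Sym2.ind with
  | _ x y =>
    refine Finset.single_le_sum (f := C.J) (fun x _ => C.nonneg x) (mem_latticeBox.2 fun i => ?_)
    exact hr x y he i

/-- Translation invariance and finite range leave finitely many nonzero couplings, so closing a bond
has a cost bounded uniformly over bonds. -/
theorem exists_closing_bound (β : ℝ) (hβ : 0 ≤ β) :
    ∃ c : ℝ, 0 < c ∧ c ≤ 1 ∧ ∀ e : C.Bond, c ≤ 1 - C.bondProb β e := by
  obtain ⟨K, hK0, hK⟩ := C.exists_bondJ_le
  refine ⟨Real.exp (-2 * β * K), Real.exp_pos _,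
    Real.exp_le_one_iff.2 (by nlinarith [mul_nonneg hβ hK0]), fun e => ?_⟩
  rw [bondProb, sub_sub_cancel, Real.exp_le_exp]
  nlinarith [hK e, mul_le_mul_of_nonneg_left (hK e) hβ]

instance : Countable C.Bond := inferInstance

/-- The probability of `A` under the finite-volume random cluster measure. -/
noncomputable def prob (β q : ℝ) (Λ : Finset (Fin d → ℤ)) (η : C.Config) (A : Set C.Config) : ℝ :=
  C.expect β q Λ η (A.indicator fun _ => 1)

theorem finiteVolume_real {β q : ℝ} (hβ : 0 ≤ β) (hq : 1 ≤ q) (Λ : Finset (Fin d → ℤ))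
    (η : C.Config) (A : Set C.Config) :
    (C.finiteVolume β q Λ η).real A = C.prob β q Λ η A := by
  have h0 : ∀ ζ : C.bondsIn Λ → Bool,
      0 ≤ (C.partitionFunction β q Λ η)⁻¹ * C.weight β q Λ (C.glue Λ η ζ) := fun ζ =>
    mul_nonneg (inv_nonneg.2 (C.partitionFunction_pos hβ hq Λ η).le) (C.weight_nonneg hβ hq Λ _)
  rw [Measure.real, finiteVolume, Measure.finsetSum_apply, ENNReal.toReal_sum, prob, expect,
    Finset.sum_div]
  · refine Finset.sum_congr rfl fun ζ _ => ?_
    rw [Measure.smul_apply, Measure.dirac_apply, smul_eq_mul, ENNReal.toReal_mul,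
      ENNReal.toReal_ofReal (h0 ζ)]
    by_cases h : C.glue Λ η ζ ∈ A
    · simp [h, div_eq_inv_mul]
    · simp [h]
  · intro ζ _
    rw [Measure.smul_apply, Measure.dirac_apply, smul_eq_mul]
    by_cases h : C.glue Λ η ζ ∈ A <;> simp [h, ENNReal.ofReal_ne_top]

/-! ### Finite-volume probabilities and conditioning. -/

section prob

variable {β q : ℝ} (hβ : 0 ≤ β) (hq : 1 ≤ q) (Λ : Finset (Fin d → ℤ)) (η : C.Config)

theorem indicator_one_nonneg (A : Set C.Config) (ω : C.Config) :
    0 ≤ A.indicator (fun _ => (1 : ℝ)) ω := Set.indicator_nonneg (fun _ _ => zero_le_one) _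

include hβ hq

theorem prob_nonneg (A : Set C.Config) : 0 ≤ C.prob β q Λ η A :=
  C.expect_nonneg hβ hq Λ η (C.indicator_one_nonneg A)

theorem prob_mono_of_agree {A B : Set C.Config}
    (h : ∀ ω, (∀ e, e ∉ C.bondsIn Λ → ω e = η e) → ω ∈ A → ω ∈ B) :
    C.prob β q Λ η A ≤ C.prob β q Λ η B := by
  refine C.expect_mono hβ hq Λ η fun ω hω => ?_
  by_cases hA : ω ∈ A
  · simp [hA, h ω hω hA]
  · simpa [hA] using C.indicator_one_nonneg B ω

theorem prob_mono {A B : Set C.Config} (h : A ⊆ B) : C.prob β q Λ η A ≤ C.prob β q Λ η B :=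
  C.prob_mono_of_agree hβ hq Λ η fun _ _ hA => h hA

theorem prob_univ : C.prob β q Λ η Set.univ = 1 := by
  rw [prob, Set.indicator_univ, C.expect_one hβ hq]

theorem prob_le_one (A : Set C.Config) : C.prob β q Λ η A ≤ 1 :=
  (C.prob_mono hβ hq Λ η (Set.subset_univ A)).trans (C.prob_univ hβ hq Λ η).le

theorem prob_biUnion_le {ι : Type*} (s : Finset ι) (A : ι → Set C.Config) :
    C.prob β q Λ η (⋃ i ∈ s, A i) ≤ ∑ i ∈ s, C.prob β q Λ η (A i) := by
  simp only [prob]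
  rw [← expect_sum]
  refine C.expect_mono hβ hq Λ η fun ω _ => ?_
  by_cases h : ω ∈ ⋃ i ∈ s, A i
  · rw [Set.indicator_of_mem h]
    simp only [Set.mem_iUnion] at h
    obtain ⟨i, hi, hA⟩ := h
    calc (1 : ℝ) = (A i).indicator (fun _ => 1) ω := by simp [hA]
      _ ≤ _ := Finset.single_le_sum (f := fun i => (A i).indicator (fun _ => (1 : ℝ)) ω)
        (fun i _ => C.indicator_one_nonneg _ _) hi
  · rw [Set.indicator_of_notMem h]
    exact Finset.sum_nonneg fun i _ => C.indicator_one_nonneg _ _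

theorem prob_mono_boundary {η' : C.Config} (h : η ≤ η') {A : Set C.Config} (hA : IsUpperSet A) :
    C.prob β q Λ η A ≤ C.prob β q Λ η' A := by
  refine C.expect_mono_boundary hβ hq Λ h (fun ω ω' hω => ?_) (C.indicator_one_nonneg A)
  by_cases hm : ω ∈ A
  · simp [hm, hA hω hm]
  · simpa [hm] using C.indicator_one_nonneg A ω'

theorem expect_prob {Δ : Finset (Fin d → ℤ)} (h : Λ ⊆ Δ) (A : Set C.Config) :
    C.expect β q Δ η (fun ω => C.prob β q Λ ω A) = C.prob β q Δ η A :=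
  C.expect_expect hβ hq h η _

omit hβ hq in
theorem prob_inter_of_outside {A B : Set C.Config}
    (hB : ∀ ω ω', (∀ e, e ∉ C.bondsIn Λ → ω e = ω' e) → ω ∈ B → ω' ∈ B) :
    C.prob β q Λ η (A ∩ B) = B.indicator (fun _ => 1) η * C.prob β q Λ η A := by
  rw [prob, prob, ← C.expect_pull_out]
  · congr 1
    ext ω
    by_cases h1 : ω ∈ A <;> by_cases h2 : ω ∈ B <;> simp [h1, h2]
  · intro ω ω' h
    by_cases h1 : ω ∈ B
    · simp [h1, hB ω ω' h h1]
    · have : ω' ∉ B := fun h2 => h1 (hB ω' ω (fun e he => (h e he).symm) h2)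
      simp [h1, this]

/-- If `B` is determined outside `Λ`, and `A` has conditional probability at most `c` on `B`, then
`A ∩ B` has probability at most `c` times that of `B`. -/
theorem prob_inter_le {Δ : Finset (Fin d → ℤ)} (h : Λ ⊆ Δ) {A B : Set C.Config}
    (hB : ∀ ω ω', (∀ e, e ∉ C.bondsIn Λ → ω e = ω' e) → ω ∈ B → ω' ∈ B) {c : ℝ}
    (hc : ∀ ω ∈ B, C.prob β q Λ ω A ≤ c) :
    C.prob β q Δ η (A ∩ B) ≤ c * C.prob β q Δ η B := by
  rw [← C.expect_prob hβ hq Λ η h, prob, ← expect_const_mul]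
  refine C.expect_mono hβ hq Δ η fun ω _ => ?_
  rw [C.prob_inter_of_outside Λ ω hB, mul_comm]
  by_cases hω : ω ∈ B
  · simpa [hω] using hc ω hω
  · simp [hω]

end prob

/-- By consistency, the measure in `Δ` averages measures in `Λ` over random boundary conditions,
each dominated by the wired one. -/
theorem prob_wired_anti {β q : ℝ} (hβ : 0 ≤ β) (hq : 1 ≤ q) {Λ Δ : Finset (Fin d → ℤ)} (h : Λ ⊆ Δ)
    {A : Set C.Config} (hA : IsUpperSet A) :
    C.prob β q Δ (fun _ => true) A ≤ C.prob β q Λ (fun _ => true) A := by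
  rw [← C.expect_prob hβ hq Λ _ h, ← C.expect_const hβ hq Δ (fun _ => true) (C.prob β q Λ _ A)]
  exact C.expect_mono hβ hq Δ _ fun ω _ =>
    C.prob_mono_boundary hβ hq Λ ω (fun e => Bool.le_true _) hA

theorem isUpperSet_connects (A B : Set (Fin d → ℤ)) : IsUpperSet (C.connects A B) :=
  fun _ _ h hω => C.connects_mono h hω

theorem connects_subset {A A' B B' : Set (Fin d → ℤ)} (hA : A ⊆ A') (hB : B ⊆ B') :
    C.connects A B ⊆ C.connects A' B' := by
  rintro ω ⟨x, hx, y, hy, h⟩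
  exact ⟨x, hA hx, y, hB hy, h⟩

/-! ### Finite energy: the cost of changing bonds. -/

section update

variable {β q : ℝ} (hβ : 0 ≤ β) (hq : 1 ≤ q)

/-- Thus the finite-volume measure in `{x, y}` is the resampling of a single bond. -/
theorem bondsIn_pair {x y : Fin d → ℤ} (h : s(x, y) ∈ C.bondGraph.edgeSet) :
    C.bondsIn {x, y} = {⟨s(x, y), h⟩} := by
  ext ⟨e, he⟩
  induction e using Sym2.ind with
  | _ a b =>
    rw [mem_bondsIn]
    simp only [Finset.mem_insert, Finset.mem_singleton, Subtype.mk.injEq, Sym2.eq_iff]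
    have hab : a ≠ b := he.1
    constructor
    · rintro ⟨rfl | rfl, rfl | rfl⟩ <;> simp_all
    · rintro (⟨rfl, rfl⟩ | ⟨rfl, rfl⟩) <;> simp

include hβ hq

/-- At most two clusters meet `{x, y}`, so each of the two weights is at most `q ^ 2` and the
partition function at most `2 * q ^ 2`; since `1 ≤ q`, the weight of the updated configuration is at
least its bond factor. -/
theorem le_prob_pair {x y : Fin d → ℤ} (h : s(x, y) ∈ C.bondGraph.edgeSet) (b : Bool)
    (ω : C.Config) (A : Set C.Config) :
    (if b = true then C.bondProb β ⟨s(x, y), h⟩ else 1 - C.bondProb β ⟨s(x, y), h⟩) *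
      (A.indicator (fun _ => 1) (Function.update ω ⟨s(x, y), h⟩ b)) ≤
      2 * q ^ 2 * C.prob β q {x, y} ω A := by
  set e : C.Bond := ⟨s(x, y), h⟩ with he
  have hp0 := C.bondProb_nonneg hβ e
  have hp1 := (C.one_sub_bondProb_pos β e).le
  have hpair := C.bondsIn_pair h
  have hw : ∀ ω', C.weight β q {x, y} ω' =
      (if ω' e = true then C.bondProb β e else 1 - C.bondProb β e) *
        q ^ C.numClusters {x, y} ω' := fun ω' => by
    rw [weight, hpair, Finset.prod_singleton]
  have hZ : C.partitionFunction β q {x, y} ω ≤ 2 * q ^ 2 := by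
    have hcard : Fintype.card (C.bondsIn {x, y} → Bool) = 2 := by
      rw [Fintype.card_fun, Fintype.card_bool, Fintype.card_coe, hpair, Finset.card_singleton,
        pow_one]
    calc C.partitionFunction β q {x, y} ω ≤ ∑ ζ : C.bondsIn {x, y} → Bool, q ^ 2 := by
          refine Finset.sum_le_sum fun ζ _ => ?_
          rw [hw]
          have h1 : q ^ C.numClusters {x, y} (C.glue {x, y} ω ζ) ≤ q ^ 2 :=
            pow_le_pow_right₀ hq ((C.numClusters_le _ _).trans Finset.card_le_two)
          have h2 : (if C.glue {x, y} ω ζ e = true then C.bondProb β e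
              else 1 - C.bondProb β e) ≤ 1 := by split_ifs <;> linarith
          calc _ ≤ 1 * q ^ C.numClusters {x, y} (C.glue {x, y} ω ζ) := by gcongr
            _ ≤ q ^ 2 := by rwa [one_mul]
      _ = 2 * q ^ 2 := by simp [hcard]
  have hglue : C.glue {x, y} ω (fun _ => b) = Function.update ω e b := by
    funext e'
    by_cases h' : e' = e
    · subst h'
      rw [Function.update_self, glue_of_mem C (by rw [hpair]; simp [he])]
    · rw [Function.update_of_ne h', glue_of_notMem C]
      rw [hpair]
      simpa [he] using h'
  have hZ0 := C.partitionFunction_pos hβ hq {x, y} ω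
  have hterm : C.weight β q {x, y} (Function.update ω e b) *
      A.indicator (fun _ => 1) (Function.update ω e b) ≤
      C.partitionFunction β q {x, y} ω * C.prob β q {x, y} ω A := by
    rw [prob, expect, mul_div_cancel₀ _ hZ0.ne', ← hglue]
    exact Finset.single_le_sum (f := fun ζ => C.weight β q {x, y} (C.glue {x, y} ω ζ) *
      A.indicator (fun _ => 1) (C.glue {x, y} ω ζ)) (fun ζ _ => mul_nonneg
        (C.weight_nonneg hβ hq _ _) (C.indicator_one_nonneg A _)) (Finset.mem_univ _)
  refine le_trans ?_ (hterm.trans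
    (mul_le_mul_of_nonneg_right hZ (C.prob_nonneg hβ hq _ ω A)))
  refine mul_le_mul_of_nonneg_right ?_ (C.indicator_one_nonneg A _)
  rw [hw, Function.update_self]
  refine le_mul_of_one_le_right ?_ (one_le_pow₀ hq)
  split_ifs <;> assumption

theorem prob_update_le {Λ : Finset (Fin d → ℤ)} {e : C.Bond} (he : e ∈ C.bondsIn Λ) (b : Bool)
    (η : C.Config) (A : Set C.Config) :
    (if b = true then C.bondProb β e else 1 - C.bondProb β e) *
      C.prob β q Λ η {ω | Function.update ω e b ∈ A} ≤ 2 * q ^ 2 * C.prob β q Λ η A := by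
  obtain ⟨e, h⟩ := e
  induction e using Sym2.ind with
  | _ x y =>
    have hsub : ({x, y} : Finset (Fin d → ℤ)) ⊆ Λ := by
      have := (C.mem_bondsIn h).1 he
      intro z hz
      simp only [Finset.mem_insert, Finset.mem_singleton] at hz
      rcases hz with rfl | rfl
      exacts [this.1, this.2]
    rw [← C.expect_prob hβ hq _ η hsub A, prob, ← expect_const_mul, ← expect_const_mul]
    refine C.expect_mono hβ hq Λ η fun ω _ => ?_
    exact C.le_prob_pair hβ hq h b ω A

omit hβ hq in
/-- The configuration `ω` with all bonds in `F` closed. -/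
noncomputable def closeOn (F : Finset C.Bond) (ω : C.Config) : C.Config :=
  fun e => if e ∈ F then false else ω e

theorem prob_closeOn_le {Λ : Finset (Fin d → ℤ)} {c : ℝ} (hc : 0 < c)
    (hce : ∀ e : C.Bond, c ≤ 1 - C.bondProb β e) {F : Finset C.Bond} (hF : F ⊆ C.bondsIn Λ)
    (η : C.Config) (A : Set C.Config) :
    C.prob β q Λ η {ω | C.closeOn F ω ∈ A} ≤ (2 * q ^ 2 / c) ^ F.card * C.prob β q Λ η A := by
  induction F using Finset.induction_on generalizing A with
  | empty =>
    have : ∀ ω, C.closeOn ∅ ω = ω := fun ω => by funext e; simp [closeOn]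
    simp [this]
  | insert e F he ih =>
    have h1 : {ω | C.closeOn (insert e F) ω ∈ A} =
        {ω | C.closeOn F ω ∈ {ω | Function.update ω e false ∈ A}} := by
      ext ω
      have : C.closeOn (insert e F) ω = Function.update (C.closeOn F ω) e false := by
        funext e'
        by_cases h' : e' = e
        · subst h'; simp [closeOn]
        · simp [closeOn, h']
      simp [this]
    have h2 := C.prob_update_le hβ hq (hF (Finset.mem_insert_self e F)) false η A
    simp only [Bool.false_eq_true, if_false] at h2
    have h3 : C.prob β q Λ η {ω | Function.update ω e false ∈ A} ≤
        2 * q ^ 2 / c * C.prob β q Λ η A := by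
      rw [div_mul_eq_mul_div, le_div_iff₀ hc, mul_comm]
      exact (mul_le_mul_of_nonneg_right (hce e) (C.prob_nonneg hβ hq Λ η _)).trans h2
    rw [h1, Finset.card_insert_of_notMem he, pow_succ, mul_assoc]
    exact (ih ((Finset.subset_insert e F).trans hF) _).trans
      (mul_le_mul_of_nonneg_left h3 (by positivity))

end update

/-! ### Comparison with an infinite-volume measure. -/

section dlr

variable {β q : ℝ} (hβ : 0 ≤ β) (hq : 1 ≤ q) {P : Measure C.Config} (hP : C.IsRandomCluster β q P)

theorem outside_le (Λ : Finset (Fin d → ℤ)) : C.outside Λ ≤ MeasurableSpace.pi :=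
  iSup_le fun e => (measurable_pi_apply e.1).comap_le

include hβ hq hP

theorem integral_prob (Λ : Finset (Fin d → ℤ)) {A : Set C.Config} (hA : MeasurableSet A) :
    ∫ η, C.prob β q Λ η A ∂P = P.real A := by
  have := hP.isProbabilityMeasure
  have h1 : P⟦A | C.outside Λ⟧ =ᵐ[P] fun η => C.prob β q Λ η A := by
    filter_upwards [hP.dlr A hA Λ] with η hη
    rw [hη, C.finiteVolume_real hβ hq]
  rw [← integral_congr_ae h1, integral_condExp (C.outside_le Λ), integral_indicator hA]
  simp

theorem integrable_prob (Λ : Finset (Fin d → ℤ)) {A : Set C.Config} (hA : MeasurableSet A) :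
    Integrable (fun η => C.prob β q Λ η A) P := by
  have := hP.isProbabilityMeasure
  refine (integrable_condExp (m := C.outside Λ) (f := A.indicator fun _ => (1 : ℝ))).congr ?_
  filter_upwards [hP.dlr A hA Λ] with η hη
  rw [← C.finiteVolume_real hβ hq, ← hη]

/-- The DLR equation writes `P` as an average over boundary conditions, all of which lie above the
free one. -/
theorem prob_free_le (Λ : Finset (Fin d → ℤ)) {A : Set C.Config} (hA : MeasurableSet A)
    (hup : IsUpperSet A) : C.prob β q Λ (fun _ => false) A ≤ P.real A := by
  have := hP.isProbabilityMeasure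
  rw [← C.integral_prob hβ hq hP Λ hA]
  calc C.prob β q Λ (fun _ => false) A = ∫ _, C.prob β q Λ (fun _ => false) A ∂P := by simp
    _ ≤ _ := integral_mono (integrable_const _) (C.integrable_prob hβ hq hP Λ hA) fun η =>
      C.prob_mono_boundary hβ hq Λ _ (fun e => Bool.false_le _) hup

end dlr

/-! ### Translation covariance and the arm probability. -/

/-- Translation of bonds. -/
def shiftBond (v : Fin d → ℤ) (e : C.Bond) : C.Bond :=
  ⟨Sym2.map (· + v) e.1, by
    obtain ⟨e, he⟩ := e
    induction e using Sym2.ind with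
    | _ x y => exact ⟨fun h => he.1 (add_right_cancel h), by simpa using he.2⟩⟩

theorem shiftBond_mk (v : Fin d → ℤ) {x y : Fin d → ℤ} (h : s(x, y) ∈ C.bondGraph.edgeSet)
    (h' : s(x + v, y + v) ∈ C.bondGraph.edgeSet) :
    C.shiftBond v ⟨s(x, y), h⟩ = ⟨s(x + v, y + v), h'⟩ := rfl

theorem shiftBond_shiftBond (v w : Fin d → ℤ) (e : C.Bond) :
    C.shiftBond w (C.shiftBond v e) = C.shiftBond (v + w) e := by
  obtain ⟨e, he⟩ := e
  induction e using Sym2.ind with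
  | _ x y => exact Subtype.ext (by simp [shiftBond, add_assoc])

theorem shiftBond_zero (e : C.Bond) : C.shiftBond 0 e = e := by
  obtain ⟨e, he⟩ := e
  induction e using Sym2.ind with
  | _ x y => exact Subtype.ext (by simp [shiftBond])

/-- Translation of bonds, as an equivalence. -/
def shiftBondEquiv (v : Fin d → ℤ) : C.Bond ≃ C.Bond where
  toFun := C.shiftBond v
  invFun := C.shiftBond (-v)
  left_inv e := by rw [shiftBond_shiftBond, add_neg_cancel, shiftBond_zero]
  right_inv e := by rw [shiftBond_shiftBond, neg_add_cancel, shiftBond_zero]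

/-- Translation of configurations: the bond `e` has in `shift v ω` the state of `e + v` in `ω`. -/
def shift (v : Fin d → ℤ) (ω : C.Config) : C.Config := fun e => ω (C.shiftBond v e)

theorem shift_shift (v w : Fin d → ℤ) (ω : C.Config) :
    C.shift v (C.shift w ω) = C.shift (v + w) ω := by
  funext e
  simp [shift, shiftBond_shiftBond]

theorem shift_zero (ω : C.Config) : C.shift 0 ω = ω := by
  funext e
  simp [shift, shiftBond_zero]

theorem bondProb_shiftBond (β : ℝ) (v : Fin d → ℤ) (e : C.Bond) :
    C.bondProb β (C.shiftBond v e) = C.bondProb β e := by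
  obtain ⟨e, he⟩ := e
  induction e using Sym2.ind with
  | _ x y => simp [bondProb, bondJ, shiftBond]

theorem adj_add_iff (v : Fin d → ℤ) (ω : C.Config) (x y : Fin d → ℤ) :
    (C.openGraph ω).Adj (x + v) (y + v) ↔ (C.openGraph (C.shift v ω)).Adj x y := by
  constructor
  · rintro ⟨h, ho⟩
    have h' : s(x, y) ∈ C.bondGraph.edgeSet :=
      ⟨fun hxy => h.1 (congrArg (· + v) hxy), by simpa using h.2⟩
    exact ⟨h', ho⟩
  · rintro ⟨h, ho⟩
    exact ⟨(C.shiftBond v ⟨_, h⟩).2, ho⟩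

theorem reachable_add_iff (v : Fin d → ℤ) (ω : C.Config) (x y : Fin d → ℤ) :
    (C.openGraph ω).Reachable (x + v) (y + v) ↔ (C.openGraph (C.shift v ω)).Reachable x y :=
  (SimpleGraph.Iso.reachable_iff (φ := (⟨Equiv.addRight v, fun {a b} => C.adj_add_iff v ω a b⟩ :
    C.openGraph (C.shift v ω) ≃g C.openGraph ω)))

section translate

variable {Λ Λ' : Finset (Fin d → ℤ)} {v : Fin d → ℤ} (h : ∀ x, x + v ∈ Λ' ↔ x ∈ Λ)

include h

theorem shiftBond_mem_iff (e : C.Bond) : C.shiftBond v e ∈ C.bondsIn Λ' ↔ e ∈ C.bondsIn Λ := by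
  obtain ⟨e, he⟩ := e
  induction e using Sym2.ind with
  | _ x y =>
    have he' : s(x + v, y + v) ∈ C.bondGraph.edgeSet := (C.shiftBond v ⟨_, he⟩).2
    rw [C.shiftBond_mk v he he', mem_bondsIn, mem_bondsIn, h, h]

theorem numClusters_shift (ω : C.Config) :
    C.numClusters Λ' ω = C.numClusters Λ (C.shift v ω) := by
  rw [numClusters_eq, numClusters_eq]
  have h1 : (Λ' : Set (Fin d → ℤ)) = (· + v) '' (Λ : Set (Fin d → ℤ)) := by
    ext x
    constructor
    · intro hx
      exact ⟨x - v, by simpa [← h] using hx, by simp⟩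
    · rintro ⟨y, hy, rfl⟩
      exact (h y).2 hy
  have h2 : ∀ x, C.cluster ω (x + v) = (· + v) '' C.cluster (C.shift v ω) x := by
    intro x
    ext y
    constructor
    · intro hy
      refine ⟨y - v, ?_, by simp⟩
      rw [mem_cluster, ← reachable_add_iff, sub_add_cancel]
      exact hy
    · rintro ⟨z, hz, rfl⟩
      exact (C.reachable_add_iff v ω x z).2 hz
  rw [h1, Set.image_image]
  simp only [h2]
  rw [← Set.image_image (fun S => (· + v) '' S), Set.ncard_image_of_injective]
  exact Set.image_injective.2 (add_left_injective v)

theorem weight_shift (β q : ℝ) (ω : C.Config) :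
    C.weight β q Λ' ω = C.weight β q Λ (C.shift v ω) := by
  rw [weight, weight, C.numClusters_shift h]
  congr 1
  refine (Finset.prod_bij (fun e _ => C.shiftBond v e) ?_ ?_ ?_ ?_).symm
  · intro e he
    exact (C.shiftBond_mem_iff h e).2 he
  · intro e _ e' _ hee
    exact (C.shiftBondEquiv v).injective hee
  · intro e he
    obtain ⟨e', rfl⟩ := (C.shiftBondEquiv v).surjective e
    exact ⟨e', (C.shiftBond_mem_iff h e').1 he, rfl⟩
  · intro e _
    rw [bondProb_shiftBond]
    rfl

theorem expect_shift (β q : ℝ) (η : C.Config) (f : C.Config → ℝ) :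
    C.expect β q Λ' η (fun ω => f (C.shift v ω)) = C.expect β q Λ (C.shift v η) f := by
  let σ : C.bondsIn Λ ≃ C.bondsIn Λ' :=
    (C.shiftBondEquiv v).subtypeEquiv fun e => (C.shiftBond_mem_iff h e).symm
  have hglue : ∀ ζ : C.bondsIn Λ' → Bool,
      C.shift v (C.glue Λ' η ζ) = C.glue Λ (C.shift v η) (fun e => ζ (σ e)) := by
    intro ζ
    funext e
    by_cases he : e ∈ C.bondsIn Λ
    · rw [glue_of_mem C he, shift, glue_of_mem C ((C.shiftBond_mem_iff h e).2 he)]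
      rfl
    · rw [glue_of_notMem C he, shift, glue_of_notMem C (mt (C.shiftBond_mem_iff h e).1 he)]
      rfl
  have key : ∀ F : C.Config → ℝ, ∑ ζ : C.bondsIn Λ' → Bool, F (C.shift v (C.glue Λ' η ζ)) =
      ∑ ζ : C.bondsIn Λ → Bool, F (C.glue Λ (C.shift v η) ζ) := by
    intro F
    simp only [hglue]
    exact Fintype.sum_equiv (Equiv.arrowCongr σ.symm (Equiv.refl Bool)) _ _ fun ζ => rfl
  rw [expect, expect, partitionFunction, partitionFunction]
  simp only [C.weight_shift h]
  rw [key (fun ω => C.weight β q Λ ω * f ω), key (fun ω => C.weight β q Λ ω)]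

theorem prob_shift (β q : ℝ) (η : C.Config) (A : Set C.Config) :
    C.prob β q Λ' η {ω | C.shift v ω ∈ A} = C.prob β q Λ (C.shift v η) A := by
  rw [prob, prob, ← C.expect_shift h]
  congr 1

end translate

/-- The box of radius `L` around `y`. -/
noncomputable def boxAt (y : Fin d → ℤ) (L : ℕ) : Finset (Fin d → ℤ) :=
  (latticeBox d L).map (Equiv.addRight y).toEmbedding

theorem mem_boxAt {x y : Fin d → ℤ} {L : ℕ} : x ∈ boxAt y L ↔ ∀ i, |x i - y i| ≤ L := by
  simp only [boxAt, Finset.mem_map, mem_latticeBox]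
  constructor
  · rintro ⟨z, hz, rfl⟩ i
    simpa using hz i
  · intro h
    exact ⟨x - y, h, by simp⟩

/-- The wired probability that the centre of a box of radius `L` is connected to the complement
of the box. -/
noncomputable def arm (β q : ℝ) (L : ℕ) : ℝ :=
  C.prob β q (latticeBox d L) (fun _ => true) (C.connects {0} {y | y ∉ latticeBox d L})

theorem prob_boxAt_eq_arm (β q : ℝ) (y : Fin d → ℤ) (L : ℕ) :
    C.prob β q (boxAt y L) (fun _ => true) (C.connects {y} {x | x ∉ boxAt y L}) = C.arm β q L := by
  have h : ∀ x, x + y ∈ boxAt y L ↔ x ∈ latticeBox d L := fun x => by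
    simp [mem_boxAt, mem_latticeBox]
  rw [arm]
  have h2 := C.prob_shift h β q (fun _ => true) (C.connects {0} {y | y ∉ latticeBox d L})
  have h3 : C.shift y (fun _ => true) = fun _ => true := rfl
  rw [h3] at h2
  rw [← h2]
  congr 1
  ext ω
  constructor
  · rintro ⟨y', hy', z, hz, hr⟩
    obtain rfl : y' = y := hy'
    refine ⟨0, rfl, z - y', ?_, ?_⟩
    · simpa [← h] using hz
    · rw [← reachable_add_iff]
      simpa using hr
  · rintro ⟨_, rfl, z, hz, hr⟩
    refine ⟨y, rfl, z + y, ?_, ?_⟩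
    · simpa [h] using hz
    · rw [← reachable_add_iff] at hr
      simpa using hr

/-- In a larger box the target is farther away and the wired boundary has less influence; both
effects decrease the probability. -/
theorem arm_antitone {β q : ℝ} (hβ : 0 ≤ β) (hq : 1 ≤ q) : Antitone (C.arm β q) := by
  intro M N h
  refine (C.prob_mono hβ hq _ _ ?_).trans
    (C.prob_wired_anti hβ hq (latticeBox_mono h) (C.isUpperSet_connects _ _))
  exact C.connects_subset subset_rfl fun y hy hy' => hy (latticeBox_mono h hy')

theorem arm_nonneg {β q : ℝ} (hβ : 0 ≤ β) (hq : 1 ≤ q) (L : ℕ) : 0 ≤ C.arm β q L :=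
  C.prob_nonneg hβ hq _ _ _

end

end FiniteRangeCoupling

/-! ### Measurability and locality of connection events. -/

namespace FiniteRangeCoupling

section

open Classical

variable {d : ℕ} (C : FiniteRangeCoupling d)

/-- The event that all bonds in `F` are open. -/
def allOpen (F : Finset C.Bond) : Set C.Config := {ω | ∀ e ∈ F, ω e = true}

theorem measurableSet_allOpen (F : Finset C.Bond) : MeasurableSet (C.allOpen F) := by
  have : C.allOpen F = ⋂ e ∈ F, (fun ω : C.Config => ω e) ⁻¹' {true} := by
    ext ω; simp [allOpen]
  rw [this]
  exact Finset.measurableSet_biInter F fun e _ => measurable_pi_apply e (measurableSet_singleton _)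

theorem isUpperSet_allOpen (F : Finset C.Bond) : IsUpperSet (C.allOpen F) :=
  fun _ _ h hω e he => Bool.le_iff_imp.1 (h e) (hω e he)

/-- The configuration in which exactly the bonds in `F` are open. -/
noncomputable def openExactly (F : Finset C.Bond) : C.Config := fun e => decide (e ∈ F)

theorem openExactly_le {F : Finset C.Bond} {ω : C.Config} (h : ω ∈ C.allOpen F) :
    C.openExactly F ≤ ω := by
  intro e
  rw [Bool.le_iff_imp]
  intro he
  exact h e (by simpa [openExactly] using he)

theorem exists_finset_reachable {ω : C.Config} {x y : Fin d → ℤ}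
    (h : (C.openGraph ω).Reachable x y) :
    ∃ F : Finset C.Bond, ω ∈ C.allOpen F ∧ (C.openGraph (C.openExactly F)).Reachable x y := by
  refine h.mem_of_closed (S := {z | ∃ F : Finset C.Bond, ω ∈ C.allOpen F ∧
    (C.openGraph (C.openExactly F)).Reachable x z}) ⟨∅, by simp [allOpen], .refl _⟩ ?_
  rintro u v ⟨F, hF, hr⟩ ⟨huv, ho⟩
  refine ⟨insert ⟨s(u, v), huv⟩ F, ?_, ?_⟩
  · intro e he
    rcases Finset.mem_insert.1 he with rfl | he
    exacts [ho, hF e he]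
  · refine (hr.mono (C.openGraph_mono (C.openExactly_le ?_))).trans
      (SimpleGraph.Adj.reachable ⟨huv, by simp [openExactly]⟩)
    intro e he
    simp [openExactly, he]

/-- A connection is witnessed by finitely many open bonds, so the event is a countable union of
cylinders. -/
theorem measurableSet_reachable (x y : Fin d → ℤ) :
    MeasurableSet {ω : C.Config | (C.openGraph ω).Reachable x y} := by
  have : {ω : C.Config | (C.openGraph ω).Reachable x y} =
      ⋃ F : {F : Finset C.Bond // (C.openGraph (C.openExactly F)).Reachable x y},
        C.allOpen F := by
    ext ω
    simp only [Set.mem_ofPred_eq, Set.mem_iUnion]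
    constructor
    · intro h
      obtain ⟨F, hF, hr⟩ := C.exists_finset_reachable h
      exact ⟨⟨F, hr⟩, hF⟩
    · rintro ⟨⟨F, hr⟩, hF⟩
      exact hr.mono (C.openGraph_mono (C.openExactly_le hF))
  rw [this]
  exact MeasurableSet.iUnion fun F => C.measurableSet_allOpen F

theorem measurableSet_connects (A B : Set (Fin d → ℤ)) : MeasurableSet (C.connects A B) := by
  have : C.connects A B = ⋃ x ∈ A, ⋃ y ∈ B, {ω : C.Config | (C.openGraph ω).Reachable x y} := by
    ext ω; simp [connects]
  rw [this]
  exact MeasurableSet.biUnion A.to_countable fun x _ =>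
    MeasurableSet.biUnion B.to_countable fun y _ => C.measurableSet_reachable x y

/-- Up to its first exit from `Λ`, a path uses only bonds with an endpoint in `Λ`. Exit events are
therefore local, and those of disjoint boxes do not see the bonds inside each other's box. -/
theorem connects_compl_congr {Λ : Finset (Fin d → ℤ)} {x : Fin d → ℤ} {ω ω' : C.Config}
    (h : ∀ u v (huv : s(u, v) ∈ C.bondGraph.edgeSet), u ∈ Λ → ω ⟨s(u, v), huv⟩ = ω' ⟨s(u, v), huv⟩)
    (hω : ω ∈ C.connects {x} {y | y ∉ Λ}) : ω' ∈ C.connects {x} {y | y ∉ Λ} := by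
  obtain ⟨x', hx', y, hy, hr⟩ := hω
  obtain rfl : x' = x := hx'
  by_cases hx : x' ∈ Λ
  · obtain ⟨u, v, hu, huΛ, hv, huv, ho⟩ := hr.exists_exit (S := (Λ : Set (Fin d → ℤ))) hx hy
    refine ⟨x', rfl, v, hv, SimpleGraph.Reachable.trans (v := u) (hu.mono ?_)
      (SimpleGraph.Adj.reachable ⟨huv, (h u v huv huΛ) ▸ ho⟩)⟩
    rintro a b ⟨⟨hab, ho⟩, ha, hb⟩
    exact ⟨hab, (h a b hab ha) ▸ ho⟩
  · exact ⟨x', rfl, x', hx, .refl _⟩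

/-! ### Truncated connections and arms in disjoint boxes. -/

section bounds

variable {β q : ℝ} (hβ : 0 ≤ β) (hq : 1 ≤ q)

theorem prob_eq_sum_fiber (Λ : Finset (Fin d → ℤ)) (η : C.Config) {ι : Type*} (s : Finset ι)
    (κ : C.Config → ι) (hκ : ∀ ω, κ ω ∈ s) (A : Set C.Config) :
    C.prob β q Λ η A = ∑ i ∈ s, C.prob β q Λ η (A ∩ {ω | κ ω = i}) := by
  simp only [prob]
  rw [← expect_sum]
  congr 1
  funext ω
  rw [Finset.sum_eq_single (κ ω)]
  · by_cases h : ω ∈ A <;> simp [h]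
  · intro i _ hi
    simp [hi.symm]
  · exact fun h => absurd (hκ ω) h

/-- If no cluster starting in `D` leaves `D`, however the inner bonds are set, then outer bonds
never help to connect sites of `D`, and the boundary condition acts as the free one. -/
theorem prob_eq_free {D : Finset (Fin d → ℤ)} {ω : C.Config} {z x : Fin d → ℤ} (hz : z ∈ D)
    (h : ∀ (ζ : C.bondsIn D → Bool), ∀ y ∈ D, C.cluster (C.glue D ω ζ) y ⊆ D) :
    C.prob β q D ω (C.connects {z} {x}) = C.prob β q D (fun _ => false) (C.connects {z} {x}) := by
  have hle : ∀ ζ, C.glue D (fun _ => false) ζ ≤ C.glue D ω ζ := by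
    intro ζ e
    by_cases he : e ∈ C.bondsIn D
    · rw [glue_of_mem C he, glue_of_mem C he]
    · rw [glue_of_notMem C he]; exact Bool.false_le _
  have hreach : ∀ ζ, ∀ y ∈ D, ∀ w, (C.openGraph (C.glue D ω ζ)).Reachable y w ↔
      (C.openGraph (C.glue D (fun _ => false) ζ)).Reachable y w := by
    intro ζ y hy w
    refine ⟨fun hr => ?_, fun hr => hr.mono (C.openGraph_mono (hle ζ))⟩
    refine hr.mem_of_closed
      (S := {w | (C.openGraph (C.glue D (fun _ => false) ζ)).Reachable y w}) (.refl _) ?_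
    rintro u v hu ⟨huv, ho⟩
    have hu' : (C.openGraph (C.glue D ω ζ)).Reachable y u := hu.mono (C.openGraph_mono (hle ζ))
    have huD : u ∈ D := h ζ y hy hu'
    have hvD : v ∈ D := h ζ y hy (hu'.trans (SimpleGraph.Adj.reachable ⟨huv, ho⟩))
    have he := (C.mem_bondsIn huv).2 ⟨huD, hvD⟩
    refine SimpleGraph.Reachable.trans hu (SimpleGraph.Adj.reachable ⟨huv, ?_⟩)
    rw [glue_of_mem C he] at ho ⊢
    exact ho
  have hw : ∀ ζ, C.weight β q D (C.glue D ω ζ) =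
      C.weight β q D (C.glue D (fun _ => false) ζ) := by
    intro ζ
    rw [weight, weight, C.numClusters_congr fun y hy w _ => hreach ζ y hy w]
    congr 1
    exact Finset.prod_congr rfl fun e he => by rw [glue_of_mem C he, glue_of_mem C he]
  have hi : ∀ ζ, (C.connects {z} {x}).indicator (fun _ => (1 : ℝ)) (C.glue D ω ζ) =
      (C.connects {z} {x}).indicator (fun _ => 1) (C.glue D (fun _ => false) ζ) := by
    intro ζ
    have : C.glue D ω ζ ∈ C.connects {z} {x} ↔
        C.glue D (fun _ => false) ζ ∈ C.connects {z} {x} := by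
      simpa [connects] using hreach ζ z hz x
    by_cases hm : C.glue D ω ζ ∈ C.connects {z} {x}
    · rw [Set.indicator_of_mem hm, Set.indicator_of_mem (this.1 hm)]
    · rw [Set.indicator_of_notMem hm, Set.indicator_of_notMem (mt this.2 hm)]
  rw [prob, prob, expect, expect, partitionFunction, partitionFunction]
  simp only [hw, hi]

include hβ hq

/-- A connection that avoids the wired boundary is no more likely than in infinite volume. -/
theorem prob_wired_truncated_le {P : Measure C.Config} (hP : C.IsRandomCluster β q P)
    (Λ : Finset (Fin d → ℤ)) (η : C.Config) (z x : Fin d → ℤ) :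
    C.prob β q Λ η (C.connects {z} {x} \ C.connects {z} {y | y ∉ Λ}) ≤
      P.real (C.connects {z} {x}) := by
  -- `κ ω` is the set of sites not connected to the complement of `Λ`. The event `κ ω = D` does not
  -- depend on the bonds inside `D`, and on it no cluster leaves `D`. Conditionally on it the law in
  -- `D` is therefore free, hence below `P` on increasing events. The truncated connection forces `z
  -- ∈ κ ω`.
  set κ : C.Config → Finset (Fin d → ℤ) :=
    fun ω => Λ.filter fun y => ω ∉ C.connects {y} {y | y ∉ Λ} with hκ
  have hmem : ∀ ω y, y ∈ κ ω ↔ ∀ w, (C.openGraph ω).Reachable y w → w ∈ Λ := by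
    intro ω y
    simp only [hκ, Finset.mem_filter, connects, Set.mem_singleton_iff, Set.mem_ofPred_eq]
    constructor
    · rintro ⟨-, h⟩ w hw
      by_contra hwΛ
      exact h ⟨y, rfl, w, hwΛ, hw⟩
    · intro h
      refine ⟨h y (.refl _), ?_⟩
      rintro ⟨_, rfl, w, hwΛ, hw⟩
      exact hwΛ (h w hw)
  have hcl : ∀ ω y, y ∈ κ ω → C.cluster ω y ⊆ κ ω := by
    intro ω y hy w hw
    exact (hmem ω w).2 fun w' hw' => (hmem ω y).1 hy w' (SimpleGraph.Reachable.trans hw hw')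
  have hκ_eq : ∀ D ω ω', (∀ e, e ∉ C.bondsIn D → ω e = ω' e) → κ ω = D → κ ω' = D := by
    intro D ω ω' hag hD
    have hout : ∀ y, y ∉ D → C.cluster ω' y = C.cluster ω y := by
      intro y hy
      refine C.cluster_eq_of_agree hag fun w hw hwy => hy ?_
      rw [← hD] at hw ⊢
      exact hcl ω w hw hwy.symm
    have hDΛ : D ⊆ Λ := hD ▸ Finset.filter_subset _ _
    ext y
    by_cases hy : y ∈ D
    · simp only [hy, iff_true]
      rw [hmem]
      intro w hw
      by_contra hwΛ
      have h1 : y ∈ C.cluster ω w := by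
        rw [← hout w fun h => hwΛ (hDΛ h)]; exact hw.symm
      rw [← hD] at hy
      exact hwΛ ((hmem ω y).1 hy w h1.symm)
    · simp only [hy, iff_false]
      intro hy'
      refine hy ?_
      rw [← hD, hmem]
      intro w hw
      have : w ∈ C.cluster ω' y := by rw [hout y hy]; exact hw
      exact (hmem ω' y).1 hy' w this
  rw [C.prob_eq_sum_fiber Λ η Λ.powerset κ
    fun ω => Finset.mem_powerset.2 (Finset.filter_subset _ _)]
  calc _ ≤ ∑ D ∈ Λ.powerset, P.real (C.connects {z} {x}) *
        C.prob β q Λ η (Set.univ ∩ {ω | κ ω = D}) := by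
        refine Finset.sum_le_sum fun D hD => ?_
        rw [Finset.mem_powerset] at hD
        by_cases hz : z ∈ D
        · rw [Set.univ_inter]
          refine (C.prob_mono hβ hq Λ η (Set.inter_subset_inter_left _ Set.sdiff_subset)).trans ?_
          refine C.prob_inter_le hβ hq D η hD (fun ω ω' => hκ_eq D ω ω') ?_
          intro ω hω
          rw [C.prob_eq_free hz]
          · exact C.prob_free_le hβ hq hP D (C.measurableSet_connects _ _)
              (C.isUpperSet_connects _ _)
          · intro ζ y hy
            have h1 : κ (C.glue D ω ζ) = D :=
              hκ_eq D ω _ (fun e he => (C.glue_of_notMem he).symm) hω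
            have h2 := hcl (C.glue D ω ζ) y (by rwa [h1])
            rwa [h1] at h2
        · have hempty : C.connects {z} {x} \ C.connects {z} {y | y ∉ Λ} ∩ {ω | κ ω = D} = ∅ := by
            ext ω
            simp only [Set.mem_inter_iff, Set.mem_ofPred_eq, Set.mem_empty_iff_false, iff_false]
            rintro ⟨⟨-, h1⟩, h2⟩
            refine hz ?_
            rw [← h2, hmem]
            intro w hw
            by_contra hwΛ
            exact h1 ⟨z, rfl, w, hwΛ, hw⟩
          rw [hempty]
          have : C.prob β q Λ η ∅ = 0 := by
            rw [prob, Set.indicator_empty]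
            exact C.expect_const hβ hq Λ η 0
          rw [this]
          exact mul_nonneg measureReal_nonneg (C.prob_nonneg hβ hq _ _ _)
    _ = P.real (C.connects {z} {x}) := by
        rw [← Finset.mul_sum, ← C.prob_eq_sum_fiber Λ η Λ.powerset κ
          fun ω => Finset.mem_powerset.2 (Finset.filter_subset _ _), C.prob_univ hβ hq, mul_one]

/-- Arm events in disjoint boxes are dominated by independent wired arm events. -/
theorem prob_forall_arm_le (Λ : Finset (Fin d → ℤ)) (η : C.Config) (L : ℕ)
    (T : Finset (Fin d → ℤ)) (hT : ∀ y ∈ T, boxAt y L ⊆ Λ)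
    (hdisj : ∀ y ∈ T, ∀ y' ∈ T, y ≠ y' → Disjoint (boxAt y L) (boxAt y' L)) :
    C.prob β q Λ η {ω | ∀ y ∈ T, ω ∈ C.connects {y} {x | x ∉ boxAt y L}} ≤
      C.arm β q L ^ T.card := by
  induction T using Finset.induction_on with
  | empty => simpa using C.prob_le_one hβ hq Λ η _
  | insert y T hy ih =>
    have heq : {ω | ∀ y' ∈ insert y T, ω ∈ C.connects {y'} {x | x ∉ boxAt y' L}} =
        C.connects {y} {x | x ∉ boxAt y L} ∩
          {ω | ∀ y' ∈ T, ω ∈ C.connects {y'} {x | x ∉ boxAt y' L}} := by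
      ext ω; simp
    rw [heq, Finset.card_insert_of_notMem hy, pow_succ, mul_comm]
    refine (C.prob_inter_le hβ hq (boxAt y L) η (hT y (Finset.mem_insert_self _ _))
      (c := C.arm β q L) ?_ ?_).trans (mul_le_mul_of_nonneg_left (ih
        (fun y' hy' => hT y' (Finset.mem_insert_of_mem hy'))
        (fun y' hy' y'' hy'' => hdisj y' (Finset.mem_insert_of_mem hy') y''
          (Finset.mem_insert_of_mem hy''))) (C.arm_nonneg hβ hq L))
    -- The arms from the other centres are decided by bonds touching their own boxes, so they are
    -- unaffected when the box of `y` is resampled.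
    · intro ω ω' hag hω y' hy'
      refine C.connects_compl_congr ?_ (hω y' hy')
      intro u v huv hu
      refine hag _ fun hmem => ?_
      exact Finset.disjoint_left.1 (hdisj y (Finset.mem_insert_self _ _) y'
        (Finset.mem_insert_of_mem hy') fun h => hy (h ▸ hy')) ((C.mem_bondsIn huv).1 hmem).1 hu
    · intro ω _
      rw [← C.prob_boxAt_eq_arm β q y L]
      exact C.prob_mono_boundary hβ hq _ _ (fun e => Bool.le_true _) (C.isUpperSet_connects _ _)

end bounds

/-! ### Few hits in the layer: cutting the origin off from the boundary. -/

/-- The bonds inside `Λ` with an endpoint in `W`. -/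
noncomputable def bondsTouching (Λ W : Finset (Fin d → ℤ)) : Finset C.Bond :=
  (C.bondsIn Λ).filter fun e => ∃ w ∈ W, w ∈ e.1

theorem card_bondsTouching_le {r : ℕ} (hr : C.HasRange r) (Λ W : Finset (Fin d → ℤ)) :
    (C.bondsTouching Λ W).card ≤ (latticeBox d r).card * W.card := by
  have h1 : (C.bondsTouching Λ W).card ≤
      (W.biUnion fun w => (boxAt w r).image fun v => s(w, v)).card := by
    refine Finset.card_le_card_of_injOn Subtype.val ?_ Subtype.val_injective.injOn
    rintro ⟨e, he⟩ hmem
    obtain ⟨w, hw, hwe⟩ := (Finset.mem_filter.1 (Finset.mem_coe.1 hmem)).2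
    obtain ⟨v, rfl⟩ := hwe
    simp only [Finset.coe_biUnion, Set.mem_iUnion, Finset.mem_coe, Finset.mem_image]
    exact ⟨w, hw, v, mem_boxAt.2 fun i => hr w v he i, rfl⟩
  refine h1.trans (Finset.card_biUnion_le.trans ?_)
  calc ∑ w ∈ W, ((boxAt w r).image fun v => s(w, v)).card ≤ ∑ w ∈ W, (latticeBox d r).card :=
        Finset.sum_le_sum fun w _ => Finset.card_image_le.trans (by rw [boxAt, Finset.card_map])
    _ = _ := by rw [Finset.sum_const, smul_eq_mul, mul_comm]

/-- The sites at depth between `L` and `L + r` in the box of radius `N`. -/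
noncomputable def layer (d L r N : ℕ) : Finset (Fin d → ℤ) :=
  latticeBox d (N - L) \ latticeBox d (N - L - r)

/-- The sites of the layer that are connected to the complement of the box. -/
noncomputable def layerHits (L r N : ℕ) (ω : C.Config) : Finset (Fin d → ℤ) :=
  (layer d L r N).filter fun y => ω ∈ C.connects {y} {x | x ∉ latticeBox d N}

theorem notMem_latticeBox {N : ℕ} {x : Fin d → ℤ} : x ∉ latticeBox d N ↔ ∃ i, (N : ℤ) < |x i| := by
  simp [mem_latticeBox]

theorem notMem_latticeBox_of_adj {r : ℕ} (hr : C.HasRange r) {M N : ℕ} {u v : Fin d → ℤ}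
    (huv : C.bondGraph.Adj u v) (hv : v ∉ latticeBox d M) (hN : N + r ≤ M) :
    u ∉ latticeBox d N := by
  obtain ⟨i, hi⟩ := notMem_latticeBox.1 hv
  refine notMem_latticeBox.2 ⟨i, ?_⟩
  have h1 := hr u v huv i
  have h2 := abs_sub_abs_le_abs_sub (v i) (u i)
  have h3 : (N : ℤ) + r ≤ M := by exact_mod_cast hN
  linarith

/-- No bond jumps over a layer of thickness `r`, so every way out visits a site of the layer
connected to the outside, and closing the bonds at such sites cuts it. The condition `r ≤ L` keeps
these exit bonds inside the box, where they may be changed. -/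
theorem closeOn_layerHits {r : ℕ} (hr : C.HasRange r) {L N : ℕ} (hrL : r ≤ L)
    (hN : L + 2 * r ≤ N) {ω : C.Config} (hω : ω ∈ C.connects {0} {x | x ∉ latticeBox d N}) :
    C.closeOn (C.bondsTouching (latticeBox d N) (C.layerHits L r N ω)) ω ∈
      ⋃ x ∈ latticeBox d N \ latticeBox d (N - L - 2 * r),
        C.connects {0} {x} \ C.connects {0} {x | x ∉ latticeBox d N} := by
  set F := C.bondsTouching (latticeBox d N) (C.layerHits L r N ω) with hF
  have hle : C.closeOn F ω ≤ ω := by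
    intro e
    by_cases he : e ∈ F <;> simp [closeOn, he]
  -- The bond along which a surviving path first leaves the inner box starts at a layer site that is
  -- also connected to the outside in `ω`; that bond has been closed.
  have hnot : C.closeOn F ω ∉ C.connects {0} {x | x ∉ latticeBox d N} := by
    rintro ⟨_, rfl, z, hz, hreach⟩
    have h0 : (0 : Fin d → ℤ) ∈ latticeBox d (N - L) := by simp [mem_latticeBox]
    obtain ⟨u, v, hu, huS, hv, huv, ho⟩ := hreach.exists_exit
      (S := (latticeBox d (N - L) : Set (Fin d → ℤ))) h0
      fun h => hz (latticeBox_mono (Nat.sub_le _ _) h)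
    have huY : u ∈ layer d L r N := Finset.mem_sdiff.2
      ⟨huS, C.notMem_latticeBox_of_adj hr huv hv (by omega)⟩
    have huW : u ∈ C.layerHits L r N ω := by
      refine Finset.mem_filter.2 ⟨huY, u, rfl, z, hz, ?_⟩
      exact ((hu.mono (SimpleGraph.within_le _ _)).symm.trans hreach).mono (C.openGraph_mono hle)
    have heF : (⟨s(u, v), huv⟩ : C.Bond) ∈ F := by
      refine Finset.mem_filter.2 ⟨(C.mem_bondsIn huv).2
        ⟨latticeBox_mono (Nat.sub_le _ _) huS, ?_⟩, u, huW, by simp⟩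
      by_contra hvN
      exact C.notMem_latticeBox_of_adj hr huv hvN (N := N - L) (by omega) huS
    simp [closeOn, heF] at ho
  obtain ⟨_, rfl, z, hz, hreach⟩ := hω
  have hzS : z ∉ C.cluster (C.closeOn F ω) 0 := fun h => hnot ⟨0, rfl, z, hz, h⟩
  -- Follow the original path until it leaves the new cluster of the origin: it does so through a
  -- closed bond, one endpoint of which is in the layer. So `u` is within range `r` of the layer.
  obtain ⟨u, v, -, huS, hv, huv, ho⟩ := hreach.exists_exit
    (S := C.cluster (C.closeOn F ω) 0) (.refl _) hzS
  have heF : (⟨s(u, v), huv⟩ : C.Bond) ∈ F := by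
    by_contra heF
    exact hv (SimpleGraph.Reachable.trans huS
      (SimpleGraph.Adj.reachable ⟨huv, by simpa [closeOn, heF] using ho⟩))
  obtain ⟨hein, w, hw, hwe⟩ := Finset.mem_filter.1 heF
  have hwY := (Finset.mem_sdiff.1 (Finset.mem_filter.1 hw).1).2
  simp only [Set.mem_iUnion]
  refine ⟨u, Finset.mem_sdiff.2 ⟨((C.mem_bondsIn huv).1 hein).1, ?_⟩, ⟨0, rfl, u, rfl, huS⟩, hnot⟩
  rcases Sym2.mem_iff.1 hwe with rfl | rfl
  · exact fun h => hwY (latticeBox_mono (by omega) h)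
  · exact C.notMem_latticeBox_of_adj hr huv hwY (by omega)

section few

variable {β q : ℝ} (hβ : 0 ≤ β) (hq : 1 ≤ q)

include hβ hq

/-- Sum over the possible hit sets `W`. Closing the bonds at `W` costs at most `K ^ W.card`, for one
common target event bounded through `P`. Inserting the factor `t ^ W.card * (t ^ k)⁻¹`, which is at
least 1 when `W.card ≤ k`, extends the sum to all subsets of the layer, where it is a binomial
expansion. -/
theorem prob_arm_few_hits_le {P : Measure C.Config} (hP : C.IsRandomCluster β q P) {r : ℕ}
    (hr : C.HasRange r) {c : ℝ} (hc : 0 < c) (hc1 : c ≤ 1)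
    (hce : ∀ e : C.Bond, c ≤ 1 - C.bondProb β e) {L N : ℕ} (hrL : r ≤ L) (hN : L + 2 * r ≤ N)
    (η : C.Config) (k : ℕ) {t : ℝ} (ht : 0 < t) (ht1 : t ≤ 1) :
    C.prob β q (latticeBox d N) η (C.connects {0} {x | x ∉ latticeBox d N} ∩
        {ω | (C.layerHits L r N ω).card ≤ k}) ≤
      (t ^ k)⁻¹ * (1 + t * (2 * q ^ 2 / c) ^ (latticeBox d r).card) ^ (layer d L r N).card *
        ∑ x ∈ latticeBox d N \ latticeBox d (N - L - 2 * r), P.real (C.connects {0} {x}) := by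
  set Λ := latticeBox d N with hΛ
  set Y := layer d L r N with hY
  set K : ℝ := (2 * q ^ 2 / c) ^ (latticeBox d r).card with hK
  set Q : Set C.Config := ⋃ x ∈ Λ \ latticeBox d (N - L - 2 * r),
    C.connects {0} {x} \ C.connects {0} {x | x ∉ Λ} with hQ
  set S : ℝ := ∑ x ∈ Λ \ latticeBox d (N - L - 2 * r), P.real (C.connects {0} {x}) with hS
  have hS0 : 0 ≤ S := Finset.sum_nonneg fun _ _ => measureReal_nonneg
  have hκ : 1 ≤ 2 * q ^ 2 / c := by
    rw [le_div_iff₀ hc]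
    nlinarith
  have hQS : C.prob β q Λ η Q ≤ S :=
    (C.prob_biUnion_le hβ hq Λ η _ _).trans
      (Finset.sum_le_sum fun x _ => C.prob_wired_truncated_le hβ hq hP Λ η 0 x)
  rw [C.prob_eq_sum_fiber Λ η Y.powerset (C.layerHits L r N)
    fun ω => Finset.mem_powerset.2 (Finset.filter_subset _ _)]
  have hterm : ∀ W ∈ Y.powerset, C.prob β q Λ η (C.connects {0} {x | x ∉ Λ} ∩
      {ω | (C.layerHits L r N ω).card ≤ k} ∩ {ω | C.layerHits L r N ω = W}) ≤
      ((t * K) ^ W.card * 1 ^ (Y.card - W.card)) * ((t ^ k)⁻¹ * S) := by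
    intro W _
    rw [one_pow, mul_one]
    by_cases hW : W.card ≤ k
    · have h1 : C.prob β q Λ η (C.connects {0} {x | x ∉ Λ} ∩
          {ω | (C.layerHits L r N ω).card ≤ k} ∩ {ω | C.layerHits L r N ω = W}) ≤
          C.prob β q Λ η {ω | C.closeOn (C.bondsTouching Λ W) ω ∈ Q} := by
        refine C.prob_mono hβ hq Λ η ?_
        rintro ω ⟨⟨hω, -⟩, rfl⟩
        exact C.closeOn_layerHits hr hrL hN hω
      have h2 := C.prob_closeOn_le hβ hq hc hce (Λ := Λ) (F := C.bondsTouching Λ W)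
        (Finset.filter_subset _ _) η Q
      have h3 : (2 * q ^ 2 / c) ^ (C.bondsTouching Λ W).card ≤ K ^ W.card := by
        rw [hK, ← pow_mul]
        exact pow_le_pow_right₀ hκ (C.card_bondsTouching_le hr Λ W)
      have h4 : 1 ≤ t ^ W.card * (t ^ k)⁻¹ := by
        rw [← div_eq_mul_inv, le_div_iff₀ (by positivity), one_mul]
        exact pow_le_pow_of_le_one ht.le ht1 hW
      calc _ ≤ _ := h1
        _ ≤ _ := h2
        _ ≤ K ^ W.card * S := by
          refine mul_le_mul h3 hQS (C.prob_nonneg hβ hq _ _ _) (by positivity)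
        _ ≤ (t ^ W.card * (t ^ k)⁻¹) * (K ^ W.card * S) :=
          le_mul_of_one_le_left (by positivity) h4
        _ = _ := by rw [mul_pow]; ring
    · have hempty : C.connects {0} {x | x ∉ Λ} ∩
          {ω | (C.layerHits L r N ω).card ≤ k} ∩ {ω | C.layerHits L r N ω = W} = ∅ := by
        ext ω
        simp only [Set.mem_inter_iff, Set.mem_ofPred_eq, Set.mem_empty_iff_false, iff_false]
        rintro ⟨⟨-, h1⟩, rfl⟩
        exact hW h1
      have : C.prob β q Λ η ∅ = 0 := by
        rw [prob, Set.indicator_empty]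
        exact C.expect_const hβ hq Λ η 0
      rw [hempty, this]
      positivity
  refine (Finset.sum_le_sum hterm).trans_eq ?_
  rw [← Finset.sum_mul, Finset.sum_pow_mul_eq_add_pow]
  ring

end few

end

end FiniteRangeCoupling

/-! ### Many hits in the planar layer. -/

namespace FiniteRangeCoupling

section

open Classical

theorem disjoint_boxAt {d : ℕ} {L : ℕ} {y y' : Fin d → ℤ} (i : Fin d)
    (h : 2 * (L : ℤ) + 1 ≤ |y i - y' i|) : Disjoint (boxAt y L) (boxAt y' L) := by
  rw [Finset.disjoint_left]
  intro x hx hx'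
  have h1 := abs_le.1 (mem_boxAt.1 hx i)
  have h2 := abs_le.1 (mem_boxAt.1 hx' i)
  rcases abs_cases (y i - y' i) with ⟨h3, -⟩ | ⟨h3, -⟩ <;> omega

/-- Two sites of the planar layer with the same class are equal or at distance more than `2 L`. -/
noncomputable def layerClass (L r N : ℕ) (y : Fin 2 → ℤ) : Fin 2 × ℤ × ℤ :=
  if ((N - L - r : ℕ) : ℤ) < |y 0| then (0, y 0, y 1 % (2 * L + 1))
  else (1, y 1, y 0 % (2 * L + 1))

/-- The possible classes of the sites in the planar layer. -/
noncomputable def layerClasses (L r N : ℕ) : Finset (Fin 2 × ℤ × ℤ) :=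
  Finset.univ ×ˢ (Finset.Ioc ((N - L - r : ℕ) : ℤ) (N - L : ℕ) ∪
    Finset.Ico (-((N - L : ℕ) : ℤ)) (-((N - L - r : ℕ) : ℤ))) ×ˢ
      Finset.Ico (0 : ℤ) (2 * L + 1)

theorem card_layerClasses_le (L r N : ℕ) (h : L + r ≤ N) :
    (layerClasses L r N).card ≤ 4 * r * (2 * L + 1) := by
  rw [layerClasses, Finset.card_product, Finset.card_product, Finset.card_univ, Fintype.card_fin]
  have h1 := Finset.card_union_le (Finset.Ioc ((N - L - r : ℕ) : ℤ) (N - L : ℕ))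
    (Finset.Ico (-((N - L : ℕ) : ℤ)) (-((N - L - r : ℕ) : ℤ)))
  rw [Int.card_Ioc, Int.card_Ico] at h1
  have h2 : (Finset.Ico (0 : ℤ) (2 * L + 1)).card = 2 * L + 1 := by
    rw [Int.card_Ico]; omega
  rw [h2]
  have h3 : (Finset.Ioc ((N - L - r : ℕ) : ℤ) (N - L : ℕ) ∪
    Finset.Ico (-((N - L : ℕ) : ℤ)) (-((N - L - r : ℕ) : ℤ))).card ≤ 2 * r :=
    h1.trans (by omega)
  calc _ ≤ 2 * (2 * r * (2 * L + 1)) := by gcongr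
    _ = _ := by ring

theorem mem_layer {d L r N : ℕ} {y : Fin d → ℤ} : y ∈ layer d L r N ↔
    (∀ i, |y i| ≤ (N - L : ℕ)) ∧ ∃ i, ((N - L - r : ℕ) : ℤ) < |y i| := by
  rw [layer, Finset.mem_sdiff, mem_latticeBox, notMem_latticeBox]

theorem layerClass_mem {L r N : ℕ} {y : Fin 2 → ℤ} (hy : y ∈ layer 2 L r N) :
    layerClass L r N y ∈ layerClasses L r N := by
  obtain ⟨h1, h2⟩ := mem_layer.1 hy
  rw [Fin.exists_fin_two] at h2
  have hmod : ∀ a : ℤ, a % (2 * L + 1) ∈ Finset.Ico (0 : ℤ) (2 * L + 1) := fun a =>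
    Finset.mem_Ico.2 ⟨Int.emod_nonneg _ (by omega), Int.emod_lt_of_pos _ (by omega)⟩
  have hlev : ∀ i, ((N - L - r : ℕ) : ℤ) < |y i| →
      y i ∈ (Finset.Ioc ((N - L - r : ℕ) : ℤ) (N - L : ℕ) ∪
        Finset.Ico (-((N - L : ℕ) : ℤ)) (-((N - L - r : ℕ) : ℤ))) := by
    intro i hi
    have := h1 i
    rw [Finset.mem_union, Finset.mem_Ioc, Finset.mem_Ico]
    rcases abs_cases (y i) with ⟨h3, -⟩ | ⟨h3, -⟩ <;> omega
  rw [layerClass, layerClasses]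
  split_ifs with h
  · exact Finset.mem_product.2 ⟨Finset.mem_univ _, Finset.mem_product.2 ⟨hlev 0 h, hmod _⟩⟩
  · exact Finset.mem_product.2 ⟨Finset.mem_univ _, Finset.mem_product.2
      ⟨hlev 1 (h2.resolve_left h), hmod _⟩⟩

theorem layerClass_or (L r N : ℕ) (y : Fin 2 → ℤ) :
    layerClass L r N y = (0, y 0, y 1 % (2 * L + 1)) ∨
      layerClass L r N y = (1, y 1, y 0 % (2 * L + 1)) := by
  rw [layerClass]
  split_ifs
  exacts [Or.inl rfl, Or.inr rfl]

theorem layerClass_eq_cases {L r N : ℕ} {y y' : Fin 2 → ℤ}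
    (h : layerClass L r N y = layerClass L r N y') :
    (y 0 = y' 0 ∧ y 1 % (2 * L + 1) = y' 1 % (2 * L + 1)) ∨
      (y 1 = y' 1 ∧ y 0 % (2 * L + 1) = y' 0 % (2 * L + 1)) := by
  rw [layerClass, layerClass] at h
  split_ifs at h <;> simp_all

theorem abs_sub_ge_of_emod_eq {m a b : ℤ} (hab : a ≠ b) (h : a % m = b % m) : m ≤ |a - b| := by
  have h1 : m ∣ a - b := Int.ModEq.dvd (Int.ModEq.symm h)
  exact Int.le_of_dvd (abs_pos.2 (sub_ne_zero.2 hab)) ((dvd_abs _ _).2 h1)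

theorem disjoint_boxAt_of_layerClass_eq {L r N : ℕ} {y y' : Fin 2 → ℤ} (hne : y ≠ y')
    (h : layerClass L r N y = layerClass L r N y') : Disjoint (boxAt y L) (boxAt y' L) := by
  rcases layerClass_eq_cases h with ⟨h0, h1⟩ | ⟨h1, h0⟩
  · refine disjoint_boxAt 1 (abs_sub_ge_of_emod_eq (fun h2 => hne ?_) h1)
    funext i; fin_cases i <;> assumption
  · refine disjoint_boxAt 0 (abs_sub_ge_of_emod_eq (fun h2 => hne ?_) h0)
    funext i; fin_cases i <;> assumption

/-- Within a class one coordinate and the residue of the other are fixed, so a site is determined by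
a quotient lying between `-n` and `n`. -/
theorem card_layer_fiber_le {L r N n : ℕ} (hN : N ≤ (2 * L + 1) * n) (c : Fin 2 × ℤ × ℤ) :
    ((layer 2 L r N).filter fun y => layerClass L r N y = c).card ≤ 2 * n + 1 := by
  have hm : (0 : ℤ) < 2 * L + 1 := by omega
  have hcard : (Finset.Icc (-(n : ℤ)) n).card = 2 * n + 1 := by rw [Int.card_Icc]; omega
  rw [← hcard]
  refine Finset.card_le_card_of_injOn
    (fun y => (if c.1 = 0 then y 1 else y 0) / (2 * L + 1)) ?_ ?_
  · intro y hy
    obtain ⟨h1, -⟩ := mem_layer.1 (Finset.mem_filter.1 (Finset.mem_coe.1 hy)).1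
    have key : ∀ i, y i / (2 * L + 1) ∈ Finset.Icc (-(n : ℤ)) n := by
      intro i
      have h2 : |y i| ≤ (2 * L + 1) * n := (h1 i).trans (by
        have : N - L ≤ (2 * L + 1) * n := (Nat.sub_le _ _).trans hN
        exact_mod_cast this)
      obtain ⟨h3, h4⟩ := abs_le.1 h2
      rw [Finset.mem_Icc]
      constructor
      · rw [Int.le_ediv_iff_mul_le hm]; linarith
      · exact Int.ediv_le_of_le_mul hm (by linarith)
    rw [Finset.mem_coe]
    dsimp only
    split_ifs
    exacts [key 1, key 0]
  · intro y hy y' hy' hyy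
    have h1 := (Finset.mem_filter.1 (Finset.mem_coe.1 hy)).2
    have h2 := (Finset.mem_filter.1 (Finset.mem_coe.1 hy')).2
    have heq : ∀ a b : ℤ, a % (2 * L + 1) = b % (2 * L + 1) → a / (2 * L + 1) = b / (2 * L + 1) →
        a = b := fun a b h h' => by
      rw [← Int.emod_add_mul_ediv a (2 * L + 1), h, h', Int.emod_add_mul_ediv]
    rcases layerClass_or L r N y with e | e <;> rcases layerClass_or L r N y' with e' | e' <;>
      rw [e] at h1 <;> rw [e', ← h1, Prod.mk.injEq, Prod.mk.injEq] at h2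
    · rw [← h1] at hyy
      have h3 := heq _ _ h2.2.2.symm (by simpa using hyy)
      funext i; fin_cases i
      exacts [h2.2.1.symm, h3]
    · exact absurd h2.1 (by decide)
    · exact absurd h2.1 (by decide)
    · rw [← h1] at hyy
      have h3 := heq _ _ h2.2.2.symm (by simpa using hyy)
      funext i; fin_cases i
      exacts [h3, h2.2.1.symm]

theorem card_layer_le {L r N n : ℕ} (hLr : L + r ≤ N) (hN : N ≤ (2 * L + 1) * n) :
    (layer 2 L r N).card ≤ 4 * r * (2 * L + 1) * (2 * n + 1) := by
  rw [Finset.card_eq_sum_card_fiberwise (f := layerClass L r N) (t := layerClasses L r N)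
    fun y hy => layerClass_mem hy]
  calc _ ≤ ∑ _c ∈ layerClasses L r N, (2 * n + 1) :=
        Finset.sum_le_sum fun c _ => card_layer_fiber_le hN c
    _ = (layerClasses L r N).card * (2 * n + 1) := by rw [Finset.sum_const, smul_eq_mul]
    _ ≤ _ := Nat.mul_le_mul_right _ (card_layerClasses_le L r N hLr)

variable (C : FiniteRangeCoupling 2) {β q : ℝ} (hβ : 0 ≤ β) (hq : 1 ≤ q)

include hβ hq

theorem prob_exists_arms_le (Λ : Finset (Fin 2 → ℤ)) (η : C.Config) (L : ℕ)
    {F : Finset (Fin 2 → ℤ)} (hF : ∀ y ∈ F, boxAt y L ⊆ Λ)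
    (hdisj : ∀ y ∈ F, ∀ y' ∈ F, y ≠ y' → Disjoint (boxAt y L) (boxAt y' L)) {m : ℕ}
    (hm : F.card ≤ m) (k : ℕ) :
    C.prob β q Λ η (⋃ T ∈ F.powersetCard k,
      {ω | ∀ y ∈ T, ω ∈ C.connects {y} {x | x ∉ boxAt y L}}) ≤ 2 ^ m * C.arm β q L ^ k := by
  have ha : 0 ≤ C.arm β q L ^ k := pow_nonneg (C.arm_nonneg hβ hq L) k
  refine (C.prob_biUnion_le hβ hq Λ η _ _).trans ?_
  calc _ ≤ ∑ _T ∈ F.powersetCard k, C.arm β q L ^ k := by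
        refine Finset.sum_le_sum fun T hT => ?_
        obtain ⟨hTs, hTc⟩ := Finset.mem_powersetCard.1 hT
        rw [← hTc]
        exact C.prob_forall_arm_le hβ hq Λ η L T (fun y hy => hF y (hTs hy))
          fun y hy y' hy' => hdisj y (hTs hy) y' (hTs hy')
    _ = (F.card.choose k : ℝ) * C.arm β q L ^ k := by
        rw [Finset.sum_const, nsmul_eq_mul, Finset.card_powersetCard]
    _ ≤ 2 ^ m * C.arm β q L ^ k := by
        refine mul_le_mul_of_nonneg_right ?_ ha
        have h1 : F.card.choose k ≤ 2 ^ F.card := Nat.choose_le_two_pow _ _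
        calc (F.card.choose k : ℝ) ≤ 2 ^ F.card := by exact_mod_cast h1
          _ ≤ 2 ^ m := pow_le_pow_right₀ one_le_two hm

/-- By pigeonhole some class contains `j + 1` hit sites, and their boxes of radius `L` are disjoint.
The layer has depth at least `L`, so these boxes lie in the large box and a connection to its
complement is an arm out of the small box. The power of 2 bounds the choice of the sites within a
class. -/
theorem prob_many_hits_le {L r N n : ℕ} (hLr : L + r ≤ N) (hN : N ≤ (2 * L + 1) * n) (j : ℕ)
    (η : C.Config) :
    C.prob β q (latticeBox 2 N) η
      {ω | 4 * r * (2 * L + 1) * j < (C.layerHits L r N ω).card} ≤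
      (4 * r * (2 * L + 1) : ℕ) * (2 ^ (2 * n + 1) * C.arm β q L ^ (j + 1)) := by
  set Λ := latticeBox 2 N with hΛ
  set Y := layer 2 L r N with hY
  set fib : Fin 2 × ℤ × ℤ → Finset (Fin 2 → ℤ) :=
    fun c => Y.filter fun y => layerClass L r N y = c with hfib
  have ha := C.arm_nonneg hβ hq L
  have hsub : ∀ y ∈ Y, boxAt y L ⊆ Λ := by
    intro y hy x hx
    refine mem_latticeBox.2 fun i => ?_
    have h1 := (mem_layer.1 hy).1 i
    have h2 := mem_boxAt.1 hx i
    have h3 := abs_sub_abs_le_abs_sub (x i) (y i)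
    omega
  have hincl : {ω | 4 * r * (2 * L + 1) * j < (C.layerHits L r N ω).card} ⊆
      ⋃ c ∈ layerClasses L r N, ⋃ T ∈ (fib c).powersetCard (j + 1),
        {ω | ∀ y ∈ T, ω ∈ C.connects {y} {x | x ∉ boxAt y L}} := by
    intro ω hω
    have hlt : (layerClasses L r N).card * j < (C.layerHits L r N ω).card :=
      (Nat.mul_le_mul_right j (card_layerClasses_le L r N hLr)).trans_lt hω
    obtain ⟨c, hc, hcj⟩ := Finset.exists_lt_card_fiber_of_mul_lt_card_of_maps_to
      (f := layerClass L r N) (fun y hy => layerClass_mem (Finset.mem_filter.1 hy).1) hlt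
    obtain ⟨T, hT, hTcard⟩ := Finset.exists_subset_card_eq (Nat.succ_le_of_lt hcj)
    simp only [Set.mem_iUnion]
    refine ⟨c, hc, T, Finset.mem_powersetCard.2 ⟨fun y hy => ?_, hTcard⟩, fun y hy => ?_⟩
    · have := Finset.mem_filter.1 (hT hy)
      exact Finset.mem_filter.2 ⟨(Finset.mem_filter.1 this.1).1, this.2⟩
    · have h1 := Finset.mem_filter.1 (Finset.mem_filter.1 (hT hy)).1
      exact C.connects_subset subset_rfl (fun x (hx : x ∉ Λ) hx' => hx (hsub y h1.1 hx')) h1.2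
  refine (C.prob_mono hβ hq Λ η hincl).trans ((C.prob_biUnion_le hβ hq Λ η _ _).trans ?_)
  calc _ ≤ ∑ _c ∈ layerClasses L r N, 2 ^ (2 * n + 1) * C.arm β q L ^ (j + 1) := by
        refine Finset.sum_le_sum fun c _ => ?_
        refine C.prob_exists_arms_le hβ hq Λ η L
          (fun y hy => hsub y (Finset.mem_filter.1 hy).1) ?_ (card_layer_fiber_le hN c) (j + 1)
        intro y hy y' hy' hne
        exact disjoint_boxAt_of_layerClass_eq hne
          ((Finset.mem_filter.1 hy).2.trans (Finset.mem_filter.1 hy').2.symm)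
    _ = (layerClasses L r N).card * (2 ^ (2 * n + 1) * C.arm β q L ^ (j + 1)) := by
        rw [Finset.sum_const, nsmul_eq_mul]
    _ ≤ _ := by
        refine mul_le_mul_of_nonneg_right ?_
          (mul_nonneg (pow_nonneg zero_le_two _) (pow_nonneg ha _))
        exact Nat.cast_le.2 (card_layerClasses_le L r N hLr)

/-- The dichotomy on the number of hits. It bounds the arm probability at scale `(2 * L + 1) * n` by
that at scale `L` and by the decay of `P`; `j` and `t` remain free. -/
theorem arm_le {P : Measure C.Config} (hP : C.IsRandomCluster β q P) {r : ℕ}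
    (hr : C.HasRange r) {c : ℝ} (hc : 0 < c) (hc1 : c ≤ 1)
    (hce : ∀ e : C.Bond, c ≤ 1 - C.bondProb β e) {L n : ℕ} (hrL : r ≤ L)
    (hN : L + 2 * r ≤ (2 * L + 1) * n) (j : ℕ) {t : ℝ} (ht : 0 < t) (ht1 : t ≤ 1) :
    C.arm β q ((2 * L + 1) * n) ≤
      (4 * r * (2 * L + 1) : ℕ) * (2 ^ (2 * n + 1) * C.arm β q L ^ (j + 1)) +
      (t ^ (4 * r * (2 * L + 1) * j))⁻¹ *
        (1 + t * (2 * q ^ 2 / c) ^ (latticeBox 2 r).card) ^ (4 * r * (2 * L + 1) * (2 * n + 1)) *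
        ∑ x ∈ latticeBox 2 ((2 * L + 1) * n) \ latticeBox 2 ((2 * L + 1) * n - L - 2 * r),
          P.real (C.connects {0} {x}) := by
  set N := (2 * L + 1) * n with hNn
  set k := 4 * r * (2 * L + 1) * j with hk
  set A : Set C.Config := C.connects {0} {y | y ∉ latticeBox 2 N} with hA
  have h1 : C.arm β q N ≤ C.prob β q (latticeBox 2 N) (fun _ => true)
        {ω | k < (C.layerHits L r N ω).card} +
      C.prob β q (latticeBox 2 N) (fun _ => true)
        (A ∩ {ω | (C.layerHits L r N ω).card ≤ k}) := by
    have h2 := C.prob_biUnion_le hβ hq (latticeBox 2 N) (fun _ => true) (Finset.univ : Finset Bool)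
      (fun b => if b = true then {ω | k < (C.layerHits L r N ω).card} else
        (A ∩ {ω | (C.layerHits L r N ω).card ≤ k}))
    rw [Fintype.sum_bool] at h2
    refine le_trans (C.prob_mono hβ hq _ _ fun ω hω => ?_) h2
    simp only [Finset.mem_univ, Set.iUnion_true, Set.mem_iUnion]
    by_cases h : k < (C.layerHits L r N ω).card
    · exact ⟨true, by simpa using h⟩
    · exact ⟨false, by simpa using ⟨hω, not_lt.1 h⟩⟩
  refine h1.trans (add_le_add (C.prob_many_hits_le hβ hq (by omega) le_rfl j _) ?_)
  refine (C.prob_arm_few_hits_le hβ hq hP hr hc hc1 hce hrL hN _ k ht ht1).trans ?_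
  refine mul_le_mul_of_nonneg_right ?_ (Finset.sum_nonneg fun _ _ => measureReal_nonneg)
  refine mul_le_mul_of_nonneg_left ?_ (by positivity)
  exact pow_le_pow_right₀ (le_add_of_nonneg_right (by positivity))
    (card_layer_le (by omega) le_rfl)

end

end FiniteRangeCoupling

/-! ### From vanishing to exponentially small arm probabilities. -/

namespace FiniteRangeCoupling

section

open Classical

theorem card_latticeBox (d N : ℕ) : (latticeBox d N).card = (2 * N + 1) ^ d := by
  rw [latticeBox, Fintype.card_piFinset_const, Int.card_Icc]
  congr 1
  omega

theorem lt_latticeNorm_of_notMem {d N : ℕ} {x : Fin d → ℤ} (hx : x ∉ latticeBox d N) :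
    (N : ℝ) < latticeNorm x := by
  obtain ⟨i, hi⟩ := notMem_latticeBox.1 hx
  have h1 : ((N : ℤ) : ℝ) < ((|x i| : ℤ) : ℝ) := by exact_mod_cast hi
  rw [Int.cast_abs] at h1
  exact lt_of_lt_of_le (by exact_mod_cast h1) (abs_apply_le_latticeNorm x i)

theorem sq_two_mul_add_one_le {c : ℝ} (hc : 0 < c) (N : ℕ) :
    ((2 * N + 1 : ℕ) : ℝ) ^ 2 ≤ (1 + 16 / c) ^ 2 * Real.exp (c / 4 * N) := by
  have h1 : ((2 * N + 1 : ℕ) : ℝ) ≤ (1 + 16 / c) * Real.exp (c / 8 * N) := by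
    calc ((2 * N + 1 : ℕ) : ℝ) = 2 * N + 1 := by push_cast; ring
      _ ≤ (1 + 16 / c) * (c / 8 * N + 1) := by
        have : (1 + 16 / c) * (c / 8 * N + 1) = 2 * N + 1 + (c / 8 * N + 16 / c) := by
          field_simp; ring
        rw [this]
        have : 0 ≤ c / 8 * N + 16 / c := by positivity
        linarith
      _ ≤ _ := mul_le_mul_of_nonneg_left (Real.add_one_le_exp _) (by positivity)
  calc ((2 * N + 1 : ℕ) : ℝ) ^ 2 ≤ ((1 + 16 / c) * Real.exp (c / 8 * N)) ^ 2 :=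
        pow_le_pow_left₀ (Nat.cast_nonneg _) h1 2
    _ = _ := by
      rw [mul_pow, ← Real.exp_nat_mul]
      congr 2
      push_cast; ring

/-- Since `b * (n / b + 1)` exceeds `n`, the power of `a` is at most `8⁻ⁿ`, which beats the entropy
`4ⁿ`. -/
theorem pow_div_succ_le {a : ℝ} (ha : 0 ≤ a) {b : ℕ} (hb : 0 < b) (hab : a ≤ (1 / 8) ^ b) (n : ℕ) :
    2 ^ (2 * n + 1) * a ^ (n / b + 1) ≤ 2 * Real.exp (-Real.log 2 * n) := by
  have h1 : a ^ (n / b + 1) ≤ (1 / 8) ^ n :=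
    calc a ^ (n / b + 1) ≤ ((1 / 8) ^ b) ^ (n / b + 1) := pow_le_pow_left₀ ha hab _
      _ = (1 / 8 : ℝ) ^ (b * (n / b + 1)) := by rw [pow_mul]
      _ ≤ (1 / 8) ^ n := pow_le_pow_of_le_one (by norm_num) (by norm_num)
        (Nat.lt_mul_div_succ n hb).le
  have h2 : Real.exp (-Real.log 2 * n) = (1 / 2) ^ n := by
    rw [mul_comm, Real.exp_nat_mul, Real.exp_neg, Real.exp_log two_pos]
    norm_num
  rw [h2]
  calc (2 : ℝ) ^ (2 * n + 1) * a ^ (n / b + 1) ≤ 2 ^ (2 * n + 1) * (1 / 8) ^ n :=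
        mul_le_mul_of_nonneg_left h1 (by positivity)
    _ = 2 * (1 / 2) ^ n := by
      rw [pow_succ, pow_mul, mul_comm _ (2 : ℝ), mul_assoc, ← mul_pow]
      norm_num

theorem exists_le_exp_of_multiples {a : ℕ → ℝ} (ha : Antitone a) (ha1 : ∀ N, a N ≤ 1) {m : ℕ}
    {A ν : ℝ} (hm : 0 < m) (hA : 0 ≤ A) (hν : 0 < ν)
    (h : ∀ n : ℕ, 2 ≤ n → a (m * n) ≤ A * Real.exp (-ν * ((m : ℝ) * n))) :
    ∃ ν₀ : ℝ, 0 < ν₀ ∧ ∀ N : ℕ, a N ≤ ν₀ * Real.exp (-ν * N) := by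
  -- The summand 1 and the exponential cover `N < 2 * m`, where only `a N ≤ 1` is available; beyond
  -- that, monotonicity compares `N` with the multiple of `m` just below it.
  refine ⟨(A + 1) * Real.exp (ν * (2 * m)), by positivity, fun N => ?_⟩
  rw [mul_assoc, ← Real.exp_add]
  have hm0 : (0 : ℝ) < m := Nat.cast_pos.2 hm
  have hNlt : (N : ℝ) ≤ m * (N / m : ℕ) + m := by
    have h2 : (N : ℝ) ≤ (m * (N / m + 1) : ℕ) := Nat.cast_le.2 (Nat.lt_mul_div_succ N hm).le
    push_cast at h2 ⊢
    linarith
  by_cases hn2 : 2 ≤ N / m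
  · calc a N ≤ a (m * (N / m)) := ha (Nat.mul_div_le N m)
      _ ≤ _ := h _ hn2
      _ ≤ (A + 1) * Real.exp (ν * (2 * m) + -ν * N) := by
          refine mul_le_mul (by linarith) (Real.exp_le_exp.2 ?_) (Real.exp_pos _).le (by positivity)
          nlinarith
  · have h1 : ((N / m : ℕ) : ℝ) ≤ 1 := Nat.cast_le_one.2 (by omega)
    calc a N ≤ 1 := ha1 N
      _ ≤ 1 * Real.exp (ν * (2 * m) + -ν * N) := by
          rw [one_mul]
          refine Real.one_le_exp ?_
          have : (N : ℝ) ≤ 2 * m := by nlinarith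
          nlinarith
      _ ≤ _ := mul_le_mul_of_nonneg_right (by linarith) (Real.exp_pos _).le

variable (C : FiniteRangeCoupling 2) {β q : ℝ} (hβ : 0 ≤ β) (hq : 1 ≤ q)

theorem sum_connects_le {P : Measure C.Config} {c₁ : ℝ} (hc₁ : 0 < c₁)
    (hdecay : ∀ x : Fin 2 → ℤ, P.real (C.connects {0} {x}) ≤ Real.exp (-c₁ * latticeNorm x))
    (M N : ℕ) :
    ∑ x ∈ latticeBox 2 N \ latticeBox 2 M, P.real (C.connects {0} {x}) ≤
      (1 + 16 / c₁) ^ 2 * Real.exp (c₁ / 4 * N) * Real.exp (-c₁ * M) := by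
  calc _ ≤ ∑ _x ∈ latticeBox 2 N \ latticeBox 2 M, Real.exp (-c₁ * M) := by
        refine Finset.sum_le_sum fun x hx => (hdecay x).trans (Real.exp_le_exp.2 ?_)
        have := lt_latticeNorm_of_notMem (Finset.mem_sdiff.1 hx).2
        nlinarith
    _ ≤ ((2 * N + 1 : ℕ) : ℝ) ^ 2 * Real.exp (-c₁ * M) := by
        rw [Finset.sum_const, nsmul_eq_mul]
        refine mul_le_mul_of_nonneg_right ?_ (Real.exp_pos _).le
        have h := Finset.card_le_card
          (Finset.sdiff_subset : latticeBox 2 N \ latticeBox 2 M ⊆ latticeBox 2 N)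
        rw [card_latticeBox] at h
        exact_mod_cast h
    _ ≤ _ := mul_le_mul_of_nonneg_right (sq_two_mul_add_one_le hc₁ N) (Real.exp_pos _).le

include hβ hq

/-- The decay `exp (-c₁ N)` is split into quarters: one pays for the number of target sites, one for
the binomial factor, one for the power of `t⁻¹`, and one survives. The order of choices matters: `t`
depends on `c₁`, `r`, `K`; then `b` on `t`; and only then `L`, so that `arm L ≤ 8⁻ᵇ`. None of the
costs per unit of `N` involves `L`. -/
theorem exists_arm_le_exp {P : Measure C.Config} (hP : C.IsRandomCluster β q P) {c₁ : ℝ}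
    (hc₁ : 0 < c₁)
    (hdecay : ∀ x : Fin 2 → ℤ, P.real (C.connects {0} {x}) ≤ Real.exp (-c₁ * latticeNorm x))
    (harm : Filter.Tendsto (C.arm β q) Filter.atTop (nhds 0)) :
    ∃ ν₀ ν₁ : ℝ, 0 < ν₀ ∧ 0 < ν₁ ∧ ∀ N : ℕ, C.arm β q N ≤ ν₀ * Real.exp (-ν₁ * N) := by
  obtain ⟨r, hr0, hr⟩ := C.exists_hasRange
  obtain ⟨c, hc, hc1, hce⟩ := C.exists_closing_bound β hβ
  set K : ℝ := (2 * q ^ 2 / c) ^ (latticeBox 2 r).card with hK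
  have hK0 : 0 ≤ K := by positivity
  have hr0' : (0 : ℝ) < r := by exact_mod_cast hr0
  -- The layer has at most `4 r (2L+1)(2n+1) ≤ 12 r N` sites, where `N = (2L+1) n`.
  obtain ⟨t, ht, ht1, htK⟩ : ∃ t : ℝ, 0 < t ∧ t ≤ 1 ∧ t * K * (12 * r) ≤ c₁ / 4 := by
    refine ⟨min 1 (c₁ / (48 * r * (K + 1))), by positivity, min_le_left _ _, ?_⟩
    calc min 1 (c₁ / (48 * r * (K + 1))) * K * (12 * r)
        ≤ c₁ / (48 * r * (K + 1)) * (K + 1) * (12 * r) := by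
          gcongr
          · exact min_le_right _ _
          · linarith
      _ = c₁ / 4 := by field_simp; ring
  -- The hit threshold will be `4 r (2L+1) (n / b)`, at most `4 r N / b`, so that `t⁻¹` to this
  -- power is at most `exp (c₁ N / 4)`.
  obtain ⟨b, hb, hbt⟩ : ∃ b : ℕ, 0 < b ∧ 4 * r * (-Real.log t) ≤ c₁ / 4 * b := by
    obtain ⟨b, hb⟩ := exists_nat_ge (4 * r * (-Real.log t) / (c₁ / 4))
    refine ⟨b + 1, Nat.succ_pos _, ?_⟩
    rw [div_le_iff₀ (by positivity)] at hb
    push_cast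
    nlinarith
  obtain ⟨L, hrL, hL⟩ : ∃ L : ℕ, r ≤ L ∧ C.arm β q L ≤ (1 / 8) ^ b := by
    have h1 : ∀ᶠ L in Filter.atTop, C.arm β q L ≤ (1 / 8) ^ b :=
      (harm.eventually_lt_const (by positivity : (0 : ℝ) < (1 / 8) ^ b)).mono fun _ h => h.le
    obtain ⟨L, h2, h3⟩ := ((Filter.eventually_ge_atTop r).and h1).exists
    exact ⟨L, h2, h3⟩
  set ℓ : ℝ := 2 * L + 1 with hℓ
  have hℓ0 : 0 < ℓ := by positivity
  set A₁ : ℝ := 4 * r * ℓ * 2 with hA₁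
  set A₂ : ℝ := (1 + 16 / c₁) ^ 2 * Real.exp (c₁ * (L + 2 * r)) with hA₂
  set ν₁ : ℝ := min (c₁ / 4) (Real.log 2 / ℓ) with hν₁
  have hν₁0 : 0 < ν₁ := lt_min (by positivity) (div_pos (Real.log_pos one_lt_two) hℓ0)
  -- Since `r ≤ L`, taking `n ≥ 2` leaves room for the depth `L + 2 r` in the box.
  have hmain : ∀ n : ℕ, 2 ≤ n →
      C.arm β q ((2 * L + 1) * n) ≤ (A₁ + A₂) * Real.exp (-ν₁ * (ℓ * n)) := by
    intro n hn
    have hNge : L + 2 * r ≤ (2 * L + 1) * n := by nlinarith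
    have hn1 : (1 : ℝ) ≤ n := by exact_mod_cast (by omega : 1 ≤ n)
    refine (C.arm_le hβ hq hP hr hc hc1 hce hrL hNge (n / b) ht ht1).trans ?_
    rw [add_mul A₁ A₂]
    refine add_le_add ?_ ?_
    · have h1 := pow_div_succ_le (C.arm_nonneg hβ hq L) hb hL n
      calc _ ≤ ((4 * r * (2 * L + 1) : ℕ) : ℝ) * (2 * Real.exp (-Real.log 2 * n)) :=
            mul_le_mul_of_nonneg_left h1 (Nat.cast_nonneg _)
        _ = A₁ * Real.exp (-Real.log 2 * n) := by rw [hA₁, hℓ]; push_cast; ring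
        _ ≤ A₁ * Real.exp (-ν₁ * (ℓ * n)) := by
            refine mul_le_mul_of_nonneg_left (Real.exp_le_exp.2 ?_) (by positivity)
            have h2 : ν₁ * ℓ ≤ Real.log 2 := by
              rw [← le_div_iff₀ hℓ0]; exact min_le_right _ _
            nlinarith
    · set N : ℕ := (2 * L + 1) * n with hN
      have hNr : (N : ℝ) = ℓ * n := by rw [hN, hℓ]; push_cast; ring
      have e1 : (t ^ (4 * r * (2 * L + 1) * (n / b)))⁻¹ ≤ Real.exp (c₁ / 4 * N) := by
        rw [← Real.exp_log ht, ← Real.exp_nat_mul, ← Real.exp_neg, Real.exp_le_exp]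
        have hdiv : ((n / b : ℕ) : ℝ) * b ≤ n := by exact_mod_cast Nat.div_mul_le_self n b
        have hj : (0 : ℝ) ≤ ((n / b : ℕ) : ℝ) := Nat.cast_nonneg _
        have hc₁' : 0 ≤ c₁ / 4 := by positivity
        calc -(((4 * r * (2 * L + 1) * (n / b) : ℕ) : ℝ) * Real.log t)
            = ℓ * (n / b : ℕ) * (4 * r * (-Real.log t)) := by rw [hℓ]; push_cast; ring
          _ ≤ ℓ * (n / b : ℕ) * (c₁ / 4 * b) := mul_le_mul_of_nonneg_left hbt (by positivity)
          _ = c₁ / 4 * (ℓ * ((n / b : ℕ) * b)) := by ring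
          _ ≤ c₁ / 4 * (ℓ * n) := by gcongr
          _ = _ := by rw [hNr]
      have e2 : (1 + t * K) ^ (4 * r * (2 * L + 1) * (2 * n + 1)) ≤ Real.exp (c₁ / 4 * N) := by
        have h1 : 1 + t * K ≤ Real.exp (t * K) := by
          rw [add_comm]; exact Real.add_one_le_exp _
        calc _ ≤ Real.exp (t * K) ^ (4 * r * (2 * L + 1) * (2 * n + 1)) :=
              pow_le_pow_left₀ (by positivity) h1 _
          _ = Real.exp (((4 * r * (2 * L + 1) * (2 * n + 1) : ℕ) : ℝ) * (t * K)) :=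
              (Real.exp_nat_mul _ _).symm
          _ ≤ _ := by
              rw [Real.exp_le_exp]
              calc ((4 * r * (2 * L + 1) * (2 * n + 1) : ℕ) : ℝ) * (t * K)
                  = (t * K * (4 * r)) * (ℓ * (2 * n + 1)) := by rw [hℓ]; push_cast; ring
                _ ≤ (t * K * (4 * r)) * (ℓ * (3 * n)) := by
                    gcongr
                    linarith
                _ = t * K * (12 * r) * (ℓ * n) := by ring
                _ ≤ c₁ / 4 * (ℓ * n) := mul_le_mul_of_nonneg_right htK (by positivity)
                _ = _ := by rw [hNr]
      have e3 := C.sum_connects_le hc₁ hdecay (N - L - 2 * r) N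
      have hcast : ((N - L - 2 * r : ℕ) : ℝ) = N - L - 2 * r := by
        rw [Nat.sub_sub, Nat.cast_sub hNge]; push_cast; ring
      rw [hcast] at e3
      calc _ ≤ Real.exp (c₁ / 4 * N) * Real.exp (c₁ / 4 * N) *
            ((1 + 16 / c₁) ^ 2 * Real.exp (c₁ / 4 * N) * Real.exp (-c₁ * (N - L - 2 * r))) := by
            refine mul_le_mul (mul_le_mul e1 e2 (by positivity) (Real.exp_pos _).le) e3
              (Finset.sum_nonneg fun _ _ => measureReal_nonneg) (by positivity)
        _ = A₂ * Real.exp (-(c₁ / 4) * N) := by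
            rw [hA₂, mul_assoc _ (Real.exp _) (Real.exp (-(c₁ / 4) * N)), ← Real.exp_add,
              mul_assoc _ (Real.exp _) (Real.exp _), ← Real.exp_add, mul_left_comm, ← Real.exp_add,
              ← Real.exp_add]
            congr 2
            ring
        _ ≤ A₂ * Real.exp (-ν₁ * (ℓ * n)) := by
            refine mul_le_mul_of_nonneg_left (Real.exp_le_exp.2 ?_) (by positivity)
            rw [hNr]
            have h2 : ν₁ ≤ c₁ / 4 := min_le_left _ _
            have h3 : 0 ≤ ℓ * n := by positivity
            nlinarith
  obtain ⟨ν₀, hν₀, h⟩ := exists_le_exp_of_multiples (C.arm_antitone hβ hq)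
    (fun N => C.prob_le_one hβ hq _ _ _) (m := 2 * L + 1) (A := A₁ + A₂) (by omega) (by positivity)
    hν₁0 fun n hn => (hmain n hn).trans_eq (by rw [hℓ]; push_cast; rfl)
  exact ⟨ν₀, ν₁, hν₀, hν₁0, h⟩

end

end FiniteRangeCoupling

/-! ### Limits of wired measures: translation invariance and tolerance. -/

namespace FiniteRangeCoupling

section

open Classical Filter Topology symmDiff

variable {d : ℕ} (C : FiniteRangeCoupling d)

/-- Events that are determined by finitely many bonds. -/
def IsLocal (A : Set C.Config) : Prop :=
  ∃ F : Finset C.Bond, ∀ ω ω' : C.Config, (∀ e ∈ F, ω e = ω' e) → ω ∈ A → ω' ∈ A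

variable {C}

theorem IsLocal.isOpen {A : Set C.Config} (hA : C.IsLocal A) : IsOpen A := by
  obtain ⟨F, hF⟩ := hA
  rw [isOpen_iff_mem_nhds]
  intro ω hω
  have h1 : (⋂ e ∈ F, (fun ω' : C.Config => ω' e) ⁻¹' {ω e}) ∈ 𝓝 ω := by
    refine (Filter.biInter_finset_mem F).2 fun e _ => ?_
    exact (continuous_apply e).continuousAt.preimage_mem_nhds
      ((isOpen_discrete {ω e}).mem_nhds rfl)
  refine Filter.mem_of_superset h1 fun ω' hω' => hF ω ω' (fun e he => ?_) hω
  simp only [Set.mem_iInter, Set.mem_preimage, Set.mem_singleton_iff] at hω'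
  exact (hω' e he).symm

theorem IsLocal.compl {A : Set C.Config} (hA : C.IsLocal A) : C.IsLocal Aᶜ := by
  obtain ⟨F, hF⟩ := hA
  exact ⟨F, fun ω ω' h hω hω' => hω (hF ω' ω (fun e he => (h e he).symm) hω')⟩

theorem IsLocal.isClopen {A : Set C.Config} (hA : C.IsLocal A) : IsClopen A :=
  ⟨isOpen_compl_iff.1 hA.compl.isOpen, hA.isOpen⟩

theorem IsLocal.measurableSet {A : Set C.Config} (hA : C.IsLocal A) : MeasurableSet A :=
  hA.isOpen.measurableSet

theorem IsLocal.preimage_update {A : Set C.Config} (hA : C.IsLocal A) (e : C.Bond) (b : Bool) :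
    C.IsLocal {ω | Function.update ω e b ∈ A} := by
  obtain ⟨F, hF⟩ := hA
  refine ⟨F, fun ω ω' h => hF _ _ fun e' he' => ?_⟩
  by_cases hee : e' = e
  · subst hee; simp
  · simp [hee, h e' he']

theorem IsLocal.preimage_shift {A : Set C.Config} (hA : C.IsLocal A) (v : Fin d → ℤ) :
    C.IsLocal {ω | C.shift v ω ∈ A} := by
  obtain ⟨F, hF⟩ := hA
  exact ⟨F.image (C.shiftBond v), fun ω ω' h => hF _ _ fun e' he' =>
    h _ (Finset.mem_image_of_mem _ he')⟩

variable (C)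

theorem isLocal_allOpen (F : Finset C.Bond) : C.IsLocal (C.allOpen F) :=
  ⟨F, fun _ _ h hω e he => (h e he) ▸ hω e he⟩

theorem exists_finset_touching (Λ : Finset (Fin d → ℤ)) :
    ∃ F : Finset C.Bond, ∀ u v (huv : s(u, v) ∈ C.bondGraph.edgeSet), u ∈ Λ → ⟨s(u, v), huv⟩ ∈ F := by
  obtain ⟨r, -, hr⟩ := C.exists_hasRange
  refine ⟨C.bondsIn (Λ.biUnion fun x => boxAt x r), fun u v huv hu => ?_⟩
  rw [mem_bondsIn]
  refine ⟨Finset.mem_biUnion.2 ⟨u, hu, mem_boxAt.2 fun i => by simp⟩,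
    Finset.mem_biUnion.2 ⟨u, hu, mem_boxAt.2 fun i => hr u v huv i⟩⟩

theorem isLocal_connects_compl (x : Fin d → ℤ) (Λ : Finset (Fin d → ℤ)) :
    C.IsLocal (C.connects {x} {y | y ∉ Λ}) := by
  obtain ⟨F, hF⟩ := C.exists_finset_touching Λ
  exact ⟨F, fun ω ω' h => C.connects_compl_congr fun u v huv hu => h _ (hF u v huv hu)⟩

theorem exists_subset_latticeBox (Λ : Finset (Fin d → ℤ)) : ∃ M, Λ ⊆ latticeBox d M := by
  refine ⟨∑ x ∈ Λ, ∑ i, (x i).natAbs, fun x hx => mem_latticeBox.2 fun i => ?_⟩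
  have h1 : (x i).natAbs ≤ ∑ i, (x i).natAbs :=
    Finset.single_le_sum (f := fun i => (x i).natAbs) (fun _ _ => Nat.zero_le _) (Finset.mem_univ i)
  have h2 : ∑ i, (x i).natAbs ≤ ∑ x ∈ Λ, ∑ i, (x i).natAbs :=
    Finset.single_le_sum (f := fun x => ∑ i, (x i).natAbs) (fun _ _ => Nat.zero_le _) hx
  rw [Int.abs_eq_natAbs]
  exact_mod_cast h1.trans h2

/-- A subsequential limit of the wired measures in boxes. -/
structure IsWiredLimit (β q : ℝ) (μ : Measure C.Config) : Prop where
  isProbabilityMeasure : IsProbabilityMeasure μ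
  tendsto : ∀ A, C.IsLocal A → Tendsto
    (fun M => C.prob β q (latticeBox d M) (fun _ => true) A) (hyperfilter ℕ) (𝓝 (μ.real A))

section wired

variable {β q : ℝ} (hβ : 0 ≤ β) (hq : 1 ≤ q)

include hβ hq

theorem isProbabilityMeasure_finiteVolume (Λ : Finset (Fin d → ℤ)) (η : C.Config) :
    IsProbabilityMeasure (C.finiteVolume β q Λ η) := by
  have h := C.finiteVolume_real hβ hq Λ η Set.univ
  rw [C.prob_univ hβ hq, Measure.real, ENNReal.toReal_eq_one_iff] at h
  exact ⟨h⟩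

/-- Probability measures on the compact configuration space form a compact space, so an ultrafilter
of wired measures converges. Local events are clopen, hence their probabilities converge. -/
theorem exists_isWiredLimit : ∃ μ : Measure C.Config, C.IsWiredLimit β q μ := by
  have hprob := fun M => C.isProbabilityMeasure_finiteVolume hβ hq (latticeBox d M) (fun _ => true)
  let m : ℕ → ProbabilityMeasure C.Config :=
    fun M => ⟨C.finiteVolume β q (latticeBox d M) (fun _ => true), hprob M⟩
  obtain ⟨μ, -, hμ⟩ := isCompact_univ.ultrafilter_le_nhds ((hyperfilter ℕ).map m) (by simp)
  refine ⟨μ, inferInstance, fun A hA => ?_⟩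
  have h1 : Tendsto m (hyperfilter ℕ) (𝓝 μ) := hμ
  have h2 := ProbabilityMeasure.tendsto_measure_of_isClopen_of_tendsto h1 hA.isClopen
  have h3 := (NNReal.continuous_coe.tendsto _).comp h2
  refine (h3.congr fun M => ?_)
  rw [← C.finiteVolume_real hβ hq]
  rfl

end wired

/-- These events form a π-system of increasing local events, so identities between measures can be
proved by monotonicity in the boundary condition. -/
theorem ext_of_allOpen {μ ν : Measure C.Config} [IsProbabilityMeasure μ] [IsProbabilityMeasure ν]
    (h : ∀ F, μ (C.allOpen F) = ν (C.allOpen F)) : μ = ν := by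
  refine MeasureTheory.ext_of_generate_finite (Set.range C.allOpen) (le_antisymm ?_ ?_) ?_ ?_
    (by simp)
  · refine iSup_le fun e => ?_
    have : Measurable[MeasurableSpace.generateFrom (Set.range C.allOpen)]
        (fun ω : C.Config => ω e) := by
      refine @measurable_to_bool _ (_) _ ?_
      refine MeasurableSpace.measurableSet_generateFrom ⟨{e}, ?_⟩
      ext ω
      simp [allOpen]
    exact this.comap_le
  · refine MeasurableSpace.generateFrom_le ?_
    rintro _ ⟨F, rfl⟩
    exact C.measurableSet_allOpen F
  · rintro _ ⟨F, rfl⟩ _ ⟨G, rfl⟩ _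
    refine ⟨F ∪ G, ?_⟩
    ext ω
    simp only [allOpen, Finset.mem_union, Set.mem_ofPred_eq, Set.mem_inter_iff]
    exact ⟨fun h => ⟨fun e he => h e (Or.inl he), fun e he => h e (Or.inr he)⟩,
      fun h e he => he.elim (h.1 e) (h.2 e)⟩
  · rintro _ ⟨F, rfl⟩
    exact h F

theorem exists_isLocal_measure_symmDiff_lt (μ : Measure C.Config) [IsFiniteMeasure μ]
    {A : Set C.Config} (hA : MeasurableSet A) {ε : ℝ} (hε : 0 < ε) :
    ∃ D, C.IsLocal D ∧ μ.real (D ∆ A) < ε := by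
  obtain ⟨D, hD, h⟩ := exists_measure_symmDiff_lt_of_generateFrom_isSetRing (μ := μ)
    (isSetRing_measurableCylinders (α := fun _ : C.Bond => Bool))
    ⟨{Set.univ}, Set.countable_singleton _, Set.singleton_subset_iff.2 (univ_mem_measurableCylinders _), by simp⟩
    generateFrom_measurableCylinders.symm hA (ENNReal.ofReal_pos.2 hε)
  refine ⟨D, ?_, ?_⟩
  · obtain ⟨F, S, -, rfl⟩ := (mem_measurableCylinders D).1 hD
    refine ⟨F, fun ω ω' hag hω => ?_⟩
    rw [mem_cylinder] at hω ⊢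
    have : F.restrict ω' = F.restrict ω := by
      funext e
      exact (hag e e.2).symm
    rwa [this]
  · rw [Measure.real]
    exact (ENNReal.toReal_lt_of_lt_ofReal h)

theorem measureReal_le_add_symmDiff {μ : Measure C.Config} [IsFiniteMeasure μ]
    (A D : Set C.Config) : μ.real A ≤ μ.real D + μ.real (D ∆ A) := by
  refine (measureReal_mono (fun ω hω => ?_)).trans (measureReal_union_le D (D ∆ A))
  by_cases h : ω ∈ D
  · exact Or.inl h
  · exact Or.inr (Or.inr ⟨hω, h⟩)

theorem measurable_update_config (e : C.Bond) (b : Bool) :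
    Measurable fun ω : C.Config => Function.update ω e b := by
  rw [measurable_pi_iff]
  intro e'
  by_cases h : e' = e
  · subst h; simp
  · simpa [h] using measurable_pi_apply e'

theorem measurable_shift (v : Fin d → ℤ) : Measurable (C.shift v) :=
  measurable_pi_iff.2 fun _ => measurable_pi_apply _

/-- The configuration `ω`, overwritten by `ξ` on the bonds in `F`. -/
noncomputable def overwrite (F : Finset C.Bond) (ξ ω : C.Config) : C.Config :=
  fun e => if e ∈ F then ξ e else ω e

theorem measurable_overwrite (F : Finset C.Bond) (ξ : C.Config) :
    Measurable (C.overwrite F ξ) := by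
  refine measurable_pi_iff.2 fun e => ?_
  by_cases h : e ∈ F
  · simp [overwrite, h]
  · simpa [overwrite, h] using measurable_pi_apply e

/-- Local modifications of the configuration do not make null events likely. -/
def IsTolerant (μ : Measure C.Config) : Prop :=
  ∀ (F : Finset C.Bond) (ξ : C.Config), ∃ K : ℝ, 0 < K ∧ ∀ A, MeasurableSet A →
    μ.real {ω | C.overwrite F ξ ω ∈ A} ≤ K * μ.real A

variable {C}

namespace IsWiredLimit

variable {β q : ℝ} {μ : Measure C.Config} (hμ : C.IsWiredLimit β q μ) (hβ : 0 ≤ β) (hq : 1 ≤ q)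

include hμ hβ hq

theorem real_le_prob (Λ : Finset (Fin d → ℤ)) {A : Set C.Config} (hA : C.IsLocal A)
    (hup : IsUpperSet A) : μ.real A ≤ C.prob β q Λ (fun _ => true) A := by
  obtain ⟨M, hM⟩ := exists_subset_latticeBox Λ
  refine le_of_tendsto (hμ.tendsto A hA) (Filter.Eventually.filter_mono Nat.hyperfilter_le_atTop ?_)
  filter_upwards [eventually_ge_atTop M] with M' hM'
  exact C.prob_wired_anti hβ hq (hM.trans (latticeBox_mono hM')) hup

/-- Translating an increasing local event turns a wired box into a translated wired box, whose
probabilities still lie above the limit. This gives one inequality for each shift; the inverse shift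
gives the converse. -/
theorem map_shift (v : Fin d → ℤ) : μ.map (C.shift v) = μ := by
  have := hμ.isProbabilityMeasure
  have hup : ∀ w {A : Set C.Config}, IsUpperSet A → IsUpperSet {ω | C.shift w ω ∈ A} :=
    fun w A hA ω ω' h hω => hA (fun e => h _) hω
  have key : ∀ w {A : Set C.Config}, C.IsLocal A → IsUpperSet A →
      μ.real A ≤ μ.real {ω | C.shift w ω ∈ A} := by
    intro w A hA hAup
    refine ge_of_tendsto (hμ.tendsto _ (hA.preimage_shift w)) (Eventually.of_forall fun M => ?_)
    have h1 : ∀ x, x + w ∈ latticeBox d M ↔ x ∈ boxAt (-w) M := fun x => by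
      simp [mem_latticeBox, mem_boxAt]
    rw [C.prob_shift h1]
    exact hμ.real_le_prob hβ hq _ hA hAup
  have : IsProbabilityMeasure (μ.map (C.shift v)) :=
    Measure.isProbabilityMeasure_map (C.measurable_shift v).aemeasurable
  refine C.ext_of_allOpen fun F => ?_
  rw [Measure.map_apply (C.measurable_shift v) (C.measurableSet_allOpen F)]
  have h1 := key v (C.isLocal_allOpen F) (C.isUpperSet_allOpen F)
  have h2 := key (-v) ((C.isLocal_allOpen F).preimage_shift v) (hup v (C.isUpperSet_allOpen F))
  have h3 : {ω | C.shift (-v) ω ∈ {ω | C.shift v ω ∈ C.allOpen F}} = C.allOpen F := by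
    ext ω
    simp [shift_shift, shift_zero]
  rw [h3] at h2
  exact (measureReal_eq_measureReal_iff).1 (le_antisymm h2 h1)

theorem update_le (e : C.Bond) (b : Bool) {A : Set C.Config} (hA : MeasurableSet A) :
    (if b = true then C.bondProb β e else 1 - C.bondProb β e) *
      μ.real {ω | Function.update ω e b ∈ A} ≤ 2 * q ^ 2 * μ.real A := by
  have := hμ.isProbabilityMeasure
  set p : ℝ := if b = true then C.bondProb β e else 1 - C.bondProb β e with hp
  have hp0 : 0 ≤ p := by
    rw [hp]; split_ifs
    exacts [C.bondProb_nonneg hβ e, (C.one_sub_bondProb_pos β e).le]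
  have hloc : ∀ D, C.IsLocal D →
      p * μ.real {ω | Function.update ω e b ∈ D} ≤ 2 * q ^ 2 * μ.real D := by
    intro D hD
    refine le_of_tendsto_of_tendsto ((hμ.tendsto _ (hD.preimage_update e b)).const_mul p)
      ((hμ.tendsto D hD).const_mul (2 * q ^ 2)) ?_
    obtain ⟨M, hM⟩ : ∃ M, e ∈ C.bondsIn (latticeBox d M) := by
      obtain ⟨e, he⟩ := e
      induction e using Sym2.ind with
      | _ x y =>
        obtain ⟨M, hM⟩ := exists_subset_latticeBox ({x, y} : Finset (Fin d → ℤ))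
        exact ⟨M, (C.mem_bondsIn he).2 ⟨hM (by simp), hM (by simp)⟩⟩
    refine Filter.Eventually.filter_mono Nat.hyperfilter_le_atTop ?_
    filter_upwards [eventually_ge_atTop M] with M' hM'
    exact C.prob_update_le hβ hq (C.bondsIn_mono (latticeBox_mono hM') hM) b _ D
  have hm := C.measurable_update_config e b
  refine le_of_forall_pos_le_add fun ε hε => ?_
  set δ : ℝ := ε / (p + 2 * q ^ 2) with hδ
  have hq0 : 0 < p + 2 * q ^ 2 := by positivity
  -- Approximating under the sum of `μ` and its image under the update makes one local `D` close to
  -- `A` both before and after the update.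
  obtain ⟨D, hD, hDA⟩ := C.exists_isLocal_measure_symmDiff_lt
    (μ + μ.map (fun ω => Function.update ω e b)) hA (div_pos hε hq0)
  have hDAm : MeasurableSet (D ∆ A) := hD.measurableSet.symmDiff hA
  rw [measureReal_add_apply, map_measureReal_apply hm hDAm] at hDA
  have hnn1 : 0 ≤ μ.real (D ∆ A) := measureReal_nonneg
  have hnn2 : 0 ≤ μ.real ((fun ω => Function.update ω e b) ⁻¹' (D ∆ A)) := measureReal_nonneg
  have h1 : μ.real {ω | Function.update ω e b ∈ A} ≤ μ.real {ω | Function.update ω e b ∈ D} + δ :=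
    (C.measureReal_le_add_symmDiff _ {ω | Function.update ω e b ∈ D}).trans
      (add_le_add le_rfl (by
        have : {ω | Function.update ω e b ∈ D} ∆ {ω | Function.update ω e b ∈ A} =
          (fun ω => Function.update ω e b) ⁻¹' (D ∆ A) := rfl
        rw [this]; linarith))
  have h2 : μ.real D ≤ μ.real A + δ :=
    (C.measureReal_le_add_symmDiff D A).trans (add_le_add le_rfl (by
      rw [symmDiff_comm]; linarith))
  calc p * μ.real {ω | Function.update ω e b ∈ A}
      ≤ p * (μ.real {ω | Function.update ω e b ∈ D} + δ) := mul_le_mul_of_nonneg_left h1 hp0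
    _ ≤ 2 * q ^ 2 * μ.real D + p * δ := by rw [mul_add]; exact add_le_add (hloc D hD) le_rfl
    _ ≤ 2 * q ^ 2 * (μ.real A + δ) + p * δ := by gcongr
    _ = 2 * q ^ 2 * μ.real A + (p + 2 * q ^ 2) * δ := by ring
    _ = _ := by rw [hδ, mul_div_cancel₀ _ hq0.ne']

-- Iterated single-bond finite energy. Strict positivity of β is needed because at β = 0 a bond
-- cannot be forced open.
omit hβ in
theorem isTolerant (hβ : 0 < β) : C.IsTolerant μ := by
  intro F ξ
  induction F using Finset.induction_on with
  | empty =>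
    refine ⟨1, one_pos, fun A _ => ?_⟩
    have : ∀ ω, C.overwrite ∅ ξ ω = ω := fun ω => by funext e; simp [overwrite]
    simp [this]
  | insert e F he ih =>
    obtain ⟨K, hK, h⟩ := ih
    set p : ℝ := if ξ e = true then C.bondProb β e else 1 - C.bondProb β e with hp
    have hp0 : 0 < p := by
      rw [hp]; split_ifs
      exacts [C.bondProb_pos hβ e, C.one_sub_bondProb_pos β e]
    refine ⟨K * (2 * q ^ 2 / p), by positivity, fun A hA => ?_⟩
    have h1 : {ω | C.overwrite (insert e F) ξ ω ∈ A} =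
        {ω | C.overwrite F ξ ω ∈ {ω | Function.update ω e (ξ e) ∈ A}} := by
      ext ω
      have : C.overwrite (insert e F) ξ ω = Function.update (C.overwrite F ξ ω) e (ξ e) := by
        funext e'
        by_cases h' : e' = e
        · subst h'; simp [overwrite]
        · simp [overwrite, h']
      simp [this]
    rw [h1, mul_assoc]
    refine (h _ (C.measurable_update_config e (ξ e) hA)).trans
      (mul_le_mul_of_nonneg_left ?_ hK.le)
    rw [div_mul_eq_mul_div, le_div_iff₀ hp0, mul_comm]
    exact hμ.update_le hβ.le hq e (ξ e) hA

end IsWiredLimit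

end

end FiniteRangeCoupling

/-! ### Uniqueness of the infinite cluster implies the DLR equations for the wired limit. -/

namespace FiniteRangeCoupling

section

open Classical Filter Topology

variable {d : ℕ} (C : FiniteRangeCoupling d)

/-- The open cluster of `x` is infinite. -/
def InInfinite (ω : C.Config) (x : Fin d → ℤ) : Prop :=
  ∀ k, ω ∈ C.connects {x} {y | y ∉ latticeBox d k}

/-- There is at most one infinite open cluster. -/
def UniqueInfinite (ω : C.Config) : Prop :=
  ∀ x y, C.InInfinite ω x → C.InInfinite ω y → (C.openGraph ω).Reachable x y

theorem measurableSet_inInfinite (x : Fin d → ℤ) :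
    MeasurableSet {ω : C.Config | C.InInfinite ω x} := by
  have : {ω : C.Config | C.InInfinite ω x} = ⋂ k, C.connects {x} {y | y ∉ latticeBox d k} := by
    ext ω; simp [InInfinite]
  rw [this]
  exact MeasurableSet.iInter fun k => C.measurableSet_connects _ _

theorem measurableSet_uniqueInfinite : MeasurableSet {ω : C.Config | C.UniqueInfinite ω} := by
  have : {ω : C.Config | C.UniqueInfinite ω} = ⋂ x, ⋂ y, ({ω : C.Config | C.InInfinite ω x}ᶜ ∪
      ({ω : C.Config | C.InInfinite ω y}ᶜ ∪
        {ω : C.Config | (C.openGraph ω).Reachable x y})) := by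
    ext ω
    simp only [UniqueInfinite, Set.mem_ofPred_eq, Set.mem_iInter, Set.mem_union,
      Set.mem_compl_iff]
    refine forall₂_congr fun x y => ?_
    tauto
  rw [this]
  exact MeasurableSet.iInter fun x => MeasurableSet.iInter fun y =>
    (C.measurableSet_inInfinite x).compl.union
      ((C.measurableSet_inInfinite y).compl.union (C.measurableSet_reachable x y))

theorem measurable_numClusters (Λ : Finset (Fin d → ℤ)) : Measurable (C.numClusters Λ) := by
  -- The count depends only on the connection relation among sites of `Λ`, which takes finitely many
  -- values, each on a measurable set.
  set rel : C.Config → Finset ((Fin d → ℤ) × (Fin d → ℤ)) :=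
    fun ω => (Λ ×ˢ Λ).filter fun p => (C.openGraph ω).Reachable p.1 p.2 with hrel
  have hmeas : ∀ S, MeasurableSet {ω | rel ω = S} := by
    intro S
    have : {ω | rel ω = S} = if S ⊆ Λ ×ˢ Λ then ⋂ p ∈ Λ ×ˢ Λ,
        (if p ∈ S then {ω : C.Config | (C.openGraph ω).Reachable p.1 p.2}
          else {ω : C.Config | (C.openGraph ω).Reachable p.1 p.2}ᶜ) else ∅ := by
      ext ω
      split_ifs with hS
      · simp only [Set.mem_ofPred_eq, Set.mem_iInter, hrel]
        constructor
        · rintro rfl p hp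
          split_ifs with h
          · exact (Finset.mem_filter.1 h).2
          · exact fun h' => h (Finset.mem_filter.2 ⟨hp, h'⟩)
        · intro h
          ext p
          rw [Finset.mem_filter]
          constructor
          · rintro ⟨hp, hr⟩
            by_contra hpS
            have := h p hp
            rw [if_neg hpS] at this
            exact this hr
          · intro hpS
            have := h p (hS hpS)
            rw [if_pos hpS] at this
            exact ⟨hS hpS, this⟩
      · simp only [Set.mem_ofPred_eq, Set.mem_empty_iff_false, iff_false]
        rintro rfl
        exact hS (Finset.filter_subset _ _)
    rw [this]
    split_ifs
    · refine Finset.measurableSet_biInter _ fun p _ => ?_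
      split_ifs
      exacts [C.measurableSet_reachable _ _, (C.measurableSet_reachable _ _).compl]
    · exact MeasurableSet.empty
  refine measurable_to_countable' fun n => ?_
  have : C.numClusters Λ ⁻¹' {n} = ⋃ S ∈ rel '' (C.numClusters Λ ⁻¹' {n}), {ω | rel ω = S} := by
    ext ω
    simp only [Set.mem_iUnion]
    constructor
    · intro h
      exact ⟨rel ω, ⟨ω, h, rfl⟩, rfl⟩
    · rintro ⟨_, ⟨ω', h, rfl⟩, hω⟩
      rw [Set.mem_preimage, ← Set.mem_singleton_iff.1 h]
      refine Set.mem_singleton_iff.2 (C.numClusters_congr fun x hx y hy => ?_)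
      have h1 : (x, y) ∈ rel ω ↔ (x, y) ∈ rel ω' := by
        rw [show rel ω = rel ω' from hω]
      simpa [hrel, hx, hy] using h1
  rw [this]
  exact MeasurableSet.biUnion (Set.to_countable _) fun S _ => hmeas S

theorem measurable_weight (β q : ℝ) (Λ : Finset (Fin d → ℤ)) : Measurable (C.weight β q Λ) := by
  refine Measurable.mul (Finset.measurable_prod _ fun e _ => ?_)
    ((measurable_from_top (f := fun n : ℕ => q ^ n)).comp (C.measurable_numClusters Λ))
  have he : MeasurableSet {ω : C.Config | ω e = true} :=
    measurable_pi_apply (X := fun _ : C.Bond => Bool) e (measurableSet_singleton true)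
  exact Measurable.ite he measurable_const measurable_const

theorem glue_eq_overwrite (Λ : Finset (Fin d → ℤ)) (ω : C.Config) (ζ : C.bondsIn Λ → Bool) :
    C.glue Λ ω ζ = C.overwrite (C.bondsIn Λ) (C.glue Λ (fun _ => false) ζ) ω := by
  funext e
  by_cases he : e ∈ C.bondsIn Λ
  · simp [overwrite, he, glue_of_mem C he]
  · simp [overwrite, he, glue_of_notMem C he]

theorem measurable_glue (Λ : Finset (Fin d → ℤ)) (ζ : C.bondsIn Λ → Bool) :
    Measurable fun ω => C.glue Λ ω ζ := by
  rw [show (fun ω => C.glue Λ ω ζ) = _ from funext fun ω => C.glue_eq_overwrite Λ ω ζ]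
  exact C.measurable_overwrite _ _

theorem measurable_prob (β q : ℝ) (Λ : Finset (Fin d → ℤ)) {A : Set C.Config}
    (hA : MeasurableSet A) : Measurable fun η => C.prob β q Λ η A := by
  have hw : ∀ ζ : C.bondsIn Λ → Bool, Measurable fun η => C.weight β q Λ (C.glue Λ η ζ) :=
    fun ζ => (C.measurable_weight β q Λ).comp (C.measurable_glue Λ ζ)
  refine Measurable.div (Finset.measurable_sum _ fun ζ _ => (hw ζ).mul ?_)
    (Finset.measurable_sum _ fun ζ _ => hw ζ)
  exact (measurable_const.indicator hA).comp (C.measurable_glue Λ ζ)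

theorem measurable_glue_outside (Λ : Finset (Fin d → ℤ)) (ζ : C.bondsIn Λ → Bool) :
    Measurable[C.outside Λ] fun ω => C.glue Λ ω ζ := by
  refine @measurable_pi_iff _ _ _ (C.outside Λ) _ _ |>.2 fun e => ?_
  by_cases he : e ∈ C.bondsIn Λ
  · simp only [glue_of_mem C he]
    exact measurable_const
  · simp only [glue_of_notMem C he]
    exact Measurable.of_comap_le
      (le_iSup (fun e : {e : C.Bond // e ∉ C.bondsIn Λ} =>
        MeasurableSpace.comap (fun ω : C.Config => ω e.1) inferInstance) ⟨e, he⟩)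

theorem measurable_prob_outside (β q : ℝ) (Λ : Finset (Fin d → ℤ)) {A : Set C.Config}
    (hA : MeasurableSet A) : Measurable[C.outside Λ] fun η => C.prob β q Λ η A := by
  have h := (C.measurable_prob β q Λ hA).comp (C.measurable_glue_outside Λ fun _ => false)
  refine (funext fun η => ?_ : (fun η => C.prob β q Λ η A) = _) ▸ h
  exact C.expect_congr β q (fun e he => (C.glue_of_notMem he).symm) _

theorem mem_of_measurableSet_outside {Λ : Finset (Fin d → ℤ)} {s : Set C.Config}
    (hs : MeasurableSet[C.outside Λ] s) {ω ω' : C.Config}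
    (h : ∀ e, e ∉ C.bondsIn Λ → ω e = ω' e) (hω : ω ∈ s) : ω' ∈ s := by
  have hle : C.outside Λ ≤ MeasurableSpace.comap (fun ω => C.glue Λ ω fun _ => false) ⊤ := by
    refine iSup_le fun e => ?_
    have : (fun ω : C.Config => ω e.1) =
        (fun ω : C.Config => ω e.1) ∘ fun ω => C.glue Λ ω fun _ => false := by
      funext ω
      exact (C.glue_of_notMem (η := ω) (ζ := fun _ => false) e.2).symm
    rw [this, ← MeasurableSpace.comap_comp]
    exact MeasurableSpace.comap_mono le_top
  obtain ⟨S, -, rfl⟩ := hle s hs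
  rw [Set.mem_preimage] at hω ⊢
  rwa [← C.glue_congr h]

/-- The configuration in which exactly the bonds that are not inside the box are open. -/
noncomputable def openOff (k : ℕ) : C.Config := fun e => decide (e ∉ C.bondsIn (latticeBox d k))

theorem sup_openOff_of_mem {k : ℕ} {η : C.Config} {e : C.Bond}
    (he : e ∈ C.bondsIn (latticeBox d k)) : (η ⊔ C.openOff k) e = η e := by
  simp [openOff, he]

theorem sup_openOff_of_notMem {k : ℕ} {η : C.Config} {e : C.Bond}
    (he : e ∉ C.bondsIn (latticeBox d k)) : (η ⊔ C.openOff k) e = true := by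
  simp [openOff, he]

theorem exists_subset_bondsIn (F : Finset C.Bond) : ∃ M, F ⊆ C.bondsIn (latticeBox d M) := by
  induction F using Finset.induction_on with
  | empty => exact ⟨0, by simp⟩
  | insert e F _ ih =>
    obtain ⟨M, hM⟩ := ih
    obtain ⟨e, he⟩ := e
    induction e using Sym2.ind with
    | _ x y =>
      obtain ⟨M', hM'⟩ := exists_subset_latticeBox ({x, y} : Finset (Fin d → ℤ))
      refine ⟨max M M', Finset.insert_subset ?_
        (hM.trans (C.bondsIn_mono (latticeBox_mono (le_max_left _ _))))⟩
      rw [mem_bondsIn]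
      exact ⟨latticeBox_mono (le_max_right _ _) (hM' (by simp)),
        latticeBox_mono (le_max_right _ _) (hM' (by simp))⟩

/-- A finite cluster and all bonds at it lie inside a large box, so changes outside that box cannot
extend the cluster. -/
theorem eventually_not_reachable {ω : C.Config} {ω' : ℕ → C.Config}
    (h : ∀ k, ∀ e ∈ C.bondsIn (latticeBox d k), ω' k e = ω e) {x y : Fin d → ℤ}
    (hx : ¬ C.InInfinite ω x) (hxy : ¬ (C.openGraph ω).Reachable x y) :
    ∀ᶠ k in atTop, ¬ (C.openGraph (ω' k)).Reachable x y := by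
  obtain ⟨r, -, hr⟩ := C.exists_hasRange
  simp only [InInfinite, not_forall] at hx
  obtain ⟨m, hm⟩ := hx
  have hsub : ∀ u ∈ C.cluster ω x, u ∈ latticeBox d m := by
    intro u hu
    by_contra hum
    exact hm ⟨x, rfl, u, hum, hu⟩
  filter_upwards [eventually_ge_atTop (m + r)] with k hk hreach
  obtain ⟨u, v, -, hu, hv, huv, ho⟩ := hreach.exists_exit (S := C.cluster ω x) (.refl _) hxy
  have hvk : v ∈ latticeBox d k := by
    by_contra hvk
    exact C.notMem_latticeBox_of_adj hr huv hvk hk (hsub u hu)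
  have he := (C.mem_bondsIn huv).2 ⟨latticeBox_mono (by omega) (hsub u hu), hvk⟩
  rw [h k _ he] at ho
  exact hv (SimpleGraph.Reachable.trans hu (SimpleGraph.Adj.reachable ⟨huv, ho⟩))

/-- Opening everything far away can merge two clusters meeting `Λ` only if both are infinite, and
then uniqueness says that they already coincide. The cluster counts, hence the whole kernel, are
eventually unchanged. -/
theorem eventually_prob_sup_openOff_eq (β q : ℝ) (Λ : Finset (Fin d → ℤ)) {η : C.Config}
    (hη : ∀ ζ : C.bondsIn Λ → Bool, C.UniqueInfinite (C.glue Λ η ζ)) (F : Finset C.Bond) :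
    ∀ᶠ k in atTop, C.prob β q Λ (η ⊔ C.openOff k) (C.allOpen F) =
      C.prob β q Λ η (C.allOpen F) := by
  have hle : ∀ ζ k, C.glue Λ η ζ ≤ C.glue Λ (η ⊔ C.openOff k) ζ := by
    intro ζ k e
    by_cases he : e ∈ C.bondsIn Λ
    · rw [glue_of_mem C he, glue_of_mem C he]
    · rw [glue_of_notMem C he, glue_of_notMem C he]; exact le_sup_left (a := η) (b := C.openOff k) e
  have hag : ∀ ζ k, ∀ e ∈ C.bondsIn (latticeBox d k),
      C.glue Λ (η ⊔ C.openOff k) ζ e = C.glue Λ η ζ e := by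
    intro ζ k e hek
    by_cases he : e ∈ C.bondsIn Λ
    · rw [glue_of_mem C he, glue_of_mem C he]
    · rw [glue_of_notMem C he, glue_of_notMem C he, C.sup_openOff_of_mem hek]
  have hreach : ∀ᶠ k in atTop, ∀ ζ : C.bondsIn Λ → Bool, ∀ x ∈ Λ, ∀ y ∈ Λ,
      ((C.openGraph (C.glue Λ (η ⊔ C.openOff k) ζ)).Reachable x y ↔
        (C.openGraph (C.glue Λ η ζ)).Reachable x y) := by
    refine eventually_all.2 fun ζ => ?_
    rw [eventually_all_finset]
    intro x _
    rw [eventually_all_finset]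
    intro y _
    by_cases hxy : (C.openGraph (C.glue Λ η ζ)).Reachable x y
    · exact Eventually.of_forall fun k => ⟨fun _ => hxy, fun h => h.mono (C.openGraph_mono (hle ζ k))⟩
    · have hinf : ¬ C.InInfinite (C.glue Λ η ζ) x ∨ ¬ C.InInfinite (C.glue Λ η ζ) y := by
        by_contra hcon
        rw [not_or, not_not, not_not] at hcon
        exact hxy (hη ζ x y hcon.1 hcon.2)
      have hev : ∀ᶠ k in atTop,
          ¬ (C.openGraph (C.glue Λ (η ⊔ C.openOff k) ζ)).Reachable x y := by
        rcases hinf with hx | hy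
        · exact C.eventually_not_reachable (hag ζ) hx hxy
        · exact (C.eventually_not_reachable (hag ζ) hy fun h => hxy h.symm).mono
            fun k hk h => hk h.symm
      exact hev.mono fun k hk => ⟨fun h => absurd h hk, fun h => absurd h hxy⟩
  obtain ⟨M, hM⟩ := C.exists_subset_bondsIn F
  filter_upwards [hreach, eventually_ge_atTop M] with k hk hkM
  have hF : F ⊆ C.bondsIn (latticeBox d k) := hM.trans (C.bondsIn_mono (latticeBox_mono hkM))
  have hw : ∀ ζ, C.weight β q Λ (C.glue Λ (η ⊔ C.openOff k) ζ) =
      C.weight β q Λ (C.glue Λ η ζ) := by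
    intro ζ
    rw [weight, weight, C.numClusters_congr (hk ζ)]
    congr 1
    exact Finset.prod_congr rfl fun e he => by rw [glue_of_mem C he, glue_of_mem C he]
  have hi : ∀ ζ, (C.allOpen F).indicator (fun _ => (1 : ℝ)) (C.glue Λ (η ⊔ C.openOff k) ζ) =
      (C.allOpen F).indicator (fun _ => 1) (C.glue Λ η ζ) := by
    intro ζ
    have : C.glue Λ (η ⊔ C.openOff k) ζ ∈ C.allOpen F ↔ C.glue Λ η ζ ∈ C.allOpen F :=
      forall₂_congr fun e he => by rw [hag ζ k e (hF he)]
    by_cases hm : C.glue Λ η ζ ∈ C.allOpen F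
    · rw [Set.indicator_of_mem hm, Set.indicator_of_mem (this.2 hm)]
    · rw [Set.indicator_of_notMem hm, Set.indicator_of_notMem (mt this.1 hm)]
  rw [prob, prob, expect, expect, partitionFunction, partitionFunction]
  simp only [hw, hi]

section dlr

variable {C} {β q : ℝ} {μ : Measure C.Config}

theorem IsWiredLimit.tendsto_expect (hμ : C.IsWiredLimit β q μ) {f : C.Config → ℝ}
    (F : Finset C.Bond) (hf : ∀ ω ω' : C.Config, (∀ e ∈ F, ω e = ω' e) → f ω = f ω') :
    Tendsto (fun M => C.expect β q (latticeBox d M) (fun _ => true) f) (hyperfilter ℕ)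
      (𝓝 (∫ ω, f ω ∂μ)) := by
  have := hμ.isProbabilityMeasure
  set A : Finset C.Bond → Set C.Config := fun S => {ω | F.filter (fun e => ω e = true) = S} with hA
  have hloc : ∀ S, C.IsLocal (A S) := by
    intro S
    refine ⟨F, fun ω ω' h hω => ?_⟩
    rw [hA, Set.mem_ofPred_eq] at hω ⊢
    rw [← hω]
    exact Finset.filter_congr fun e he => by rw [h e he]
  have hf_eq : f = fun ω => ∑ S ∈ F.powerset,
      f (C.openExactly S) * (A S).indicator (fun _ => 1) ω := by
    funext ω
    rw [Finset.sum_eq_single (F.filter fun e => ω e = true)]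
    · have h1 : ω ∈ A (F.filter fun e => ω e = true) := rfl
      rw [Set.indicator_of_mem h1, mul_one]
      exact hf _ _ fun e he => by
        by_cases h : ω e = true <;> simp [openExactly, he, h]
    · intro S _ hS
      have h1 : ω ∉ A S := fun h => hS h.symm
      rw [Set.indicator_of_notMem h1, mul_zero]
    · exact fun h => absurd (Finset.mem_powerset.2 (Finset.filter_subset _ _)) h
  have h1 : ∀ M, C.expect β q (latticeBox d M) (fun _ => true) f =
      ∑ S ∈ F.powerset, f (C.openExactly S) *
        C.prob β q (latticeBox d M) (fun _ => true) (A S) := by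
    intro M
    conv_lhs => rw [hf_eq]
    rw [expect_sum]
    exact Finset.sum_congr rfl fun S _ => C.expect_const_mul _ _ _ _ _ _
  have h2 : ∫ ω, f ω ∂μ = ∑ S ∈ F.powerset, f (C.openExactly S) * μ.real (A S) := by
    conv_lhs => rw [hf_eq]
    rw [integral_finsetSum]
    · refine Finset.sum_congr rfl fun S _ => ?_
      rw [integral_const_mul, integral_indicator_const _ (hloc S).measurableSet]
      simp
    · intro S _
      exact ((integrable_const _).indicator (hloc S).measurableSet).const_mul _
  simp only [h1]
  rw [h2]
  exact tendsto_finsetSum _ fun S _ => (hμ.tendsto _ (hloc S)).const_mul _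

theorem IsWiredLimit.ae_uniqueInfinite_glue (hμ : C.IsWiredLimit β q μ) (htol : C.IsTolerant μ)
    (huniq : ∀ᵐ ω ∂μ, C.UniqueInfinite ω) (Λ : Finset (Fin d → ℤ)) :
    ∀ᵐ η ∂μ, ∀ ζ : C.bondsIn Λ → Bool, C.UniqueInfinite (C.glue Λ η ζ) := by
  have := hμ.isProbabilityMeasure
  refine ae_all_iff.2 fun ζ => ?_
  obtain ⟨K, -, hK⟩ := htol (C.bondsIn Λ) (C.glue Λ (fun _ => false) ζ)
  have h1 := hK _ C.measurableSet_uniqueInfinite.compl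
  have h2 : μ.real {ω | C.UniqueInfinite ω}ᶜ = 0 := by
    rw [Measure.real, ENNReal.toReal_eq_zero_iff]
    exact Or.inl huniq
  rw [h2, mul_zero] at h1
  have h3 := le_antisymm h1 measureReal_nonneg
  rw [measureReal_eq_zero_iff] at h3
  rw [ae_iff]
  refine measure_mono_null (fun η hη => ?_) h3
  rw [Set.mem_ofPred_eq, ← glue_eq_overwrite]
  exact hη

/-- As a function of the boundary condition the kernel is not local, so weak convergence does not
apply to it. Opening all bonds outside the box of radius `k` gives the local, increasing upper
approximation `h k`, which converges almost surely by uniqueness of the infinite cluster. -/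
theorem IsWiredLimit.integral_prob_allOpen (hμ : C.IsWiredLimit β q μ) (hβ : 0 ≤ β) (hq : 1 ≤ q)
    (htol : C.IsTolerant μ) (huniq : ∀ᵐ ω ∂μ, C.UniqueInfinite ω) (Λ : Finset (Fin d → ℤ))
    (F : Finset C.Bond) : ∫ η, C.prob β q Λ η (C.allOpen F) ∂μ = μ.real (C.allOpen F) := by
  have := hμ.isProbabilityMeasure
  set A := C.allOpen F with hA
  have hAm : MeasurableSet A := C.measurableSet_allOpen F
  have hAup : IsUpperSet A := C.isUpperSet_allOpen F
  set h : ℕ → C.Config → ℝ := fun k η => C.prob β q Λ (η ⊔ C.openOff k) A with hh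
  have hdep : ∀ k, ∀ ω ω' : C.Config, (∀ e ∈ C.bondsIn (latticeBox d k), ω e = ω' e) →
      h k ω = h k ω' := by
    intro k ω ω' hag
    have : ω ⊔ C.openOff k = ω' ⊔ C.openOff k := by
      funext e
      by_cases he : e ∈ C.bondsIn (latticeBox d k)
      · rw [C.sup_openOff_of_mem he, C.sup_openOff_of_mem he, hag e he]
      · rw [C.sup_openOff_of_notMem he, C.sup_openOff_of_notMem he]
    simp only [hh, this]
  have hmono : ∀ k, Monotone (h k) := fun k ω ω' hω =>
    C.prob_mono_boundary hβ hq Λ _ (sup_le_sup_right hω _) hAup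
  have hmeas : ∀ k, Measurable (h k) := by
    intro k
    refine (C.measurable_prob β q Λ hAm).comp (measurable_pi_iff.2 fun e => ?_)
    by_cases he : e ∈ C.bondsIn (latticeBox d k)
    · simpa only [C.sup_openOff_of_mem he] using measurable_pi_apply e
    · simpa only [C.sup_openOff_of_notMem he] using measurable_const
  have hlim : Tendsto (fun k => ∫ η, h k η ∂μ) atTop (𝓝 (∫ η, C.prob β q Λ η A ∂μ)) := by
    refine tendsto_integral_of_dominated_convergence (fun _ => 1)
      (fun k => (hmeas k).aestronglyMeasurable) (integrable_const _) (fun k => ?_) ?_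
    · refine Eventually.of_forall fun η => ?_
      rw [Real.norm_of_nonneg (C.prob_nonneg hβ hq _ _ _)]
      exact C.prob_le_one hβ hq _ _ _
    · filter_upwards [hμ.ae_uniqueInfinite_glue htol huniq Λ] with η hη
      exact tendsto_nhds_of_eventually_eq (C.eventually_prob_sup_openOff_eq β q Λ hη F)
  obtain ⟨M₀, hM₀⟩ := exists_subset_latticeBox Λ
  refine le_antisymm ?_ ?_
  -- Under the wired measure of the box of radius `M` the bonds outside are open anyway, so there `h
  -- M` is the kernel itself and consistency applies.
  · have key : ∀ M, M₀ ≤ M → ∫ η, h M η ∂μ ≤ C.prob β q (latticeBox d M) (fun _ => true) A := by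
      intro M hM
      refine le_of_tendsto (hμ.tendsto_expect _ (hdep M))
        (Filter.Eventually.filter_mono Nat.hyperfilter_le_atTop ?_)
      filter_upwards [eventually_ge_atTop M] with M' hM'
      rw [← C.expect_prob hβ hq Λ _ (hM₀.trans (latticeBox_mono hM)),
        ← C.expect_expect hβ hq (latticeBox_mono hM'),
        ← C.expect_const hβ hq (latticeBox d M') (fun _ => true)
          (C.expect β q (latticeBox d M) (fun _ => true) fun ω => C.prob β q Λ ω A)]
      refine C.expect_mono hβ hq _ _ fun ω _ => ?_
      refine (C.expect_mono_boundary hβ hq _ (fun e => Bool.le_true (ω e)) (hmono M)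
        fun ω => C.prob_nonneg hβ hq _ _ _).trans ?_
      refine C.expect_mono hβ hq _ _ fun ω' hω' => le_of_eq ?_
      have : ω' ⊔ C.openOff M = ω' := by
        funext e
        by_cases he : e ∈ C.bondsIn (latticeBox d M)
        · exact C.sup_openOff_of_mem he
        · rw [C.sup_openOff_of_notMem he, hω' e he]
      simp only [hh, this]
    refine le_of_tendsto_of_tendsto (hlim.mono_left Nat.hyperfilter_le_atTop)
      (hμ.tendsto A (C.isLocal_allOpen F))
      (Filter.Eventually.filter_mono Nat.hyperfilter_le_atTop ?_)
    filter_upwards [eventually_ge_atTop M₀] with M hM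
    exact key M hM
  -- Consistency in a large box together with kernel ≤ `h k`; first the box grows with `k` fixed,
  -- then `k` tends to infinity.
  · refine ge_of_tendsto hlim (Eventually.of_forall fun k => ?_)
    refine le_of_tendsto_of_tendsto (hμ.tendsto A (C.isLocal_allOpen F))
      (hμ.tendsto_expect _ (hdep k))
      (Filter.Eventually.filter_mono Nat.hyperfilter_le_atTop ?_)
    filter_upwards [eventually_ge_atTop M₀] with M hM
    rw [← C.expect_prob hβ hq Λ _ (hM₀.trans (latticeBox_mono hM))]
    exact C.expect_mono hβ hq _ _ fun ω _ =>
      C.prob_mono_boundary hβ hq Λ ω (le_sup_left : ω ≤ ω ⊔ C.openOff k) hAup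

/-- The mixture of the kernels over `μ` is a probability measure agreeing with `μ` on the π-system,
hence everywhere. -/
theorem IsWiredLimit.integral_prob (hμ : C.IsWiredLimit β q μ) (hβ : 0 ≤ β) (hq : 1 ≤ q)
    (htol : C.IsTolerant μ) (huniq : ∀ᵐ ω ∂μ, C.UniqueInfinite ω) (Λ : Finset (Fin d → ℤ))
    {A : Set C.Config} (hA : MeasurableSet A) :
    ∫ η, C.prob β q Λ η A ∂μ = μ.real A := by
  have := hμ.isProbabilityMeasure
  have hfv : ∀ η (A : Set C.Config),
      C.finiteVolume β q Λ η A = ENNReal.ofReal (C.prob β q Λ η A) := by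
    intro η A
    have := C.isProbabilityMeasure_finiteVolume hβ hq Λ η
    rw [← C.finiteVolume_real hβ hq, ofReal_measureReal]
  have hmeas : Measurable fun η => C.finiteVolume β q Λ η := by
    refine Measure.measurable_of_measurable_coe _ fun A hA => ?_
    simp only [hfv]
    exact (C.measurable_prob β q Λ hA).ennreal_ofReal
  have hbind : ∀ A, MeasurableSet A → (μ.bind fun η => C.finiteVolume β q Λ η) A =
      ENNReal.ofReal (∫ η, C.prob β q Λ η A ∂μ) := by
    intro A hA
    rw [Measure.bind_apply hA hmeas.aemeasurable, ofReal_integral_eq_lintegral_ofReal]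
    · simp only [hfv]
    · refine Integrable.of_bound (C := 1) (C.measurable_prob β q Λ hA).aestronglyMeasurable
        (Eventually.of_forall fun η => ?_)
      rw [Real.norm_of_nonneg (C.prob_nonneg hβ hq _ _ _)]
      exact C.prob_le_one hβ hq _ _ _
    · exact Eventually.of_forall fun η => C.prob_nonneg hβ hq _ _ _
  have hprob : IsProbabilityMeasure (μ.bind fun η => C.finiteVolume β q Λ η) := by
    refine ⟨?_⟩
    rw [hbind _ MeasurableSet.univ]
    simp [C.prob_univ hβ hq]
  have heq : (μ.bind fun η => C.finiteVolume β q Λ η) = μ := by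
    refine C.ext_of_allOpen fun F => ?_
    rw [hbind _ (C.measurableSet_allOpen F), hμ.integral_prob_allOpen hβ hq htol huniq,
      ofReal_measureReal]
  have h1 := hbind A hA
  rw [heq] at h1
  rw [Measure.real, h1, ENNReal.toReal_ofReal]
  exact integral_nonneg fun η => C.prob_nonneg hβ hq _ _ _

theorem IsWiredLimit.isRandomCluster (hμ : C.IsWiredLimit β q μ) (hβ : 0 ≤ β) (hq : 1 ≤ q)
    (htol : C.IsTolerant μ) (huniq : ∀ᵐ ω ∂μ, C.UniqueInfinite ω) : C.IsRandomCluster β q μ := by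
  have := hμ.isProbabilityMeasure
  refine ⟨this, fun A hA Λ => ?_⟩
  simp only [C.finiteVolume_real hβ hq]
  have hint : Integrable (fun η => C.prob β q Λ η A) μ := by
    refine Integrable.of_bound (C := 1) (C.measurable_prob β q Λ hA).aestronglyMeasurable
      (Eventually.of_forall fun η => ?_)
    rw [Real.norm_of_nonneg (C.prob_nonneg hβ hq _ _ _)]
    exact C.prob_le_one hβ hq _ _ _
  refine (ae_eq_condExp_of_forall_setIntegral_eq (C.outside_le Λ)
    ((integrable_const (1 : ℝ)).indicator hA) (fun s _ _ => hint.integrableOn) ?_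
    (C.measurable_prob_outside β q Λ hA).stronglyMeasurable.aestronglyMeasurable).symm
  intro s hs _
  have hs' : MeasurableSet s := C.outside_le Λ s hs
  rw [← integral_indicator hs', setIntegral_indicator hA]
  have h1 : s.indicator (fun η => C.prob β q Λ η A) = fun η => C.prob β q Λ η (A ∩ s) := by
    funext η
    rw [C.prob_inter_of_outside Λ η fun ω ω' h => C.mem_of_measurableSet_outside hs h]
    by_cases hη : η ∈ s <;> simp [hη]
  rw [h1, hμ.integral_prob hβ hq htol huniq Λ (hA.inter hs'), Set.inter_comm]
  simp

end dlr

end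

end FiniteRangeCoupling

/-! ### Counting hubs in the Burton–Keane argument. -/

section

open Classical

/-- Disjoint pairs of sets that are pairwise disjoint or nested are at most as many as the points
they contain. -/
theorem Finset.card_le_of_laminar {ι α : Type*} [LinearOrder α] (I : Finset ι) (B : Finset α)
    (U V : ι → Finset α) (hU : ∀ i ∈ I, (U i).Nonempty) (hV : ∀ i ∈ I, (V i).Nonempty)
    (hUB : ∀ i ∈ I, U i ⊆ B) (hVB : ∀ i ∈ I, V i ⊆ B) (hUV : ∀ i ∈ I, Disjoint (U i) (V i))
    (h : ∀ i ∈ I, ∀ j ∈ I, i ≠ j → Disjoint (U i ∪ V i) (U j ∪ V j) ∨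
      (U i ∪ V i ⊆ U j ∨ U i ∪ V i ⊆ V j) ∨ (U j ∪ V j ⊆ U i ∨ U j ∪ V j ⊆ V i)) :
    I.card ≤ B.card := by
  -- The larger of the two minima lies in `U i ∪ V i` but is not its least element. If `U i ∪ V i`
  -- sits inside one side of pair `j` and `f i = f j`, then that value is the minimum of the side,
  -- yet the side contains a smaller point of pair `i`. So `f` is injective.
  set f : ∀ i, i ∈ I → α := fun i hi => max ((U i).min' (hU i hi)) ((V i).min' (hV i hi)) with hf
  have hfc : ∀ i hi, f i hi = (U i).min' (hU i hi) ∨ f i hi = (V i).min' (hV i hi) :=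
    fun i hi => max_choice _ _
  have hfmem : ∀ i hi, f i hi ∈ U i ∪ V i := by
    intro i hi
    rw [Finset.mem_union]
    rcases hfc i hi with h | h
    · exact Or.inl (by rw [h]; exact Finset.min'_mem _ _)
    · exact Or.inr (by rw [h]; exact Finset.min'_mem _ _)
  have hfU : ∀ i hi, f i hi ∈ U i → f i hi = (U i).min' (hU i hi) := by
    intro i hi hm
    rcases hfc i hi with h | h
    · exact h
    · exact absurd (by rw [h]; exact Finset.min'_mem _ _)
        (Finset.disjoint_left.1 (hUV i hi) hm)
  have hfV : ∀ i hi, f i hi ∈ V i → f i hi = (V i).min' (hV i hi) := by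
    intro i hi hm
    rcases hfc i hi with h | h
    · exact absurd hm (Finset.disjoint_left.1 (hUV i hi) (by rw [h]; exact Finset.min'_mem _ _))
    · exact h
  have hmin : ∀ i hi, ∃ b ∈ U i ∪ V i, b < f i hi := by
    intro i hi
    have hne : (U i).min' (hU i hi) ≠ (V i).min' (hV i hi) := fun he =>
      Finset.disjoint_left.1 (hUV i hi) (Finset.min'_mem _ _) (by rw [he]; exact Finset.min'_mem _ _)
    rcases lt_or_gt_of_ne hne with h | h
    · exact ⟨_, Finset.mem_union_left _ (Finset.min'_mem _ _), lt_max_of_lt_right h⟩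
    · exact ⟨_, Finset.mem_union_right _ (Finset.min'_mem _ _), lt_max_of_lt_left h⟩
  have hnest : ∀ i hi j hj, (U i ∪ V i ⊆ U j ∨ U i ∪ V i ⊆ V j) → f i hi ≠ f j hj := by
    intro i hi j hj hsub heq
    obtain ⟨b, hb, hlt⟩ := hmin i hi
    rcases hsub with hs | hs
    · have h1 := hfU j hj (heq ▸ hs (hfmem i hi))
      rw [heq, h1] at hlt
      exact absurd (Finset.min'_le _ _ (hs hb)) (not_le.2 hlt)
    · have h1 := hfV j hj (heq ▸ hs (hfmem i hi))
      rw [heq, h1] at hlt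
      exact absurd (Finset.min'_le _ _ (hs hb)) (not_le.2 hlt)
  refine Finset.card_le_card_of_forall_subsingleton (fun i b => ∃ hi, f i hi = b) ?_ ?_
  · intro i hi
    exact ⟨f i hi, Finset.union_subset (hUB i hi) (hVB i hi) (hfmem i hi), hi, rfl⟩
  · rintro b - i ⟨-, hi, hib⟩ j ⟨-, hj, hjb⟩
    by_contra hij
    have heq : f i hi = f j hj := hib.trans hjb.symm
    rcases h i hi j hj hij with hd | hs | hs
    · exact Finset.disjoint_left.1 hd (hfmem i hi) (heq ▸ hfmem j hj)
    · exact hnest i hi j hj hs heq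
    · exact hnest j hj i hi hs heq.symm

namespace SimpleGraph

variable {V : Type*} {G : SimpleGraph V}

theorem within_mono {S T : Set V} (h : S ⊆ T) : G.within S ≤ G.within T :=
  fun _ _ hab => ⟨hab.1, h hab.2.1, h hab.2.2⟩

/-- A branch at `S` that does not meet `T` is connected to `S` off `T`. -/
theorem branch_subset {S T : Set V} (hST : Disjoint S T)
    (hS : ∀ x ∈ S, ∀ y ∈ S, (G.within S).Reachable x y) {x s₀ s : V} (hs₀ : s₀ ∈ S) (hs : s ∈ S)
    (hsx : G.Adj s x) (hx : ∀ z, (G.within Sᶜ).Reachable x z → z ∉ T) {y : V}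
    (hy : (G.within Sᶜ).Reachable x y) : (G.within Tᶜ).Reachable s₀ y := by
  have h1 : (G.within Tᶜ).Reachable s₀ s :=
    (hS s₀ hs₀ s hs).mono (within_mono fun z hz => Set.disjoint_left.1 hST hz)
  have h2 : (G.within Tᶜ).Reachable s x :=
    Adj.reachable ⟨hsx, Set.disjoint_left.1 hST hs, hx x (.refl _)⟩
  have h3 : y ∈ {z | (G.within Sᶜ).Reachable x z ∧ (G.within Tᶜ).Reachable x z} := by
    refine hy.mem_of_closed ⟨.refl _, .refl _⟩ ?_
    rintro u v ⟨hu, hu'⟩ huv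
    have hv := hu.trans huv.reachable
    exact ⟨hv, hu'.trans (Adj.reachable ⟨huv.1, hx u hu, hx v hv⟩)⟩
  exact h1.trans (h2.trans h3.2)

theorem notMem_branch_of_notMem {S T : Set V} (hST : Disjoint S T)
    (hT : ∀ x ∈ T, ∀ y ∈ T, (G.within T).Reachable x y) {x t₀ : V} (ht₀ : t₀ ∈ T)
    (hx : ¬ (G.within Sᶜ).Reachable x t₀) {z : V} (hz : (G.within Sᶜ).Reachable x z) : z ∉ T := by
  intro hzT
  exact hx (hz.trans ((hT z hzT t₀ ht₀).mono
    (within_mono fun w hw => Set.disjoint_right.1 hST hw)))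

/-- The point `r` acts as a root. The branch of `S` through `r` is not that of `a`, so it misses
`T`, and a branch of `T` meeting `S` would reach `r` through it. A branch of `T` without `r` thus
misses `S`, and it hangs off `T`, which lies in the branch of `a`. -/
theorem branch_nested {S T : Set V} (hST : Disjoint S T)
    (hS : ∀ x ∈ S, ∀ y ∈ S, (G.within S).Reachable x y)
    (hT : ∀ x ∈ T, ∀ y ∈ T, (G.within T).Reachable x y) {s₀ t₀ t a x r : V} (hs₀ : s₀ ∈ S)
    (ht₀ : t₀ ∈ T) (hat : (G.within Sᶜ).Reachable a t₀) (hrS : r ∉ S)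
    (hra : ¬ (G.within Sᶜ).Reachable a r) (hr : G.Reachable s₀ r) (ht : t ∈ T) (htx : G.Adj t x)
    (hrx : ¬ (G.within Tᶜ).Reachable x r) {y : V} (hy : (G.within Tᶜ).Reachable x y) :
    (G.within Sᶜ).Reachable a y := by
  have hxs : ¬ (G.within Tᶜ).Reachable x s₀ := by
    intro hxs
    obtain ⟨u, v, hru, -, hv, huv⟩ := hr.symm.exists_exit (S := Sᶜ) hrS (by simpa using hs₀)
    have hv' : v ∈ S := by simpa using hv
    have hut : ¬ (G.within Sᶜ).Reachable u t₀ := fun h => hra (hat.trans (hru.trans h).symm)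
    exact hrx (hxs.trans (branch_subset hST hS hs₀ hv' huv.symm
      (fun z hz => notMem_branch_of_notMem hST hT ht₀ hut hz) hru.symm))
  exact hat.trans (branch_subset hST.symm hT ht₀ ht htx
    (fun z hz => notMem_branch_of_notMem hST.symm hS hs₀ hxs hz) hy)

/-- `S` is a hub with respect to `B`: it is connected, and its removal leaves at least three
branches at `S` that meet `B`. -/
structure IsHub (G : SimpleGraph V) (B : Finset V) (S : Set V) : Prop where
  connected : ∀ x ∈ S, ∀ y ∈ S, (G.within S).Reachable x y
  disjoint : ∀ b ∈ B, b ∉ S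
  branches : ∃ p : Fin 3 → V, (∀ i, ∃ s ∈ S, G.Adj s (p i)) ∧
    (∀ i, ∃ b ∈ B, (G.within Sᶜ).Reachable (p i) b) ∧
    ∀ i j, i ≠ j → ¬ (G.within Sᶜ).Reachable (p i) (p j)

/-- A function that picks from each component a vertex of `B`, if there is one. -/
noncomputable def pickRoot (G : SimpleGraph V) (B : Finset V) (c : G.ConnectedComponent) : V :=
  if h : ∃ b ∈ B, G.connectedComponentMk b = c then h.choose else c.exists_rep.choose

theorem pickRoot_mem {B : Finset V} {c : G.ConnectedComponent}
    (h : ∃ b ∈ B, G.connectedComponentMk b = c) : G.pickRoot B c ∈ B := by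
  rw [pickRoot, dif_pos h]
  exact h.choose_spec.1

theorem pickRoot_reachable {B : Finset V} {x : V}
    (h : ∃ b ∈ B, G.connectedComponentMk b = G.connectedComponentMk x) :
    G.Reachable x (G.pickRoot B (G.connectedComponentMk x)) := by
  rw [pickRoot, dif_pos h]
  exact (ConnectedComponent.eq.1 h.choose_spec.2).symm

/-- Distinct branches are disjoint, so at most one of three contains the root of the component. The
root depends only on the component, so all hubs in it are oriented consistently. -/
theorem IsHub.exists_two_branches {B : Finset V} {S : Set V} (h : G.IsHub B S) :
    ∃ s₀ ∈ S, ∃ a b : V, (∃ s ∈ S, G.Adj s a) ∧ (∃ s ∈ S, G.Adj s b) ∧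
      (∃ y ∈ B, (G.within Sᶜ).Reachable a y) ∧ (∃ y ∈ B, (G.within Sᶜ).Reachable b y) ∧
      ¬ (G.within Sᶜ).Reachable a b ∧
      G.Reachable s₀ (G.pickRoot B (G.connectedComponentMk s₀)) ∧
      G.pickRoot B (G.connectedComponentMk s₀) ∈ B ∧
      ¬ (G.within Sᶜ).Reachable a (G.pickRoot B (G.connectedComponentMk s₀)) ∧
      ¬ (G.within Sᶜ).Reachable b (G.pickRoot B (G.connectedComponentMk s₀)) := by
  obtain ⟨p, hadj, hB, hdisj⟩ := h.branches
  obtain ⟨s₀, hs₀, hs₀p⟩ := hadj 0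
  obtain ⟨b₀, hb₀, hr₀⟩ := hB 0
  have hex : ∃ b ∈ B, G.connectedComponentMk b = G.connectedComponentMk s₀ :=
    ⟨b₀, hb₀, ConnectedComponent.eq.2
      (hs₀p.reachable.trans (hr₀.mono (within_le _ _))).symm⟩
  set r := G.pickRoot B (G.connectedComponentMk s₀) with hr
  have key : ∀ i j, i ≠ j → (G.within Sᶜ).Reachable (p i) r → ¬ (G.within Sᶜ).Reachable (p j) r :=
    fun i j hij h1 h2 => hdisj i j hij (h1.trans h2.symm)
  have hpair : ∃ i j, i ≠ j ∧ ¬ (G.within Sᶜ).Reachable (p i) r ∧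
      ¬ (G.within Sᶜ).Reachable (p j) r := by
    by_cases h0 : (G.within Sᶜ).Reachable (p 0) r
    · exact ⟨1, 2, by decide, key 0 1 (by decide) h0, key 0 2 (by decide) h0⟩
    · by_cases h1 : (G.within Sᶜ).Reachable (p 1) r
      · exact ⟨0, 2, by decide, h0, key 1 2 (by decide) h1⟩
      · exact ⟨0, 1, by decide, h0, h1⟩
  obtain ⟨i, j, hij, hi, hj⟩ := hpair
  exact ⟨s₀, hs₀, p i, p j, hadj i, hadj j, hB i, hB j, hdisj i j hij, pickRoot_reachable hex,
    pickRoot_mem hex, hi, hj⟩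

/-- Each hub contributes the traces on `B` of two branches avoiding the root. For two hubs these
pairs are nested, when one hub lies in a chosen branch of the other, and otherwise disjoint, so the
laminar count applies. -/
theorem card_hubs_le [LinearOrder V] {ι : Type*} (I : Finset ι) (B : Finset V) (S : ι → Set V)
    (hub : ∀ i ∈ I, G.IsHub B (S i)) (hdisj : ∀ i ∈ I, ∀ j ∈ I, i ≠ j → Disjoint (S i) (S j)) :
    I.card ≤ B.card := by
  rcases I.eq_empty_or_nonempty with rfl | ⟨i₀, hi₀⟩
  · simp
  have : Nonempty V := ⟨(hub i₀ hi₀).exists_two_branches.choose⟩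
  have hex := fun (i : ι) (hi : i ∈ I) => (hub i hi).exists_two_branches
  choose! s₀ hs₀ a b ha hb haB hbB hab hreach hrB hra hrb using hex
  set U : ι → Finset V := fun i => B.filter fun y => (G.within (S i)ᶜ).Reachable (a i) y with hU
  set W : ι → Finset V := fun i => B.filter fun y => (G.within (S i)ᶜ).Reachable (b i) y with hW
  have hnest : ∀ i ∈ I, ∀ j ∈ I, i ≠ j → ∀ c, ((c = a i) ∨ (c = b i)) →
      (G.within (S i)ᶜ).Reachable c (s₀ j) →
      ∀ y ∈ U j ∪ W j, (G.within (S i)ᶜ).Reachable c y := by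
    intro i hi j hj hij c hc hcj y hy
    have hci : ∃ s ∈ S i, G.Adj s c := by
      rcases hc with rfl | rfl
      exacts [ha i hi, hb i hi]
    have hcr : ¬ (G.within (S i)ᶜ).Reachable c (G.pickRoot B (G.connectedComponentMk (s₀ i))) := by
      rcases hc with rfl | rfl
      exacts [hra i hi, hrb i hi]
    have hcomp : G.connectedComponentMk (s₀ i) = G.connectedComponentMk (s₀ j) := by
      obtain ⟨s, hs, hsc⟩ := hci
      exact ConnectedComponent.eq.2
        ((((hub i hi).connected _ (hs₀ i hi) s hs).mono (within_le _ _)).trans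
          (hsc.reachable.trans (hcj.mono (within_le _ _))))
    rcases Finset.mem_union.1 hy with hy | hy
    · obtain ⟨t, ht, hta⟩ := ha j hj
      exact branch_nested (hdisj i hi j hj hij) (hub i hi).connected (hub j hj).connected
        (hs₀ i hi) (hs₀ j hj) hcj ((hub i hi).disjoint _ (hrB i hi)) hcr (hreach i hi) ht hta
        (hcomp ▸ hra j hj) (Finset.mem_filter.1 hy).2
    · obtain ⟨t, ht, htb⟩ := hb j hj
      exact branch_nested (hdisj i hi j hj hij) (hub i hi).connected (hub j hj).connected
        (hs₀ i hi) (hs₀ j hj) hcj ((hub i hi).disjoint _ (hrB i hi)) hcr (hreach i hi) ht htb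
        (hcomp ▸ hrb j hj) (Finset.mem_filter.1 hy).2
  have hsubB : ∀ i ∈ I, ∀ j ∈ I, U j ∪ W j ⊆ B := fun i _ j _ =>
    Finset.union_subset (Finset.filter_subset _ _) (Finset.filter_subset _ _)
  refine Finset.card_le_of_laminar I B U W ?_ ?_ (fun i _ => Finset.filter_subset _ _)
    (fun i _ => Finset.filter_subset _ _) ?_ ?_
  · intro i hi
    obtain ⟨y, hy, hr⟩ := haB i hi
    exact ⟨y, Finset.mem_filter.2 ⟨hy, hr⟩⟩
  · intro i hi
    obtain ⟨y, hy, hr⟩ := hbB i hi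
    exact ⟨y, Finset.mem_filter.2 ⟨hy, hr⟩⟩
  · intro i hi
    rw [Finset.disjoint_left]
    intro y h1 h2
    exact hab i hi ((Finset.mem_filter.1 h1).2.trans (Finset.mem_filter.1 h2).2.symm)
  · intro i hi j hj hij
    by_cases h1 : (G.within (S i)ᶜ).Reachable (a i) (s₀ j)
    · exact Or.inr (Or.inr (Or.inl fun y hy => Finset.mem_filter.2
        ⟨hsubB i hi j hj hy, hnest i hi j hj hij _ (Or.inl rfl) h1 y hy⟩))
    by_cases h2 : (G.within (S i)ᶜ).Reachable (b i) (s₀ j)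
    · exact Or.inr (Or.inr (Or.inr fun y hy => Finset.mem_filter.2
        ⟨hsubB i hi j hj hy, hnest i hi j hj hij _ (Or.inr rfl) h2 y hy⟩))
    by_cases h3 : (G.within (S j)ᶜ).Reachable (a j) (s₀ i)
    · exact Or.inr (Or.inl (Or.inl fun y hy => Finset.mem_filter.2
        ⟨hsubB j hj i hi hy, hnest j hj i hi hij.symm _ (Or.inl rfl) h3 y hy⟩))
    by_cases h4 : (G.within (S j)ᶜ).Reachable (b j) (s₀ i)
    · exact Or.inr (Or.inl (Or.inr fun y hy => Finset.mem_filter.2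
        ⟨hsubB j hj i hi hy, hnest j hj i hi hij.symm _ (Or.inr rfl) h4 y hy⟩))
    left
    have hd := hdisj i hi j hj hij
    have hout : ∀ y ∈ U i ∪ W i, (G.within (S j)ᶜ).Reachable (s₀ i) y := by
      intro y hy
      rcases Finset.mem_union.1 hy with hy | hy
      · obtain ⟨s, hs, hsa⟩ := ha i hi
        exact branch_subset hd (hub i hi).connected (hs₀ i hi) hs hsa
          (fun z hz => notMem_branch_of_notMem hd (hub j hj).connected (hs₀ j hj) h1 hz)
          (Finset.mem_filter.1 hy).2
      · obtain ⟨s, hs, hsb⟩ := hb i hi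
        exact branch_subset hd (hub i hi).connected (hs₀ i hi) hs hsb
          (fun z hz => notMem_branch_of_notMem hd (hub j hj).connected (hs₀ j hj) h2 hz)
          (Finset.mem_filter.1 hy).2
    rw [Finset.disjoint_left]
    intro y hy hy'
    rcases Finset.mem_union.1 hy' with hy' | hy'
    · exact h3 ((Finset.mem_filter.1 hy').2.trans (hout y hy).symm)
    · exact h4 ((Finset.mem_filter.1 hy').2.trans (hout y hy).symm)

end SimpleGraph

end

/-! ### Infinite hubs: invariance, measurability, passage to a shell. -/

namespace SimpleGraph

variable {V W : Type*} {G : SimpleGraph V}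

/-- `S` is connected, and its removal leaves at least three infinite branches at `S`. -/
structure IsInfiniteHub (G : SimpleGraph V) (S : Set V) : Prop where
  connected : ∀ x ∈ S, ∀ y ∈ S, (G.within S).Reachable x y
  branches : ∃ p : Fin 3 → V, (∀ i, ∃ s ∈ S, G.Adj s (p i)) ∧
    (∀ i, {y | (G.within Sᶜ).Reachable (p i) y}.Infinite) ∧
    ∀ i j, i ≠ j → ¬ (G.within Sᶜ).Reachable (p i) (p j)

theorem within_reachable_iff {G' : SimpleGraph W} (φ : G ≃g G') {S : Set V} {T : Set W}
    (h : ∀ x, φ x ∈ T ↔ x ∈ S) (x y : V) :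
    (G'.within T).Reachable (φ x) (φ y) ↔ (G.within S).Reachable x y :=
  Iso.reachable_iff (φ := (⟨φ.toEquiv, fun {a b} => and_congr φ.map_adj_iff
    (and_congr (h a) (h b))⟩ : G.within S ≃g G'.within T))

theorem IsInfiniteHub.map {G' : SimpleGraph W} (φ : G ≃g G') {S : Set V} {T : Set W}
    (h : ∀ x, φ x ∈ T ↔ x ∈ S) (hS : G.IsInfiniteHub S) : G'.IsInfiniteHub T := by
  have hc : ∀ x, φ x ∈ Tᶜ ↔ x ∈ Sᶜ := fun x => not_congr (h x)
  constructor
  · intro x hx y hy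
    obtain ⟨x, rfl⟩ := φ.surjective x
    obtain ⟨y, rfl⟩ := φ.surjective y
    exact (within_reachable_iff φ h x y).2 (hS.connected x ((h x).1 hx) y ((h y).1 hy))
  · obtain ⟨p, hadj, hinf, hdis⟩ := hS.branches
    refine ⟨fun i => φ (p i), fun i => ?_, fun i => ?_, fun i j hij => ?_⟩
    · obtain ⟨s, hs, hsp⟩ := hadj i
      exact ⟨φ s, (h s).2 hs, φ.map_adj_iff.2 hsp⟩
    · refine ((hinf i).image φ.injective.injOn).mono ?_
      rintro _ ⟨y, hy, rfl⟩
      exact (within_reachable_iff φ hc _ _).2 hy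
    · exact fun hr => hdis i j hij ((within_reachable_iff φ hc _ _).1 hr)

/-- Off `S`, the cluster is a union of finitely many branches at `S`, so one of them is infinite. -/
theorem exists_infinite_branch {S : Set V} (hfin : {v | ∃ s ∈ S, G.Adj s v}.Finite)
    (hS : S.Finite) {x : V} (hx : x ∈ S) (hinf : {y | G.Reachable x y}.Infinite) :
    ∃ u, (∃ s ∈ S, G.Adj s u) ∧ G.Reachable x u ∧
      {y | (G.within Sᶜ).Reachable u y}.Infinite := by
  by_contra hcon
  push Not at hcon
  refine hinf (((hfin.inter_of_left {u | G.Reachable x u}).biUnion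
    (t := fun u => {y | (G.within Sᶜ).Reachable u y}) ?_).union hS |>.subset ?_)
  · rintro u ⟨⟨s, hs, hsu⟩, hxu⟩
    exact hcon u ⟨s, hs, hsu⟩ hxu
  · intro y hy
    by_cases hyS : y ∈ S
    · exact Or.inr hyS
    · obtain ⟨u, v, hyu, -, hv, huv⟩ := hy.symm.exists_exit (S := Sᶜ) hyS (by simpa using hx)
      exact Or.inl (Set.mem_biUnion (x := u) ⟨⟨v, by simpa using hv, huv.symm⟩,
        hy.trans (hyu.mono (within_le _ _))⟩ hyu.symm)

end SimpleGraph

namespace FiniteRangeCoupling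

section

open Classical Filter Topology symmDiff

variable {d : ℕ} (C : FiniteRangeCoupling d)

theorem inInfinite_iff {ω : C.Config} {x : Fin d → ℤ} :
    C.InInfinite ω x ↔ (C.cluster ω x).Infinite := by
  constructor
  · intro h hfin
    obtain ⟨M, hM⟩ := exists_subset_latticeBox hfin.toFinset
    obtain ⟨x', hx', y, hy, hr⟩ := h M
    obtain rfl : x' = x := hx'
    exact hy (hM (hfin.mem_toFinset.2 hr))
  · intro h k
    by_contra hk
    refine h ((latticeBox d k).finite_toSet.subset fun y hy => ?_)
    by_contra hy'
    exact hk ⟨x, rfl, y, hy', hy⟩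

/-- Translation, as an isomorphism of the graphs of open bonds. -/
def shiftIso (v : Fin d → ℤ) (ω : C.Config) : C.openGraph (C.shift v ω) ≃g C.openGraph ω :=
  ⟨Equiv.addRight v, fun {a b} => C.adj_add_iff v ω a b⟩

theorem inInfinite_shift (v : Fin d → ℤ) (ω : C.Config) (x : Fin d → ℤ) :
    C.InInfinite (C.shift v ω) x ↔ C.InInfinite ω (x + v) := by
  rw [inInfinite_iff, inInfinite_iff]
  have : C.cluster ω (x + v) = (· + v) '' C.cluster (C.shift v ω) x := by
    ext y
    constructor
    · intro hy
      refine ⟨y - v, ?_, sub_add_cancel y v⟩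
      rw [mem_cluster, ← reachable_add_iff, sub_add_cancel]
      exact hy
    · rintro ⟨y, hy, rfl⟩
      exact (C.reachable_add_iff v ω x y).2 hy
  rw [this, Set.infinite_image_iff (add_left_injective v).injOn]

theorem uniqueInfinite_shift (v : Fin d → ℤ) (ω : C.Config) :
    C.UniqueInfinite (C.shift v ω) ↔ C.UniqueInfinite ω := by
  constructor
  · intro h x y hx hy
    have := h (x - v) (y - v) (by rwa [inInfinite_shift, sub_add_cancel])
      (by rwa [inInfinite_shift, sub_add_cancel])
    rwa [← reachable_add_iff, sub_add_cancel, sub_add_cancel] at this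
  · intro h x y hx hy
    rw [← reachable_add_iff]
    exact h _ _ ((C.inInfinite_shift v ω x).1 hx) ((C.inInfinite_shift v ω y).1 hy)

/-- The configuration in which all bonds that are not inside `S` are closed. -/
noncomputable def restrict (S : Set (Fin d → ℤ)) (ω : C.Config) : C.Config :=
  fun e => ω e && decide (∀ x ∈ e.1, x ∈ S)

theorem openGraph_restrict (S : Set (Fin d → ℤ)) (ω : C.Config) :
    C.openGraph (C.restrict S ω) = (C.openGraph ω).within S := by
  ext x y
  simp [openGraph, restrict, SimpleGraph.within]

theorem measurable_restrict (S : Set (Fin d → ℤ)) : Measurable (C.restrict S) := by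
  refine measurable_pi_iff.2 fun e => ?_
  by_cases h : ∀ x ∈ e.1, x ∈ S
  · have : (fun ω => C.restrict S ω e) = fun ω => ω e := by
      funext ω
      simpa [restrict] using fun _ => h
    rw [this]
    exact measurable_pi_apply e
  · simp only [restrict, h, decide_false, Bool.and_false]
    exact measurable_const

theorem measurableSet_within_reachable (S : Set (Fin d → ℤ)) (x y : Fin d → ℤ) :
    MeasurableSet {ω | ((C.openGraph ω).within S).Reachable x y} := by
  simp_rw [← openGraph_restrict]
  exact C.measurable_restrict S (C.measurableSet_reachable x y)

theorem measurableSet_adj (x y : Fin d → ℤ) : MeasurableSet {ω | (C.openGraph ω).Adj x y} := by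
  by_cases h : s(x, y) ∈ C.bondGraph.edgeSet
  · have : {ω | (C.openGraph ω).Adj x y} = (fun ω : C.Config => ω ⟨s(x, y), h⟩) ⁻¹' {true} := by
      ext ω
      exact ⟨fun h => h.2, fun h' => ⟨h, h'⟩⟩
    rw [this]
    exact measurable_pi_apply _ (measurableSet_singleton _)
  · have : {ω | (C.openGraph ω).Adj x y} = ∅ := by
      ext ω
      exact ⟨fun h' => h h'.1, fun h => h.elim⟩
    rw [this]
    exact MeasurableSet.empty

theorem measurableSet_within_infinite (S : Set (Fin d → ℤ)) (x : Fin d → ℤ) :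
    MeasurableSet {ω | {y | ((C.openGraph ω).within S).Reachable x y}.Infinite} := by
  have : {ω | {y | ((C.openGraph ω).within S).Reachable x y}.Infinite} =
      C.restrict S ⁻¹' {ω | C.InInfinite ω x} := by
    ext ω
    simp only [Set.mem_ofPred_eq, Set.mem_preimage, inInfinite_iff, cluster, openGraph_restrict]
  rw [this]
  exact C.measurable_restrict S (C.measurableSet_inInfinite x)

theorem measurableSet_isInfiniteHub (S : Set (Fin d → ℤ)) :
    MeasurableSet {ω | (C.openGraph ω).IsInfiniteHub S} := by
  have : {ω | (C.openGraph ω).IsInfiniteHub S} =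
      (⋂ x ∈ S, ⋂ y ∈ S, {ω | ((C.openGraph ω).within S).Reachable x y}) ∩
      ⋃ p : Fin 3 → Fin d → ℤ, (⋂ i, ⋃ s ∈ S, {ω | (C.openGraph ω).Adj s (p i)}) ∩
        ((⋂ i, {ω | {y | ((C.openGraph ω).within Sᶜ).Reachable (p i) y}.Infinite}) ∩
        ⋂ i, ⋂ j, ⋂ _ : i ≠ j, {ω | ((C.openGraph ω).within Sᶜ).Reachable (p i) (p j)}ᶜ) := by
    ext ω
    simp only [Set.mem_ofPred_eq, Set.mem_inter_iff, Set.mem_iInter, Set.mem_iUnion,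
      Set.mem_compl_iff, exists_prop]
    exact ⟨fun h => ⟨h.connected, h.branches⟩, fun h => ⟨h.1, h.2⟩⟩
  rw [this]
  refine (MeasurableSet.biInter S.to_countable fun x _ => MeasurableSet.biInter S.to_countable
    fun y _ => C.measurableSet_within_reachable S x y).inter (MeasurableSet.iUnion fun p =>
    (MeasurableSet.iInter fun i => MeasurableSet.biUnion S.to_countable
      fun s _ => C.measurableSet_adj s (p i)).inter ((MeasurableSet.iInter fun i =>
        C.measurableSet_within_infinite Sᶜ (p i)).inter ?_))
  exact MeasurableSet.iInter fun i => MeasurableSet.iInter fun j => MeasurableSet.iInter fun _ =>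
    (C.measurableSet_within_reachable Sᶜ (p i) (p j)).compl

theorem isInfiniteHub_shift (v : Fin d → ℤ) (ω : C.Config) (K : ℕ)
    (h : (C.openGraph (C.shift v ω)).IsInfiniteHub (latticeBox d K)) :
    (C.openGraph ω).IsInfiniteHub (boxAt v K) := by
  refine h.map (C.shiftIso v ω) fun x => ?_
  change x + v ∈ (boxAt v K : Set (Fin d → ℤ)) ↔ x ∈ (latticeBox d K : Set (Fin d → ℤ))
  rw [Finset.mem_coe, Finset.mem_coe, mem_boxAt, mem_latticeBox]
  simp

/-- An infinite hub in a box yields a hub with respect to the shell around the box. -/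
theorem isHub_shell {r : ℕ} (hr : C.HasRange r) {M : ℕ} {ω : C.Config} {S : Set (Fin d → ℤ)}
    (hS : S ⊆ latticeBox d M) (h : (C.openGraph ω).IsInfiniteHub S) :
    (C.openGraph ω).IsHub (latticeBox d (M + r) \ latticeBox d M) S := by
  obtain ⟨p, hadj, hinf, hdis⟩ := h.branches
  refine ⟨h.connected, fun b hb hbS => (Finset.mem_sdiff.1 hb).2 (hS hbS), p, hadj, fun i => ?_,
    hdis⟩
  have hstep : ∀ u v, (C.openGraph ω).Adj u v → u ∈ latticeBox d M → v ∉ latticeBox d M →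
      v ∈ latticeBox d (M + r) \ latticeBox d M := by
    intro u v huv hu hv
    refine Finset.mem_sdiff.2 ⟨?_, hv⟩
    by_contra hv'
    exact C.notMem_latticeBox_of_adj hr huv.1 hv' le_rfl hu
  by_cases hp : p i ∈ latticeBox d M
  · have hex : ∃ y, ((C.openGraph ω).within Sᶜ).Reachable (p i) y ∧ y ∉ latticeBox d M := by
      by_contra hcon
      push Not at hcon
      exact hinf i ((latticeBox d M).finite_toSet.subset fun y hy => hcon y hy)
    obtain ⟨y, hy, hyM⟩ := hex
    obtain ⟨u, v, hpu, hu, hv, huv⟩ := hy.exists_exit (S := latticeBox d M) hp hyM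
    exact ⟨v, hstep u v huv.1 hu hv,
      (hpu.mono (SimpleGraph.within_le _ _)).trans (SimpleGraph.Adj.reachable huv)⟩
  · obtain ⟨s, hs, hsp⟩ := hadj i
    exact ⟨p i, hstep s _ hsp (hS hs) hp, .refl _⟩

end

end FiniteRangeCoupling

/-! ### Almost sure uniqueness of the infinite cluster in the plane. -/

namespace FiniteRangeCoupling

section

open Classical Filter Topology symmDiff

theorem sum_measureReal_le {Ω ι : Type*} [MeasurableSpace Ω] (μ : Measure Ω)
    [IsProbabilityMeasure μ] (s : Finset ι) {A : ι → Set Ω} (hA : ∀ i, MeasurableSet (A i)) {m : ℕ}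
    (h : ∀ ω, (s.filter fun i => ω ∈ A i).card ≤ m) : ∑ i ∈ s, μ.real (A i) ≤ m := by
  have hint : ∀ i ∈ s, Integrable ((A i).indicator (1 : Ω → ℝ)) μ := fun i _ =>
    (integrable_const (1 : ℝ)).indicator (hA i)
  calc ∑ i ∈ s, μ.real (A i) = ∑ i ∈ s, ∫ ω, (A i).indicator (1 : Ω → ℝ) ω ∂μ :=
        Finset.sum_congr rfl fun i _ => (integral_indicator_one (hA i)).symm
    _ = ∫ ω, ∑ i ∈ s, (A i).indicator (1 : Ω → ℝ) ω ∂μ := (integral_finsetSum s hint).symm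
    _ ≤ ∫ _, (m : ℝ) ∂μ := by
        refine integral_mono (integrable_finsetSum s hint) (integrable_const _) fun ω => ?_
        have : ∑ i ∈ s, (A i).indicator (1 : Ω → ℝ) ω = (s.filter fun i => ω ∈ A i).card := by
          rw [Finset.card_filter, Nat.cast_sum]
          exact Finset.sum_congr rfl fun i _ => by simp [Set.indicator_apply]
        change ∑ i ∈ s, (A i).indicator (1 : Ω → ℝ) ω ≤ m
        rw [this]
        exact_mod_cast h ω
    _ = m := by simp

theorem latticeNorm_single {d : ℕ} (i : Fin d) {c : ℤ} (hc : c = 1 ∨ c = -1) :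
    latticeNorm (Pi.single i c) = 1 := by
  rw [latticeNorm, Real.sqrt_eq_one, Finset.sum_eq_single i]
  · rcases hc with rfl | rfl <;> simp
  · intro j _ hj
    simp [hj]
  · simp

section general

variable {d : ℕ} (C : FiniteRangeCoupling d)

/-- If all bonds inside a box are open, then the box is connected. -/
theorem within_latticeBox_reachable_zero {K : ℕ} {ω : C.Config}
    (hω : ω ∈ C.allOpen (C.bondsIn (latticeBox d K))) {x : Fin d → ℤ} (hx : x ∈ latticeBox d K) :
    ((C.openGraph ω).within (latticeBox d K)).Reachable x 0 := by
  induction hn : ∑ i, (x i).natAbs using Nat.strong_induction_on generalizing x with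
  | _ n ih =>
  by_cases h0 : x = 0
  · rw [h0]
  obtain ⟨i, hi⟩ : ∃ i, x i ≠ 0 := by
    by_contra hcon
    push Not at hcon
    exact h0 (funext hcon)
  obtain ⟨c, hc, hlt⟩ : ∃ c : ℤ, (c = 1 ∨ c = -1) ∧ (x i + c).natAbs < (x i).natAbs := by
    rcases lt_or_gt_of_ne hi with h | h
    · exact ⟨1, Or.inl rfl, by omega⟩
    · exact ⟨-1, Or.inr rfl, by omega⟩
  set y := x + Pi.single i c with hy
  have hyi : y i = x i + c := by simp [hy]
  have hyj : ∀ j, j ≠ i → y j = x j := fun j hj => by simp [hy, hj]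
  have hyB : y ∈ latticeBox d K := by
    rw [mem_latticeBox] at hx ⊢
    intro j
    by_cases hj : j = i
    · subst hj
      rw [hyi]
      have h1 : |x j + c| ≤ |x j| := by
        rw [Int.abs_eq_natAbs, Int.abs_eq_natAbs]
        exact_mod_cast hlt.le
      exact h1.trans (hx j)
    · rw [hyj j hj]
      exact hx j
  have hbond : s(x, y) ∈ C.bondGraph.edgeSet := by
    refine ⟨fun hxy => ?_, ?_⟩
    · have : x i = y i := congrFun hxy i
      rw [hyi] at this
      omega
    · rw [hy, add_sub_cancel_left]
      exact C.nearest_pos _ (latticeNorm_single i hc)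
  have hadj : ((C.openGraph ω).within (latticeBox d K)).Adj x y :=
    ⟨⟨hbond, hω _ ((C.mem_bondsIn hbond).2 ⟨hx, hyB⟩)⟩, hx, hyB⟩
  refine hadj.reachable.trans (ih _ ?_ hyB rfl)
  rw [← hn]
  refine Finset.sum_lt_sum (fun j _ => ?_) ⟨i, Finset.mem_univ i, by rw [hyi]; exact hlt⟩
  by_cases hj : j = i
  · subst hj; rw [hyi]; exact hlt.le
  · rw [hyj j hj]

theorem within_compl_overwrite (Λ : Finset (Fin d → ℤ)) (ξ ω : C.Config) :
    (C.openGraph (C.overwrite (C.bondsIn Λ) ξ ω)).within (Λ : Set (Fin d → ℤ))ᶜ =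
      (C.openGraph ω).within (Λ : Set (Fin d → ℤ))ᶜ := by
  ext x y
  refine and_congr_left fun h => exists_congr fun hxy => ?_
  rw [overwrite, if_neg fun hh => h.1 ((C.mem_bondsIn hxy).1 hh).1]

/-- There are three distinct infinite clusters that meet `S`. -/
def ThreeInfinite (S : Set (Fin d → ℤ)) (ω : C.Config) : Prop :=
  ∃ p : Fin 3 → Fin d → ℤ, (∀ i, p i ∈ S) ∧ (∀ i, C.InInfinite ω (p i)) ∧
    ∀ i j, i ≠ j → ¬ (C.openGraph ω).Reachable (p i) (p j)

/-- Opening all bonds in a box that meets three infinite clusters creates an infinite hub. -/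
theorem isInfiniteHub_overwrite {K : ℕ} {ω : C.Config}
    (h : C.ThreeInfinite (latticeBox d K : Set (Fin d → ℤ)) ω) :
    (C.openGraph (C.overwrite (C.bondsIn (latticeBox d K)) (fun _ => true) ω)).IsInfiniteHub
      (latticeBox d K) := by
  set ω' := C.overwrite (C.bondsIn (latticeBox d K)) (fun _ => true) ω with hω'
  have hopen : ω' ∈ C.allOpen (C.bondsIn (latticeBox d K)) := fun e he => by
    simp [hω', overwrite, he]
  have hle : ω ≤ ω' := by
    intro e
    by_cases he : e ∈ C.bondsIn (latticeBox d K)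
    · rw [hopen e he]; exact Bool.le_true _
    · simp [hω', overwrite, he]
  refine ⟨fun x hx y hy => (C.within_latticeBox_reachable_zero hopen hx).trans
    (C.within_latticeBox_reachable_zero hopen hy).symm, ?_⟩
  obtain ⟨p, hp, hinf, hdis⟩ := h
  obtain ⟨r, -, hr⟩ := C.exists_hasRange
  have hfin : {v | ∃ s ∈ (latticeBox d K : Set (Fin d → ℤ)), (C.openGraph ω).Adj s v}.Finite := by
    refine (latticeBox d (K + r)).finite_toSet.subset ?_
    rintro v ⟨s, hs, hsv⟩
    by_contra hv
    exact C.notMem_latticeBox_of_adj hr hsv.1 hv le_rfl hs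
  have hex := fun i => SimpleGraph.exists_infinite_branch hfin (latticeBox d K).finite_toSet (hp i)
    (C.inInfinite_iff.1 (hinf i))
  choose u hadj hpu hu using hex
  refine ⟨u, fun i => ?_, fun i => ?_, fun i j hij => ?_⟩
  · obtain ⟨s, hs, hsu⟩ := hadj i
    exact ⟨s, hs, C.openGraph_mono hle hsu⟩
  · rw [hω', within_compl_overwrite]
    exact hu i
  · rw [hω', within_compl_overwrite]
    exact fun hr => hdis i j hij
      ((hpu i).trans ((hr.mono (SimpleGraph.within_le _ _)).trans (hpu j).symm))

end general

section planar

variable (C : FiniteRangeCoupling 2) {μ : Measure C.Config} [IsProbabilityMeasure μ]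

theorem card_shell (M r : ℕ) : (latticeBox 2 (M + r) \ latticeBox 2 M).card =
    4 * r * (2 * M + r + 1) := by
  rw [Finset.card_sdiff_of_subset (latticeBox_mono (Nat.le_add_right M r)), card_latticeBox,
    card_latticeBox]
  have : (2 * (M + r) + 1) ^ 2 = 4 * r * (2 * M + r + 1) + (2 * M + 1) ^ 2 := by ring
  rw [this, Nat.add_sub_cancel]

/-- Place `(2n+1)²` disjoint translates of the box, with spacing `2K+1`. The number of hubs among
them is at most the number of sites in a shell, of order `n`. By translation invariance the expected
number is `(2n+1)²` times the probability, which must therefore vanish. -/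
theorem measure_isInfiniteHub (hshift : ∀ v, μ.map (C.shift v) = μ) (K : ℕ) :
    μ.real {ω | (C.openGraph ω).IsInfiniteHub (latticeBox 2 K : Set (Fin 2 → ℤ))} = 0 := by
  obtain ⟨r, hr0, hr⟩ := C.exists_hasRange
  set H := {ω | (C.openGraph ω).IsInfiniteHub (latticeBox 2 K : Set (Fin 2 → ℤ))} with hH
  have hHm : MeasurableSet H := C.measurableSet_isInfiniteHub _
  set site : (Fin 2 → ℤ) → Fin 2 → ℤ := fun w i => (2 * K + 1) * w i with hsite
  have hle : ∀ n : ℕ, ((2 * n + 1) ^ 2 : ℝ) * μ.real H ≤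
      4 * r * (2 * ((2 * K + 1) * n + K) + r + 1) := by
    intro n
    set M := (2 * K + 1) * n + K with hM
    have hcount : ∀ ω, ((latticeBox 2 n).filter fun w => ω ∈ C.shift (site w) ⁻¹' H).card ≤
        (latticeBox 2 (M + r) \ latticeBox 2 M).card := by
      intro ω
      -- Any linear order serves; the laminar count only compares minima.
      let _ : LinearOrder (Fin 2 → ℤ) := linearOrderOfSTO WellOrderingRel
      refine SimpleGraph.card_hubs_le (G := C.openGraph ω) _ _
        (fun w => (boxAt (site w) K : Set (Fin 2 → ℤ))) ?_ ?_
      · intro w hw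
        obtain ⟨hwn, hwH⟩ := Finset.mem_filter.1 hw
        refine C.isHub_shell hr ?_ (C.isInfiniteHub_shift _ _ _ hwH)
        intro x hx
        rw [Finset.mem_coe, mem_latticeBox]
        intro i
        have h1 := abs_le.1 (mem_boxAt.1 (Finset.mem_coe.1 hx) i)
        have h2 := abs_le.1 (mem_latticeBox.1 hwn i)
        simp only [hsite] at h1
        rw [abs_le, hM]
        push_cast
        constructor <;> nlinarith
      · intro w _ w' _ hww
        obtain ⟨i, hi⟩ : ∃ i, w i ≠ w' i := by
          by_contra hcon
          push Not at hcon
          exact hww (funext hcon)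
        rw [Finset.disjoint_coe]
        refine disjoint_boxAt i ?_
        have h1 : 1 ≤ |w i - w' i| := Int.one_le_abs (sub_ne_zero.2 hi)
        simp only [hsite]
        rw [← mul_sub, abs_mul, abs_of_nonneg (by positivity : (0 : ℤ) ≤ 2 * K + 1)]
        nlinarith
    have h1 := sum_measureReal_le μ (latticeBox 2 n)
      (fun w => C.measurable_shift (site w) hHm) hcount
    have h2 : ∀ w, μ.real (C.shift (site w) ⁻¹' H) = μ.real H := fun w => by
      rw [← map_measureReal_apply (C.measurable_shift _) hHm, hshift]
    simp_rw [h2] at h1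
    rw [Finset.sum_const, card_latticeBox, card_shell, nsmul_eq_mul, hM] at h1
    exact_mod_cast h1
  have hH0 : 0 ≤ μ.real H := measureReal_nonneg
  refine le_antisymm (le_of_forall_pos_le_add fun ε hε => ?_) hH0
  obtain ⟨n, hn⟩ := exists_nat_gt ((4 * r * (2 * (2 * K + 1) + r + 1)) / ε : ℝ)
  rw [div_lt_iff₀ hε] at hn
  have h3 := hle n
  have hn0 : (0 : ℝ) ≤ n := n.cast_nonneg
  have hr0' : (0 : ℝ) ≤ r := r.cast_nonneg
  have hK0 : (0 : ℝ) ≤ K := K.cast_nonneg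
  have h4 : (4 * r * (2 * ((2 * K + 1) * n + K) + r + 1) : ℝ) ≤
      (2 * n + 1) * (4 * r * (2 * (2 * K + 1) + r + 1)) := by
    have : (2 * ((2 * K + 1) * n + K) + r + 1 : ℝ) ≤
        (2 * n + 1) * (2 * (2 * K + 1) + r + 1) := by nlinarith [mul_nonneg hK0 hn0, mul_nonneg hr0' hn0]
    calc _ ≤ 4 * r * ((2 * n + 1) * (2 * (2 * K + 1) + r + 1) : ℝ) := by gcongr
      _ = _ := by ring
  have h5 : (2 * n + 1 : ℝ) * μ.real H ≤ n * ε := by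
    have h6 : (2 * n + 1 : ℝ) * ((2 * n + 1) * μ.real H) ≤
        (2 * n + 1) * (4 * r * (2 * (2 * K + 1) + r + 1)) := by
      calc _ = (2 * n + 1 : ℝ) ^ 2 * μ.real H := by ring
        _ ≤ _ := h3.trans h4
    exact (le_of_mul_le_mul_left h6 (by positivity)).trans hn.le
  rw [zero_add]
  by_contra hcon
  push Not at hcon
  nlinarith

/-- Opening a box that meets three infinite clusters creates an infinite hub, a null event; by
tolerance the original event is null too. -/
theorem ae_not_threeInfinite (hshift : ∀ v, μ.map (C.shift v) = μ) (htol : C.IsTolerant μ) :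
    ∀ᵐ ω ∂μ, ¬ C.ThreeInfinite Set.univ ω := by
  have hK : ∀ K, ∀ᵐ ω ∂μ, ¬ C.ThreeInfinite (latticeBox 2 K : Set (Fin 2 → ℤ)) ω := by
    intro K
    obtain ⟨c, -, hc⟩ := htol (C.bondsIn (latticeBox 2 K)) (fun _ => true)
    have h1 := hc _ (C.measurableSet_isInfiniteHub (latticeBox 2 K : Set (Fin 2 → ℤ)))
    rw [C.measure_isInfiniteHub hshift, mul_zero] at h1
    have h2 := (measureReal_eq_zero_iff).1 (le_antisymm h1 measureReal_nonneg)
    refine measure_mono_null (fun ω hω => ?_) h2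
    exact C.isInfiniteHub_overwrite (not_not.1 hω)
  filter_upwards [ae_all_iff.2 hK] with ω hω h
  obtain ⟨p, -, hinf, hdis⟩ := h
  obtain ⟨K, hp⟩ := exists_subset_latticeBox (Finset.univ.image p)
  exact hω K ⟨p, fun i => hp (Finset.mem_image_of_mem _ (Finset.mem_univ i)), hinf, hdis⟩

/-- If there are at most two infinite clusters and a box meets two of them, then opening the bonds
in the box makes the infinite cluster unique. -/
theorem uniqueInfinite_overwrite {K : ℕ} {ω : C.Config} (h3 : ¬ C.ThreeInfinite Set.univ ω)
    {a b : Fin 2 → ℤ} (ha : a ∈ latticeBox 2 K) (hb : b ∈ latticeBox 2 K) (hia : C.InInfinite ω a)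
    (hib : C.InInfinite ω b) (hab : ¬ (C.openGraph ω).Reachable a b) :
    C.UniqueInfinite (C.overwrite (C.bondsIn (latticeBox 2 K)) (fun _ => true) ω) := by
  set ω' := C.overwrite (C.bondsIn (latticeBox 2 K)) (fun _ => true) ω with hω'
  have hopen : ω' ∈ C.allOpen (C.bondsIn (latticeBox 2 K)) := fun e he => by
    simp [hω', overwrite, he]
  have key : ∀ x, C.InInfinite ω' x → (C.openGraph ω').Reachable x 0 := by
    intro x hx
    by_cases hmeet : ∃ y ∈ latticeBox 2 K, y ∈ C.cluster ω' x
    · obtain ⟨y, hy, hxy⟩ := hmeet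
      exact SimpleGraph.Reachable.trans hxy
        ((C.within_latticeBox_reachable_zero hopen hy).mono (SimpleGraph.within_le _ _))
    · push Not at hmeet
      exfalso
      have heq : C.cluster ω x = C.cluster ω' x :=
        C.cluster_eq_of_agree (fun e he => by simp [hω', overwrite, he]) hmeet
      have hxa : ¬ (C.openGraph ω).Reachable x a := fun h => hmeet a ha (heq ▸ h)
      have hxb : ¬ (C.openGraph ω).Reachable x b := fun h => hmeet b hb (heq ▸ h)
      refine h3 ⟨![x, a, b], fun _ => trivial, ?_, ?_⟩
      · intro i
        fin_cases i
        · exact C.inInfinite_iff.2 (heq ▸ C.inInfinite_iff.1 hx)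
        · exact hia
        · exact hib
      · intro i j hij
        fin_cases i <;> fin_cases j <;> first
          | exact absurd rfl hij
          | assumption
          | exact fun h => hxa h.symm
          | exact fun h => hxb h.symm
          | exact fun h => hab h.symm
  exact fun x y hx hy => (key x hx).trans (key y hy).symm

theorem exists_shift_notMem (F : Finset C.Bond) (K : ℕ) :
    ∃ v, ∀ e ∈ F, C.shiftBond v e ∉ C.bondsIn (latticeBox 2 K) := by
  obtain ⟨M, hM⟩ := C.exists_subset_bondsIn F
  refine ⟨fun _ => M + K + 1, fun e he => ?_⟩
  have he' := hM he
  obtain ⟨e, hb⟩ := e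
  induction e using Sym2.ind with
  | _ x y =>
    have hb' : s(x + fun _ => (M + K + 1 : ℤ), y + fun _ => (M + K + 1 : ℤ)) ∈ C.bondGraph.edgeSet :=
      (C.shiftBond _ ⟨_, hb⟩).2
    rw [C.shiftBond_mk _ hb hb', mem_bondsIn]
    rintro ⟨hx, -⟩
    have h1 := abs_le.1 (mem_latticeBox.1 hx 0)
    have h2 := abs_le.1 (mem_latticeBox.1 ((C.mem_bondsIn hb).1 he').1 0)
    simp only [Pi.add_apply] at h1
    omega

/-- **Uniqueness of the infinite cluster** for translation invariant measures that tolerate local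
modifications. -/
theorem ae_uniqueInfinite (hshift : ∀ v, μ.map (C.shift v) = μ) (htol : C.IsTolerant μ) :
    ∀ᵐ ω ∂μ, C.UniqueInfinite ω := by
  set I : Set C.Config := {ω | C.UniqueInfinite ω}ᶜ with hI
  have hIm : MeasurableSet I := C.measurableSet_uniqueInfinite.compl
  set T : ℕ → Set C.Config := fun K => {ω | ∃ a ∈ latticeBox 2 K, ∃ b ∈ latticeBox 2 K,
    C.InInfinite ω a ∧ C.InInfinite ω b ∧ ¬ (C.openGraph ω).Reachable a b} with hT
  set N : Set C.Config := {ω | C.ThreeInfinite Set.univ ω} with hN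
  have hN0 : μ.real N = 0 := by
    rw [measureReal_eq_zero_iff]
    have := C.ae_not_threeInfinite hshift htol
    rw [ae_iff] at this
    simpa [hN] using this
  have hT0 : ∀ K, μ.real (T K) = 0 := by
    intro K
    set op := C.overwrite (C.bondsIn (latticeBox 2 K)) (fun _ => true) with hop
    obtain ⟨c, hc0, hc⟩ := htol (C.bondsIn (latticeBox 2 K)) (fun _ => true)
    refine le_antisymm (le_of_forall_pos_le_add fun ε hε => ?_) measureReal_nonneg
    -- Two infinite clusters are excluded by invariance, without ergodicity. Non-uniqueness `I` is
    -- close to a local event, which invariance allows to be moved away from the box. Opening the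
    -- box then leaves the shifted local event unchanged but destroys `I`. So one of the two
    -- configurations lies in the small symmetric difference, and tolerance controls both cases.
    obtain ⟨D, hD, hDI⟩ := C.exists_isLocal_measure_symmDiff_lt μ hIm
      (div_pos hε (by linarith : 0 < c + 1))
    have hDm := hD.measurableSet
    obtain ⟨F, hF⟩ := id hD
    obtain ⟨v, hv⟩ := C.exists_shift_notMem F K
    set E := C.shift v ⁻¹' (D ∆ I) with hE
    have hEm : MeasurableSet E := C.measurable_shift v (hDm.symmDiff hIm)
    have hEμ : μ.real E = μ.real (D ∆ I) := by
      rw [hE, ← map_measureReal_apply (C.measurable_shift _) (hDm.symmDiff hIm), hshift]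
    have hIinv : ∀ ω, C.shift v ω ∈ I ↔ ω ∈ I := fun ω =>
      not_congr (C.uniqueInfinite_shift v ω)
    have hsub : T K ⊆ N ∪ ({ω | op ω ∈ E} ∪ E) := by
      rintro ω ⟨a, ha, b, hb, hia, hib, hab⟩
      by_cases h3 : C.ThreeInfinite Set.univ ω
      · exact Or.inl h3
      right
      have hωI : ω ∈ I := fun hu => hab (hu a b hia hib)
      have hopI : op ω ∉ I := fun hn => hn (C.uniqueInfinite_overwrite h3 ha hb hia hib hab)
      by_cases hωD : C.shift v ω ∈ D
      · refine Or.inl (Or.inl ⟨hF _ _ (fun e he => ?_) hωD, fun h => hopI ((hIinv _).1 h)⟩)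
        simp [shift, hop, overwrite, hv e he]
      · exact Or.inr (Or.inr ⟨(hIinv ω).2 hωI, hωD⟩)
    calc μ.real (T K) ≤ μ.real (N ∪ ({ω | op ω ∈ E} ∪ E)) := measureReal_mono hsub
      _ ≤ μ.real N + (μ.real {ω | op ω ∈ E} + μ.real E) :=
          (measureReal_union_le _ _).trans (by gcongr; exact measureReal_union_le _ _)
      _ ≤ 0 + (c * μ.real E + μ.real E) := by
          rw [hN0]; gcongr; exact hc E hEm
      _ = (c + 1) * μ.real (D ∆ I) := by rw [hEμ]; ring
      _ ≤ (c + 1) * (ε / (c + 1)) := by gcongr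
      _ = 0 + ε := by rw [mul_div_cancel₀ _ (by linarith : c + 1 ≠ 0), zero_add]
  have hall : ∀ K, ∀ᵐ ω ∂μ, ω ∉ T K := fun K => by
    have := (measureReal_eq_zero_iff).1 (hT0 K)
    rw [ae_iff]
    simpa using this
  filter_upwards [ae_all_iff.2 hall] with ω hω x y hx hy
  by_contra hxy
  obtain ⟨K, hK⟩ := exists_subset_latticeBox ({x, y} : Finset (Fin 2 → ℤ))
  exact hω K ⟨x, hK (by simp), y, hK (by simp), hx, hy, hxy⟩

end planar

end

end FiniteRangeCoupling

/-! ### The wired arm probability vanishes; conclusion. -/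

namespace FiniteRangeCoupling

section

open Classical Filter Topology

variable (C : FiniteRangeCoupling 2) {β q : ℝ}

theorem tendsto_measureReal_connects_compl {P : Measure C.Config} [IsProbabilityMeasure P] {c₁ : ℝ}
    (hc₁ : 0 < c₁)
    (hdecay : ∀ x : Fin 2 → ℤ, P.real (C.connects {0} {x}) ≤ Real.exp (-c₁ * latticeNorm x)) :
    Tendsto (fun K => P.real (C.connects {0} {y | y ∉ latticeBox 2 K})) atTop (𝓝 0) := by
  obtain ⟨r, -, hr⟩ := C.exists_hasRange
  have hle : ∀ K : ℕ, P.real (C.connects {0} {y | y ∉ latticeBox 2 K}) ≤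
      (1 + 16 / c₁) ^ 2 * Real.exp (c₁ / 4 * r) * Real.exp (-(3 * c₁ / 4 * K)) := by
    intro K
    have hsub : C.connects {0} {y | y ∉ latticeBox 2 K} ⊆
        ⋃ x ∈ latticeBox 2 (K + r) \ latticeBox 2 K, C.connects {0} {x} := by
      rintro ω ⟨x, rfl, y, hy, hxy⟩
      have hyK : y ∉ (latticeBox 2 K : Set (Fin 2 → ℤ)) := hy
      obtain ⟨u, v, h0u, hu, hv, huv⟩ := hxy.exists_exit (by simp [mem_latticeBox]) hyK
      refine Set.mem_biUnion (x := v) ?_ ⟨0, rfl, v, rfl,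
        (h0u.mono (SimpleGraph.within_le _ _)).trans huv.reachable⟩
      refine Finset.mem_sdiff.2 ⟨?_, hv⟩
      by_contra hv'
      exact C.notMem_latticeBox_of_adj hr huv.1 hv' le_rfl hu
    calc _ ≤ P.real (⋃ x ∈ latticeBox 2 (K + r) \ latticeBox 2 K, C.connects {0} {x}) :=
          measureReal_mono hsub (measure_ne_top _ _)
      _ ≤ ∑ x ∈ latticeBox 2 (K + r) \ latticeBox 2 K, P.real (C.connects {0} {x}) :=
          measureReal_biUnion_finset_le _ _
      _ ≤ (1 + 16 / c₁) ^ 2 * Real.exp (c₁ / 4 * (K + r : ℕ)) * Real.exp (-c₁ * K) :=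
          C.sum_connects_le hc₁ hdecay K (K + r)
      _ = _ := by
          rw [mul_assoc, mul_assoc, ← Real.exp_add, ← Real.exp_add]
          push_cast
          ring_nf
  refine squeeze_zero (fun _ => measureReal_nonneg) hle ?_
  rw [← mul_zero ((1 + 16 / c₁) ^ 2 * Real.exp (c₁ / 4 * r))]
  exact (Real.tendsto_exp_neg_atTop_nhds_zero.comp
    (tendsto_natCast_atTop_atTop.const_mul_atTop (by positivity))).const_mul _

/-- At β = 0, where tolerance fails, every inner bond has opening probability 0; for `r ≤ L` all
bonds at the origin are inner bonds. -/
theorem arm_of_eq_zero {r : ℕ} (hr : C.HasRange r) {L : ℕ} (hL : r ≤ L) (q : ℝ) :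
    C.arm 0 q L = 0 := by
  rw [arm, prob, expect, Finset.sum_eq_zero, zero_div]
  intro ζ _
  by_cases h : C.glue (latticeBox 2 L) (fun _ => true) ζ ∈
      C.connects {0} {y | y ∉ latticeBox 2 L}
  · obtain ⟨x, rfl, y, hy, hxy⟩ := h
    have hy0 : y ∉ ({0} : Set (Fin 2 → ℤ)) := by
      rintro rfl
      exact hy (by simp [mem_latticeBox])
    obtain ⟨u, v, -, hu, hv, ⟨huv, ho⟩⟩ := hxy.exists_exit (S := {0}) rfl hy0
    obtain rfl : u = 0 := hu
    have hvL : v ∈ latticeBox 2 L := by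
      rw [mem_latticeBox]
      intro i
      have := hr 0 v huv i
      rw [Pi.zero_apply, sub_zero] at this
      exact this.trans (by exact_mod_cast hL)
    have hmem : (⟨s(0, v), huv⟩ : C.Bond) ∈ C.bondsIn (latticeBox 2 L) :=
      (C.mem_bondsIn huv).2 ⟨by simp [mem_latticeBox], hvL⟩
    rw [weight, Finset.prod_eq_zero hmem, zero_mul, zero_mul]
    rw [if_pos ho]
    simp [bondProb]
  · rw [Set.indicator_of_notMem h, mul_zero]

/-- The wired limit is a random cluster measure, hence equals `P`. For fixed `K`, leaving the box of
radius `K` is a local event, so its wired probability in some larger box is close to its small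
`P`-probability; monotonicity in the radius carries this to all larger `L`. -/
theorem tendsto_arm (hβ : 0 ≤ β) (hq : 1 ≤ q) {P : Measure C.Config}
    (hunique : ∀ P' : Measure C.Config, C.IsRandomCluster β q P' → P' = P) {c₁ : ℝ} (hc₁ : 0 < c₁)
    (hdecay : ∀ x : Fin 2 → ℤ, P.real (C.connects {0} {x}) ≤ Real.exp (-c₁ * latticeNorm x)) :
    Tendsto (C.arm β q) atTop (𝓝 0) := by
  rcases hβ.eq_or_lt with rfl | hβ0
  · obtain ⟨r, -, hr⟩ := C.exists_hasRange
    exact tendsto_const_nhds.congr' ((eventually_ge_atTop r).mono fun L hL =>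
      (C.arm_of_eq_zero hr hL q).symm)
  obtain ⟨μ, hμ⟩ := C.exists_isWiredLimit hβ hq
  have := hμ.isProbabilityMeasure
  have htol := hμ.isTolerant hq hβ0
  obtain rfl : μ = P := hunique μ (hμ.isRandomCluster hβ hq htol
    (C.ae_uniqueInfinite (hμ.map_shift hβ hq) htol))
  rw [Metric.tendsto_atTop]
  intro ε hε
  obtain ⟨K, hK⟩ :=
    ((C.tendsto_measureReal_connects_compl hc₁ hdecay).eventually_lt_const hε).exists
  obtain ⟨M, hM, hKM⟩ := (((hμ.tendsto _ (C.isLocal_connects_compl 0 (latticeBox 2 K))).eventually_lt_const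
    hK).and ((Nat.hyperfilter_le_atTop) (eventually_ge_atTop K))).exists
  refine ⟨M, fun L hL => ?_⟩
  rw [Real.dist_0_eq_abs, abs_of_nonneg (C.arm_nonneg hβ hq L)]
  refine ((C.arm_antitone hβ hq hL).trans ?_).trans_lt hM
  exact C.prob_mono hβ hq _ _ (C.connects_subset subset_rfl fun y (hy : y ∉ latticeBox 2 M) hy' =>
    hy (latticeBox_mono hKM hy'))

end

end FiniteRangeCoupling

theorem propositionA1 (C : FiniteRangeCoupling 2) (β q : ℝ) (hβ : 0 ≤ β) (hq : 1 ≤ q)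
    (P : Measure C.Config) (hP : C.IsRandomCluster β q P)
    (hunique : ∀ P' : Measure C.Config, C.IsRandomCluster β q P' → P' = P)
    (hdecay : ∃ c₁ : ℝ, 0 < c₁ ∧ ∀ x : Fin 2 → ℤ,
      P.real (C.connects {0} {x}) ≤ Real.exp (-c₁ * latticeNorm x)) :
    ∃ ν₀ ν₁ : ℝ, 0 < ν₀ ∧ 0 < ν₁ ∧ ∀ N : ℕ,
      (C.wired β q (latticeBox 2 N)).real
          (C.connects {0} {y | y ∉ latticeBox 2 N}) ≤
        ν₀ * Real.exp (-ν₁ * N) := by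
  obtain ⟨c₁, hc₁, hdec⟩ := hdecay
  obtain ⟨ν₀, ν₁, h₀, h₁, h⟩ :=
    C.exists_arm_le_exp hβ hq hP hc₁ hdec (C.tendsto_arm hβ hq hunique hc₁ hdec)
  refine ⟨ν₀, ν₁, h₀, h₁, fun N => ?_⟩
  rw [FiniteRangeCoupling.wired, C.finiteVolume_real hβ hq]
  exact h N
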